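/- Let $0<\alpha<1$, $\lambda\ge 0$, $\sigma>0$, $r>0$, $D\ge 0$, $T>0$, $x_l<x_r$, $\gamma\ge 1$, and put $c=r-D-\tfrac12\sigma^2$, $q=\frac{c^2}{2\sigma^2}+r$. Let $v$ solve $$ {}^{C}_0\mathbb{D}^{\alpha,\lambda}_{\tau}v=\tfrac12\sigma^2\,\partial_x^2v-qv+g \ \text{ on } (x_l,x_r)\times(0,T],\qquad v(x,0)=v_0(x)\ (x_l<x<x_r),\qquad v(x_l,\tau)=v(x_r,\tau)=0\ (0<\tau\le T), $$ where $$ {}^{C}_0\mathbb{D}^{\alpha,\lambda}_{\tau}v(x,\tau)=\frac{e^{-\lambda\tau}}{\Gamma(1-\alpha)}\int_0^\tau(\tau-\eta)^{-\alpha}\,\partial_\eta\big[e^{\lambda\eta}v(x,\eta)\big]\,d\eta . $$ Assume that $g(\cdot,\tau)$ is continuous on $[x_l,x_r]$ for each $\tau\in(0,T]$; that $v(x,\cdot)$ is continuous on $[0,T]$ and $C^2$ on $(0,T]$ for each $x\in[x_l,x_r]$; that $v(\cdot,\tau)$ is $C^6$ on $[x_l,x_r]$ for each $\tau\in(0,T]$;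 and that for some constant $C$, for all $(x,\tau)\in[x_l,x_r]\times(0,T]$, $|\partial_x^pv(x,\tau)|\le C$ for $0\le p\le 6$ and $|\partial_\tau^\ell v(x,\tau)|\le C(1+\tau^{\alpha-\ell})$ for $\ell=0,1,2$. For integers $M,N\ge 1$ let $\tau_n=T(n/M)^\gamma$, $\Delta\tau_n=\tau_n-\tau_{n-1}$, $h=(x_r-x_l)/N$, $x_i=x_l+ih$. For grid functions let $\delta_x^2u_i=(u_{i+1}-2u_i+u_{i-1})/h^2$, and $\mathcal H_xu_i=u_i+\frac{h^2}{12}\delta_x^2u_i$ for $1\le i\le N-1$, $\mathcal H_xu_i=u_i$ for $i=0,N$. Put $a_k^{(n,\alpha)}=\frac1{\Delta\tau_k}\int_{\tau_{k-1}}^{\tau_k}(\tau_n-s)^{-\alpha}ds$. A sum-of-exponentials approximation with tolerance $\epsilon$ consists of an integer $M_{exp}\ge1$, points $s_j>0$ and weights $w_j>0$ $(1\le j\le M_{exp})$ with $\big|\tau^{-\alpha}-\sum_jw_je^{-s_j\tau}\big|\le\epsilon$ for all $\tau\in[TM^{-\gamma},T]$. For values $u^0,\dots,u^M$ at the time levels,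 the fast tempered L1 formula is, for $1\le n\le M$, $$ {}^F\mathcal D^{\alpha,\lambda}_\tau u^n=\frac{e^{-\lambda\tau_n}}{\Gamma(1-\alpha)}\Big\{\sum_jw_jF_j^n+a_n^{(n,\alpha)}\big[e^{\lambda\tau_n}u^n-e^{\lambda\tau_{n-1}}u^{n-1}\big]\Big\}, $$ $$ F_j^1=0,\qquad F_j^n=e^{-s_j\Delta\tau_n}F_j^{n-1}+\Big(\frac1{\Delta\tau_{n-1}}\int_{\tau_{n-2}}^{\tau_{n-1}}e^{-s_j(\tau_n-s)}ds\Big)\big[e^{\lambda\tau_{n-1}}u^{n-1}-e^{\lambda\tau_{n-2}}u^{n-2}\big]\quad(n\ge2). $$ The fast scheme for $\{v_i^n\}$ is $$ \mathcal H_x\big({}^F\mathcal D^{\alpha,\lambda}_\tau v_i^n\big)=\tfrac12\sigma^2\delta_x^2v_i^n-q\mathcal H_xv_i^n+\mathcal H_xg(x_i,\tau_n)\qquad(1\le i\le N-1,\ 1\le n\le M), $$ with $v_i^0=v_0(x_i)$ for $1\le i\le N-1$ and $v_0^n=v_N^n=0$ for $0\le n\le M$. Its local truncation error $\widehat{\mathcal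 R}_i^n$ is the left side minus the right side when $v(x_i,\tau_n)$ is put in place of $v_i^n$. Then there is a constant $c_1>0$ such that $$ a_n^{(n,\alpha)}-a_{n-1}^{(n,\alpha)}\ge c_1M^\alpha\quad\text{for all } M \text{ and } 2\le n\le M, \tag{1} $$ and there is a constant $c_3>0$, depending on the problem (that is, on $\alpha,\lambda,\sigma,r,D,T,x_l,x_r,g,v$) and on $\gamma$, but not on $M$, $N$, $n$, $\epsilon$ or the sum-of-exponentials approximation, such that the following two statements hold for all $M,N\ge1$ and every sum-of-exponentials approximation with tolerance $\epsilon$. (a) $|\widehat{\mathcal R}_i^n|\le c_3\big(n^{-\min\{\gamma(1+\alpha),\,2-\alpha\}}+h^4+\epsilon\big)$ for $1\le i\le N-1$, $1\le n\le M$. (b) If $\epsilon\le\min\{c_1M^\alpha,\ \tfrac12T^{-\alpha}\}$ for some constant $c_1$ satisfying (1), and $\{v_i^n\}$ solves the fast scheme, then $$ \max_{0\le i\le N}|v(x_i,\tau_n)-v_i^n|\le 2\Gamma(1-\alpha)\,c_3\,T^\alpha\Big(M^{-\min\{\gamma\alpha,\,2-\alpha\}}+h^4+\epsilon\Big),\qquad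 1\le n\le M. $$ -/

import Mathlib

open Set

noncomputable section

namespace TemperedBS

/-! ### The continuous problem -/

/-- Tempered Caputo derivative of order `α` with tempering parameter `lam`:
`e^{-lam τ} / Γ(1-α) * ∫₀^τ (τ-η)^{-α} d/dη [e^{lam η} v(η)] dη`. -/
def temperedCaputo (α lam : ℝ) (v : ℝ → ℝ) (τ : ℝ) : ℝ :=
  Real.exp (-lam * τ) / Real.Gamma (1 - α) *
    ∫ η in (0 : ℝ)..τ, (τ - η) ^ (-α) * deriv (fun s => Real.exp (lam * s) * v s) η

/-- `∂^p v / ∂x^p` at `(x, τ)` for `x ∈ [xl, xr]` (one-sided at the two end points). -/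
def partialX (xl xr : ℝ) (v : ℝ → ℝ → ℝ) (p : ℕ) (x τ : ℝ) : ℝ :=
  iteratedDerivWithin p (fun y => v y τ) (Icc xl xr) x

/-- `∂^l v / ∂τ^l` at `(x, τ)` for `τ ∈ (0, T]` (one-sided at `τ = T`). -/
def partialT (T : ℝ) (v : ℝ → ℝ → ℝ) (l : ℕ) (x τ : ℝ) : ℝ :=
  iteratedDerivWithin l (fun t => v x t) (Ioc 0 T) τ

/-- `v` solves the tempered time-fractional diffusion-reaction problem with homogeneous
Dirichlet boundary conditions on `(xl, xr) × (0, T]`. -/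
structure IsSolution (α lam σ q T xl xr : ℝ) (g : ℝ → ℝ → ℝ) (v₀ : ℝ → ℝ)
    (v : ℝ → ℝ → ℝ) : Prop where
  pde : ∀ x ∈ Ioo xl xr, ∀ τ ∈ Ioc 0 T,
    temperedCaputo α lam (v x) τ
      = σ ^ 2 / 2 * partialX xl xr v 2 x τ - q * v x τ + g x τ
  init : ∀ x ∈ Ioo xl xr, v x 0 = v₀ x
  bdry_left : ∀ τ ∈ Ioc 0 T, v xl τ = 0
  bdry_right : ∀ τ ∈ Ioc 0 T, v xr τ = 0

/-- Regularity of the solution: smooth in space, smooth in time away from `τ = 0`, with a weak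
singularity of the type `τ^α` at `τ = 0`. -/
structure IsRegular (α T xl xr : ℝ) (v : ℝ → ℝ → ℝ) : Prop where
  continuous_time : ∀ x ∈ Icc xl xr, ContinuousOn (fun τ => v x τ) (Icc 0 T)
  smooth_time : ∀ x ∈ Icc xl xr, ContDiffOn ℝ 2 (fun τ => v x τ) (Ioc 0 T)
  smooth_space : ∀ τ ∈ Ioc 0 T, ContDiffOn ℝ 6 (fun x => v x τ) (Icc xl xr)
  bounds : ∃ C : ℝ, ∀ x ∈ Icc xl xr, ∀ τ ∈ Ioc 0 T,
    (∀ p : ℕ, p ≤ 6 → |partialX xl xr v p x τ| ≤ C) ∧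
    (∀ l : ℕ, l ≤ 2 → |partialT T v l x τ| ≤ C * (1 + τ ^ (α - l)))

/-! ### Meshes and difference operators -/

/-- Graded time level `τ_n = T (n / M)^γ`. -/
def timeNode (T γ : ℝ) (M n : ℕ) : ℝ := T * ((n : ℝ) / M) ^ γ

/-- Time step `Δτ_n = τ_n - τ_{n-1}`, for `n ≥ 1`. -/
def timeStep (T γ : ℝ) (M n : ℕ) : ℝ := timeNode T γ M n - timeNode T γ M (n - 1)

/-- Spatial grid size `h = (xr - xl) / N`. -/
def gridSize (xl xr : ℝ) (N : ℕ) : ℝ := (xr - xl) / N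

/-- Spatial node `x_i = xl + i h`. -/
def spaceNode (xl xr : ℝ) (N i : ℕ) : ℝ := xl + i * gridSize xl xr N

/-- `(u_{i+1} - 2 u_i + u_{i-1}) / h²`, for `i ≥ 1`. -/
def secondDiff (h : ℝ) (u : ℕ → ℝ) (i : ℕ) : ℝ := (u (i + 1) - 2 * u i + u (i - 1)) / h ^ 2

/-- The compact averaging operator: `1 + (h²/12) δ²` at interior nodes, the identity at the
boundary nodes. -/
def compactOp (N : ℕ) (h : ℝ) (u : ℕ → ℝ) (i : ℕ) : ℝ :=
  if 1 ≤ i ∧ i < N then u i + h ^ 2 / 12 * secondDiff h u i else u i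

/-- Maximum norm of a grid function over the nodes `0, …, N`. -/
def maxNorm (N : ℕ) (u : ℕ → ℝ) : ℝ :=
  (Finset.range (N + 1)).sup' Finset.nonempty_range_add_one (fun i => |u i|)

/-! ### The fast tempered L1 formula -/

/-- L1 coefficient `a_k^{(n,α)} = (1/Δτ_k) ∫_{τ_{k-1}}^{τ_k} (τ_n - s)^{-α} ds`, `1 ≤ k ≤ n`. -/
def l1Coeff (α T γ : ℝ) (M n k : ℕ) : ℝ :=
  1 / timeStep T γ M k *
    ∫ s in (timeNode T γ M (k - 1))..(timeNode T γ M k), (timeNode T γ M n - s) ^ (-α)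

/-- `c₁` is a mesh-independent constant with `a_n^{(n,α)} - a_{n-1}^{(n,α)} ≥ c₁ M^α` for all
`2 ≤ n ≤ M`. -/
def IsGapConstant (α T γ c₁ : ℝ) : Prop :=
  ∀ M n : ℕ, 2 ≤ n → n ≤ M →
    c₁ * (M : ℝ) ^ α ≤ l1Coeff α T γ M n n - l1Coeff α T γ M n (n - 1)

/-- The positive points `s_j` and positive weights `ω_j` (`j` in `Fin K`, `K ≥ 1`) form a
sum-of-exponentials approximation of `τ^{-α}` on `[δ, T]` with tolerance `ε`. -/
structure IsSOE (α ε δ T : ℝ) (K : ℕ) (s ω : Fin K → ℝ) : Prop where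
  card_pos : 0 < K
  points_pos : ∀ j, 0 < s j
  weights_pos : ∀ j, 0 < ω j
  approx : ∀ τ ∈ Icc δ T, |τ ^ (-α) - ∑ j, ω j * Real.exp (-s j * τ)| ≤ ε

/-- `B^n = (1/Δτ_{n-1}) ∫_{τ_{n-2}}^{τ_{n-1}} e^{-s (τ_n - y)} dy`, for `n ≥ 2`. -/
def historyWeight (T γ : ℝ) (M : ℕ) (s : ℝ) (n : ℕ) : ℝ :=
  1 / timeStep T γ M (n - 1) *
    ∫ y in (timeNode T γ M (n - 2))..(timeNode T γ M (n - 1)),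
      Real.exp (-s * (timeNode T γ M n - y))

/-- The history variable of one exponential, for a sequence of values `w n` at `τ_n`:
`F^1 = 0` and, for `n ≥ 2`,
`F^n = e^{-s Δτ_n} F^{n-1} + B^n (e^{lam τ_{n-1}} w_{n-1} - e^{lam τ_{n-2}} w_{n-2})`.
(The value at `n = 0` is never used.) -/
def history (lam T γ : ℝ) (M : ℕ) (s : ℝ) (w : ℕ → ℝ) : ℕ → ℝ
  | 0 => 0
  | 1 => 0
  | n + 2 =>
      Real.exp (-s * timeStep T γ M (n + 2)) * history lam T γ M s w (n + 1)
        + historyWeight T γ M s (n + 2) *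
          (Real.exp (lam * timeNode T γ M (n + 1)) * w (n + 1)
            - Real.exp (lam * timeNode T γ M n) * w n)

/-- The fast tempered L1 formula at `τ_n`, `n ≥ 1`, for a sequence of values `w n` at `τ_n`. -/
def fastCaputo (α lam T γ : ℝ) (M : ℕ) {K : ℕ} (s ω : Fin K → ℝ) (w : ℕ → ℝ) (n : ℕ) : ℝ :=
  Real.exp (-lam * timeNode T γ M n) / Real.Gamma (1 - α) *
    (∑ j, ω j * history lam T γ M (s j) w n
      + l1Coeff α T γ M n n *
        (Real.exp (lam * timeNode T γ M n) * w n
          - Real.exp (lam * timeNode T γ M (n - 1)) * w (n - 1)))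

/-- Local truncation error of the fast compact scheme at `(x_i, τ_n)` (`1 ≤ i ≤ N - 1`, `1 ≤ n`)
for the function `v`: the defect left when the nodal values of `v` are put into the scheme. -/
def truncation (α lam σ q T γ xl xr : ℝ) (g : ℝ → ℝ → ℝ) (v : ℝ → ℝ → ℝ)
    (M N : ℕ) {K : ℕ} (s ω : Fin K → ℝ) (n i : ℕ) : ℝ :=
  compactOp N (gridSize xl xr N)
      (fun j => fastCaputo α lam T γ M s ω
        (fun m => v (spaceNode xl xr N j) (timeNode T γ M m)) n) i
    - (σ ^ 2 / 2 * secondDiff (gridSize xl xr N)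
          (fun j => v (spaceNode xl xr N j) (timeNode T γ M n)) i
        - q * compactOp N (gridSize xl xr N)
            (fun j => v (spaceNode xl xr N j) (timeNode T γ M n)) i
        + compactOp N (gridSize xl xr N)
            (fun j => g (spaceNode xl xr N j) (timeNode T γ M n)) i)

/-- `w n i` (`0 ≤ n ≤ M`, `0 ≤ i ≤ N`) solves the fast compact difference scheme. -/
structure IsFastSchemeSolution (α lam σ q T γ xl xr : ℝ) (g : ℝ → ℝ → ℝ) (v₀ : ℝ → ℝ)
    (M N : ℕ) {K : ℕ} (s ω : Fin K → ℝ) (w : ℕ → ℕ → ℝ) : Prop where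
  scheme : ∀ n i : ℕ, 1 ≤ n → n ≤ M → 1 ≤ i → i < N →
    compactOp N (gridSize xl xr N)
        (fun j => fastCaputo α lam T γ M s ω (fun m => w m j) n) i
      = σ ^ 2 / 2 * secondDiff (gridSize xl xr N) (w n) i
        - q * compactOp N (gridSize xl xr N) (w n) i
        + compactOp N (gridSize xl xr N)
            (fun j => g (spaceNode xl xr N j) (timeNode T γ M n)) i
  init : ∀ i : ℕ, 1 ≤ i → i < N → w 0 i = v₀ (spaceNode xl xr N i)
  bdry_left : ∀ n : ℕ, n ≤ M → w n 0 = 0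
  bdry_right : ∀ n : ℕ, n ≤ M → w n N = 0

end TemperedBS

end

/-! Consistency of the fast formula on the graded mesh is combined with stability in the maximum
norm that needs no relation between the time steps and `h`.

Consistency. The function `w(τ) = e^{lam τ} v(x, τ)` removes the tempering and satisfies, uniformly
in `x`, `|w'| ≤ A τ^(α-1)` and `|w''| ≤ A τ^(α-2)`; this is `WeaklySingular`. The L1 formula
replaces `w` by its piecewise linear interpolant. On each cell before the last, integration by parts
bounds the error by the interpolation error times the increment of the kernel. Cells with small
index contribute a convergent series, the others telescope, and the last cell is treated through the
error of the slope (`exists_l1_error_bound`). Exponentials change each coefficient by at most `ε`,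
which costs `ε` times a bound for the total variation of `w` (`exists_fast_error_bound`). In space,
Taylor expansion gives order four (`abs_compact_sub_le`). Since the averaging operator also sees `g`
at the end points, the equation is first extended to them (`IsSolution.pde_closed`).

Stability. A discrete maximum principle is not available in general: the off-diagonal entries of the
implicit matrix become positive when `Δτ^α` is small against `h^2`. Instead, odd `2N`-periodic
extension turns grid functions into bounded functions on `ℤ`, where everything is a function of the
shift `E`. With `L = (2 - E - E⁻¹)/4` the averaging operator is `1 - L/3`, and its inverse times `L`
is a multiple of `L (1 + G)` with `‖G‖ ≤ 1/4`. Poisson moment bounds give `‖(tL)^k exp(-tL)‖ ≤ k^k`,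
so the perturbation series for `exp(-t L (1 + G))` converges with a bound independent of `t` and `N`
(`norm_exp_perturbed_secondDiff_le`). The supremum of the norm along this semigroup is an equivalent
norm in which the spatial operator is accretive (`exists_accretive_norm`).

In that norm, a memory kernel `A n k` that is positive and nondecreasing in `k` bounds the solution
by the supremum of residual over `A n 1` (`norm_le_of_monotone_kernel`). The two conditions on `ε`
give the monotonicity and `A n 1 ≥ τ_n^(-α) / 2`. The resulting weight `τ_n^α` converts the rate in
`n` of the truncation error into the global rate in `M` (`timeNode_rpow_mul_le`). -/

namespace TemperedBS

/-! ### Analytic semigroup bounds for the second difference -/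

section BanachAlgebra
open NormedSpace

theorem hasSum_exp_real (a : ℝ) : HasSum (fun n : ℕ => a ^ n / n.factorial) (Real.exp a) := by
  rw [Real.exp_eq_exp_ℝ]
  exact expSeries_div_hasSum_exp a

theorem hasSum_poisson_first_moment (a : ℝ) :
    HasSum (fun n : ℕ => a ^ n / n.factorial * n) (a * Real.exp a) := by
  have h := (hasSum_exp_real a).mul_left a
  rw [← add_zero (a * Real.exp a)]
  have h2 := (hasSum_nat_add_iff (f := fun n : ℕ => a ^ n / n.factorial * n)
    (g := a * Real.exp a) 1).1 (by
      refine h.congr_fun fun n => ?_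
      have h0 : ((n + 1).factorial : ℝ) ≠ 0 := by positivity
      rw [Nat.factorial_succ] at *
      push_cast at *
      have h3 : (n.factorial : ℝ) ≠ 0 := by positivity
      have h4 : (n : ℝ) + 1 ≠ 0 := by positivity
      field_simp
      ring)
  simpa using h2

theorem hasSum_poisson_second_moment (a : ℝ) :
    HasSum (fun n : ℕ => a ^ n / n.factorial * (n : ℝ) ^ 2) ((a ^ 2 + a) * Real.exp a) := by
  have h := ((hasSum_poisson_first_moment a).add (hasSum_exp_real a)).mul_left a
  have h2 := (hasSum_nat_add_iff (f := fun n : ℕ => a ^ n / n.factorial * (n : ℝ) ^ 2)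
    (g := a * (a * Real.exp a + Real.exp a)) 1).1 (by
      refine h.congr_fun fun n => ?_
      have h0 : ((n + 1).factorial : ℝ) ≠ 0 := by positivity
      rw [Nat.factorial_succ] at *
      push_cast at *
      have h3 : (n.factorial : ℝ) ≠ 0 := by positivity
      have h4 : (n : ℝ) + 1 ≠ 0 := by positivity
      field_simp
      ring)
  have e : (a ^ 2 + a) * Real.exp a = a * (a * Real.exp a + Real.exp a) + ∑ i ∈ Finset.range 1,
      a ^ i / i.factorial * (i : ℝ) ^ 2 := by
    simp
    ring
  rw [e]
  exact h2

variable {𝔸 : Type*} [NormedRing 𝔸] [NormedAlgebra ℝ 𝔸] [CompleteSpace 𝔸]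

theorem exp_add_of_commute_real {x y : 𝔸} (h : Commute x y) : exp (x + y) = exp x * exp y := by
  let _ : NormedAlgebra ℚ 𝔸 := NormedAlgebra.restrictScalars ℚ ℝ 𝔸
  exact exp_add_of_commute h

omit [CompleteSpace 𝔸] in
theorem exp_smul_one (a : ℝ) : exp (a • (1 : 𝔸)) = Real.exp a • (1 : 𝔸) := by
  have := algebraMap_exp_comm (𝔸 := 𝔸) a
  rw [Algebra.algebraMap_eq_smul_one, Algebra.algebraMap_eq_smul_one] at this
  rw [← this, Real.exp_eq_exp_ℝ]

/-- The operator equals `e^{-a} ∑ a^n/n! (1 - n/a) E^n`, so its norm is at most the mean of `|1 -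
X/a|` for `X` Poisson of parameter `a`. This is at most the standard deviation `1/√a` of `X/a`; the
inequality `2|y| ≤ 1/√a + √a y^2` replaces Cauchy-Schwarz. -/
theorem norm_one_sub_mul_exp_le {E : 𝔸} (h1 : ‖(1 : 𝔸)‖ ≤ 1) (hE : ‖E‖ ≤ 1) {a : ℝ}
    (ha : 0 < a) : ‖(1 - E) * exp (-(a • (1 - E)))‖ ≤ 1 / √a := by
  have hpow : ∀ n : ℕ, ‖E ^ n‖ ≤ 1 := by
    intro n
    induction n with
    | zero => simpa using h1
    | succ n ih =>
      rw [pow_succ]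
      exact (norm_mul_le _ _).trans (mul_le_one₀ ih (norm_nonneg _) hE)
  have hs : HasSum (fun n : ℕ => (a ^ n / n.factorial) • E ^ n) (exp (a • E)) := by
    refine (exp_series_hasSum_exp' (𝕂 := ℝ) (a • E)).congr_fun fun n => ?_
    rw [smul_pow, smul_smul]
    congr 1
    ring
  have hs2 : HasSum (fun n : ℕ => (a ^ n / n.factorial * (n / a)) • E ^ n) (E * exp (a • E)) := by
    have h2 := (hasSum_nat_add_iff (f := fun n : ℕ => (a ^ n / n.factorial * (n / a)) • E ^ n)
      (g := E * exp (a • E)) 1).1 (by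
        refine (hs.mul_left E).congr_fun fun n => ?_
        rw [mul_smul_comm, ← pow_succ']
        congr 1
        rw [Nat.factorial_succ]
        push_cast
        have h3 : (n.factorial : ℝ) ≠ 0 := by positivity
        have h4 : (n : ℝ) + 1 ≠ 0 := by positivity
        field_simp
        ring)
    simpa using h2
  have hs3 := hs.sub hs2
  have hbd : HasSum (fun n : ℕ => a ^ n / n.factorial *
      ((1 / √a + √a * (1 - n / a) ^ 2) / 2)) (Real.exp a / √a) := by
    have hq := Real.sq_sqrt ha.le
    have h0 : √a ≠ 0 := (Real.sqrt_pos.2 ha).ne'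
    have := (((hasSum_exp_real a).mul_left (1 / √a + √a)).sub
      ((hasSum_poisson_first_moment a).mul_left (2 * √a / a))).add
      ((hasSum_poisson_second_moment a).mul_left (√a / a ^ 2))
    have := this.mul_left (1 / 2)
    have e : Real.exp a / √a = 1 / 2 * ((1 / √a + √a) * Real.exp a - 2 * √a / a * (a * Real.exp a)
        + √a / a ^ 2 * ((a ^ 2 + a) * Real.exp a)) := by
      field_simp
      rw [hq]
      ring
    rw [e]
    refine this.congr_fun fun n => ?_
    field_simp
    ring
  have hkey : ‖exp (a • E) - E * exp (a • E)‖ ≤ Real.exp a / √a := by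
    refine HasSum.norm_le_of_bounded hs3 hbd fun n => ?_
    rw [← sub_smul, norm_smul]
    have hsq := Real.sqrt_pos.2 ha
    have hn : |1 - n / a| ≤ (1 / √a + √a * (1 - n / a) ^ 2) / 2 := by
      rw [← sq_abs (1 - n / a)]
      set y := |1 - n / a|
      have : 0 ≤ (√a * y - 1) ^ 2 / √a := by positivity
      have h2 : (√a * y - 1) ^ 2 / √a = √a * y ^ 2 - 2 * y + 1 / √a := by
        field_simp
        ring
      linarith
    have : ‖a ^ n / n.factorial - a ^ n / n.factorial * (n / a)‖
        = a ^ n / n.factorial * |1 - n / a| := by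
      rw [← mul_one_sub, Real.norm_eq_abs, abs_mul, abs_of_nonneg]
      positivity
    rw [this]
    calc _ ≤ a ^ n / n.factorial * |1 - n / a| * 1 := by
          gcongr
          exact hpow n
      _ ≤ _ := by
          rw [mul_one]
          gcongr
  have hexp : exp (-(a • (1 - E))) = Real.exp (-a) • exp (a • E) := by
    have : -(a • (1 - E)) = (-a) • (1 : 𝔸) + a • E := by
      rw [smul_sub, neg_smul]; abel
    rw [this, exp_add_of_commute_real, exp_smul_one, smul_mul_assoc, one_mul]
    exact (Commute.one_left _).smul_left _
  rw [hexp, mul_smul_comm, sub_mul, one_mul, norm_smul, Real.norm_of_nonneg (Real.exp_pos _).le]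
  calc _ ≤ Real.exp (-a) * (Real.exp a / √a) := by gcongr
    _ = 1 / √a := by
      rw [← mul_div_assoc, ← Real.exp_add]
      simp

/-- For commuting contractions `E`, `E'` inverse to each other, the second difference
`(1 - E)(1 - E') / 4` generates a bounded analytic semigroup, with an explicit constant. -/
theorem norm_mul_exp_secondDiff_le {E E' S : 𝔸} (h1 : ‖(1 : 𝔸)‖ ≤ 1) (hE : ‖E‖ ≤ 1)
    (hE' : ‖E'‖ ≤ 1) (hi : E * E' = 1) (hi' : E' * E = 1)
    (hS : S = (1 / 4 : ℝ) • ((1 - E) * (1 - E'))) {t : ℝ} (ht : 0 < t) :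
    ‖(t • S) * exp (-(t • S))‖ ≤ 1 := by
  have hc : Commute E E' := by rw [Commute, SemiconjBy, hi, hi']
  have hc1 : Commute (1 - E) (1 - E') :=
    ((Commute.one_left _).sub_left ((Commute.one_right _).sub_right hc))
  -- Because `E E' = 1`, the product is also a sum. The semigroup therefore factors, and each factor
  -- supplies a decay `1/√(t/4)`.
  have hsum : (1 - E) * (1 - E') = (1 - E) + (1 - E') := by
    rw [mul_sub, sub_mul, sub_mul, hi]
    noncomm_ring
  have hexp : exp (-(t • S)) = exp (-((t / 4) • (1 - E))) * exp (-((t / 4) • (1 - E'))) := by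
    rw [← exp_add_of_commute_real]
    · congr 1
      rw [hS, hsum, smul_smul, ← neg_add, ← smul_add]
      congr 2
      ring
    · exact ((hc1.smul_left _).smul_right _).neg_left.neg_right
  have hcc : Commute (1 - E') (exp (-((t / 4) • (1 - E)))) := by
    let _ : NormedAlgebra ℚ 𝔸 := NormedAlgebra.restrictScalars ℚ ℝ 𝔸
    exact ((hc1.symm.smul_right _).neg_right).exp_right
  have : (t • S) * exp (-(t • S)) = (t / 4) • (((1 - E) * exp (-((t / 4) • (1 - E)))) *
      ((1 - E') * exp (-((t / 4) • (1 - E'))))) := by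
    rw [hexp, hS, smul_smul, smul_mul_assoc]
    congr 1
    · ring
    · rw [mul_assoc, mul_assoc, ← mul_assoc (1 - E'), hcc.eq, mul_assoc]
  rw [this, norm_smul, Real.norm_of_nonneg (by positivity)]
  have hs := Real.sqrt_pos.2 (show 0 < t / 4 by positivity)
  calc _ ≤ t / 4 * (1 / √(t / 4) * (1 / √(t / 4))) := by
        gcongr
        refine (norm_mul_le _ _).trans ?_
        gcongr
        · exact norm_one_sub_mul_exp_le h1 hE (by positivity)
        · exact norm_one_sub_mul_exp_le h1 hE' (by positivity)
    _ = 1 := by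
      have := Real.mul_self_sqrt (show 0 ≤ t / 4 by positivity)
      field_simp
      nlinarith

/-- The time `t` is divided into `k` equal parts: the operator is the `k`-th power of `k` times the
case `k = 1` at time `t/k`. -/
theorem norm_pow_mul_exp_secondDiff_le {E E' S : 𝔸} (h1 : ‖(1 : 𝔸)‖ ≤ 1) (hE : ‖E‖ ≤ 1)
    (hE' : ‖E'‖ ≤ 1) (hi : E * E' = 1) (hi' : E' * E = 1)
    (hS : S = (1 / 4 : ℝ) • ((1 - E) * (1 - E'))) {t : ℝ} (ht : 0 < t) {k : ℕ} (hk : 0 < k) :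
    ‖(t • S) ^ k * exp (-(t • S))‖ ≤ (k : ℝ) ^ k := by
  let _ : NormedAlgebra ℚ 𝔸 := NormedAlgebra.restrictScalars ℚ ℝ 𝔸
  have hk0 : (k : ℝ) ≠ 0 := by positivity
  have h : (t • S) ^ k * exp (-(t • S))
      = ((k : ℝ) • (((t / k) • S) * exp (-((t / k) • S)))) ^ k := by
    rw [← smul_mul_assoc, smul_smul, Commute.mul_pow, ← exp_nsmul, smul_neg,
      ← Nat.cast_smul_eq_nsmul ℝ, smul_smul]
    · congr <;> field_simp
    · exact (((Commute.refl S).smul_left _).smul_right _).neg_right.exp_right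
  rw [h, smul_pow]
  refine (norm_smul_le _ _).trans ?_
  rw [Real.norm_of_nonneg (by positivity)]
  have := norm_mul_exp_secondDiff_le h1 hE hE' hi hi' hS (show 0 < t / k by positivity)
  calc _ ≤ (k : ℝ) ^ k * 1 ^ k := by
        gcongr
        exact (norm_pow_le' _ hk).trans (by gcongr)
    _ = _ := by simp

/-- Here `-tS = -(t/2) + (t/2) P` with the contraction `P = (E + E')/2`, and `‖exp((t/2) P)‖ ≤
e^{t/2}`. -/
theorem norm_exp_secondDiff_le {E E' S : 𝔸} (h1 : ‖(1 : 𝔸)‖ ≤ 1) (hE : ‖E‖ ≤ 1)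
    (hE' : ‖E'‖ ≤ 1) (hi : E * E' = 1)
    (hS : S = (1 / 4 : ℝ) • ((1 - E) * (1 - E'))) {t : ℝ} (ht : 0 ≤ t) :
    ‖exp (-(t • S))‖ ≤ 1 := by
  have hsum : (1 - E) * (1 - E') = (1 - E) + (1 - E') := by
    rw [mul_sub, sub_mul, sub_mul, hi]
    noncomm_ring
  set P : 𝔸 := (1 / 2 : ℝ) • (E + E') with hP
  have hPn : ‖P‖ ≤ 1 := by
    rw [hP, norm_smul]
    have := norm_add_le E E'
    norm_num
    linarith
  have hpow : ∀ n : ℕ, ‖P ^ n‖ ≤ 1 := by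
    intro n
    induction n with
    | zero => simpa using h1
    | succ n ih =>
      rw [pow_succ]
      exact (norm_mul_le _ _).trans (mul_le_one₀ ih (norm_nonneg _) hPn)
  have hneg : -(t • S) = (-(t / 2)) • (1 : 𝔸) + (t / 2) • P := by
    rw [hS, hsum, hP, smul_smul, smul_smul]
    module
  rw [hneg, exp_add_of_commute_real, exp_smul_one, smul_mul_assoc, one_mul, norm_smul,
    Real.norm_of_nonneg (Real.exp_pos _).le]
  · have : ‖exp ((t / 2) • P)‖ ≤ Real.exp (t / 2) := by
      refine HasSum.norm_le_of_bounded (exp_series_hasSum_exp' (𝕂 := ℝ) ((t / 2) • P))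
        (hasSum_exp_real (t / 2)) fun n => ?_
      rw [smul_pow, smul_smul, norm_smul]
      rw [Real.norm_of_nonneg (by positivity)]
      calc _ ≤ ((n.factorial : ℝ)⁻¹ * (t / 2) ^ n) * 1 := by
            gcongr
            exact hpow n
        _ = _ := by ring
    calc _ ≤ Real.exp (-(t / 2)) * Real.exp (t / 2) := by gcongr
      _ = 1 := by rw [← Real.exp_add]; simp
  · exact (Commute.one_left _).smul_left _

/-- Uniform boundedness of the semigroup generated by a perturbation `S (1 + G)` of the second
difference, `‖G‖ ≤ 1/4`. -/
theorem norm_exp_perturbed_secondDiff_le {E E' S G : 𝔸} (h1 : ‖(1 : 𝔸)‖ ≤ 1) (hE : ‖E‖ ≤ 1)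
    (hE' : ‖E'‖ ≤ 1) (hi : E * E' = 1) (hi' : E' * E = 1)
    (hS : S = (1 / 4 : ℝ) • ((1 - E) * (1 - E'))) (hG : ‖G‖ ≤ 1 / 4) (hc : Commute S G)
    {t : ℝ} (ht : 0 ≤ t) :
    ‖exp (-(t • (S * (1 + G))))‖ ≤ 1 / (1 - Real.exp 1 / 4) := by
  let _ : NormedAlgebra ℚ 𝔸 := NormedAlgebra.restrictScalars ℚ ℝ 𝔸
  have he := Real.exp_one_lt_d9
  rcases ht.eq_or_lt with rfl | ht
  · have h2 : 1 ≤ 1 / (1 - Real.exp 1 / 4) := by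
      rw [le_div_iff₀] <;> linarith [Real.exp_pos 1]
    rw [zero_smul, neg_zero, exp_zero]
    exact h1.trans h2
  have hSG : Commute S (S * G) := (Commute.refl S).mul_right hc
  have hneg : -(t • (S * (1 + G))) = -(t • (S * G)) + -(t • S) := by
    rw [mul_add, mul_one, smul_add]; abel
  rw [hneg, exp_add_of_commute_real ((hSG.symm.smul_left _).smul_right _).neg_left.neg_right]
  have hs := (exp_series_hasSum_exp' (𝕂 := ℝ) (-(t • (S * G)))).mul_right (exp (-(t • S)))
  have hg : HasSum (fun k : ℕ => (Real.exp 1 / 4) ^ k) (1 / (1 - Real.exp 1 / 4)) := by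
    rw [one_div]
    exact hasSum_geometric_of_lt_one (by positivity) (by linarith)
  refine HasSum.norm_le_of_bounded hs hg fun k => ?_
  have hterm : ((k.factorial : ℝ)⁻¹ • (-(t • (S * G))) ^ k) * exp (-(t • S))
      = ((k.factorial : ℝ)⁻¹ * (-1) ^ k) • (G ^ k * ((t • S) ^ k * exp (-(t • S)))) := by
    rw [smul_mul_assoc, mul_smul]
    congr 1
    rw [← mul_assoc, ← (hc.symm.smul_right t).mul_pow, (hc.symm.smul_right t).eq,
      ← smul_mul_assoc ((-1 : ℝ) ^ k), ← smul_pow, neg_one_smul, smul_mul_assoc t S G]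
  rw [hterm, norm_smul, norm_mul, norm_pow, norm_neg, norm_one, one_pow, mul_one,
    Real.norm_of_nonneg (by positivity)]
  rcases Nat.eq_zero_or_pos k with rfl | hk
  · simpa using norm_exp_secondDiff_le h1 hE hE' hi hS ht.le
  -- By `k^k / k! ≤ e^k`, the `k`-th term of the perturbation series is at most `(e/4)^k`. The size
  -- `1/4` of `G` enters here, through `e < 4`.
  · have hkf : (k : ℝ) ^ k / k.factorial ≤ Real.exp 1 ^ k := by
      rw [← Real.exp_nat_mul, mul_one]
      exact Real.pow_div_factorial_le_exp _ (by positivity) k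
    calc _ ≤ (k.factorial : ℝ)⁻¹ * ((1 / 4) ^ k * (k : ℝ) ^ k) := by
          gcongr
          refine (norm_mul_le _ _).trans ?_
          gcongr
          · exact (norm_pow_le' _ hk).trans (by gcongr)
          · exact norm_pow_mul_exp_secondDiff_le h1 hE hE' hi hi' hS ht hk
      _ = (1 / 4) ^ k * ((k : ℝ) ^ k / k.factorial) := by ring
      _ ≤ (1 / 4) ^ k * Real.exp 1 ^ k := by gcongr
      _ = _ := by rw [← mul_pow]; congr 1; ring

end BanachAlgebra

/-! ### Equivalent accretive norms and monotone memory kernels -/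

section Renorming
open NormedSpace Filter Topology

variable {X : Type*} [NormedAddCommGroup X] [NormedSpace ℝ X] [CompleteSpace X]

/-- If `exp (-t B)`, `t ≥ 0`, is uniformly bounded, then `B` is accretive in an equivalent norm. -/
theorem exists_accretive_norm {B : X →L[ℝ] X} {C : ℝ}
    (hB : ∀ t : ℝ, 0 ≤ t → ‖exp (-(t • B))‖ ≤ C) :
    ∃ p : X → ℝ, (∀ u, ‖u‖ ≤ p u) ∧ (∀ u, p u ≤ C * ‖u‖) ∧ (∀ u v, p (u + v) ≤ p u + p v) ∧
      (∀ (c : ℝ) u, p (c • u) = |c| * p u) ∧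
      ∀ μ β : ℝ, 0 ≤ β → ∀ u, μ * p u ≤ p (μ • u + β • B u) := by
  let _ : NormedAlgebra ℚ (X →L[ℝ] X) := NormedAlgebra.restrictScalars ℚ ℝ (X →L[ℝ] X)
  -- The supremum along the forward orbit makes every `exp (-t B)` a contraction for `p`;
  -- boundedness of the semigroup makes it equivalent to the norm.
  set p : X → ℝ := fun u => ⨆ t : {t : ℝ // 0 ≤ t}, ‖exp (-((t : ℝ) • B)) u‖ with hp
  have : Nonempty {t : ℝ // 0 ≤ t} := ⟨⟨0, le_rfl⟩⟩
  have hle : ∀ u, ∀ t : ℝ, 0 ≤ t → ‖exp (-(t • B)) u‖ ≤ C * ‖u‖ := fun u t ht =>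
    (ContinuousLinearMap.le_opNorm _ _).trans (by gcongr; exact hB t ht)
  have hbdd : ∀ u, BddAbove (range fun t : {t : ℝ // 0 ≤ t} => ‖exp (-((t : ℝ) • B)) u‖) :=
    fun u => ⟨C * ‖u‖, by rintro _ ⟨t, rfl⟩; exact hle u t t.2⟩
  have hge : ∀ u, ∀ t : ℝ, 0 ≤ t → ‖exp (-(t • B)) u‖ ≤ p u := fun u t ht =>
    le_ciSup (hbdd u) ⟨t, ht⟩
  have hpC : ∀ u, p u ≤ C * ‖u‖ := fun u => ciSup_le fun t => hle u t t.2
  have hadd : ∀ u v, p (u + v) ≤ p u + p v := fun u v => ciSup_le fun t => by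
    rw [map_add]
    exact (norm_add_le _ _).trans (add_le_add (hge u t t.2) (hge v t t.2))
  have hsmul : ∀ (c : ℝ) u, p (c • u) = |c| * p u := fun c u => by
    simp only [hp, map_smul, norm_smul, Real.norm_eq_abs]
    rw [Real.mul_iSup_of_nonneg (abs_nonneg c)]
  have hcontr : ∀ u, ∀ t : ℝ, 0 ≤ t → p (exp (-(t • B)) u) ≤ p u := fun u t ht =>
    ciSup_le fun r => by
      have : exp (-((r : ℝ) • B)) (exp (-(t • B)) u) = exp (-(((r : ℝ) + t) • B)) u := by
        rw [← mul_apply_eq_comp, ← exp_add_of_commute_real]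
        · congr 2
          rw [add_smul]; abel
        · exact (((Commute.refl B).smul_left _).smul_right _).neg_left.neg_right
      rw [this]
      exact hge u _ (add_nonneg r.2 ht)
  refine ⟨p, fun u => ?_, hpC, hadd, hsmul, fun μ β hβ u => ?_⟩
  · have := hge u 0 le_rfl
    simpa using this
  set w := μ • u + β • B u with hw
  set R : ℝ → X := fun δ => u - δ • (β • B u) - exp (-((δ * β) • B)) u with hR
  have hstep : ∀ δ : ℝ, 0 < δ → μ * p u ≤ p w + C * (δ⁻¹ * ‖R δ‖) := fun δ hδ => by
    -- One explicit Euler step compared with the exact semigroup over time `δ β`. The contraction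
    -- property and `R δ = o(δ)` give accretivity after division by `δ`.
    have e : (1 + δ * μ) • u = (exp (-((δ * β) • B)) u + δ • w) + R δ := by
      simp only [hR, hw]
      module
    have h1 : (1 + δ * μ) * p u ≤ p u + δ * p w + C * ‖R δ‖ := by
      calc (1 + δ * μ) * p u ≤ |1 + δ * μ| * p u := by
            gcongr
            · exact (norm_nonneg _).trans (hge u 0 le_rfl)
            · exact le_abs_self _
        _ = p ((exp (-((δ * β) • B)) u + δ • w) + R δ) := by rw [← hsmul, e]
        _ ≤ p (exp (-((δ * β) • B)) u) + p (δ • w) + p (R δ) :=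
          (hadd _ _).trans (by gcongr; exact hadd _ _)
        _ ≤ _ := by
          gcongr
          · exact hcontr _ _ (by positivity)
          · rw [hsmul, abs_of_pos hδ]
          · exact hpC _
    have h2 : δ * (μ * p u) ≤ δ * (p w + C * (δ⁻¹ * ‖R δ‖)) := by
      have : δ * (p w + C * (δ⁻¹ * ‖R δ‖)) = δ * p w + C * ‖R δ‖ := by
        field_simp
      rw [this]
      linarith
    exact le_of_mul_le_mul_left h2 hδ
  have hderiv : HasDerivAt (fun δ : ℝ => exp (-((δ * β) • B)) u) (-(β • B u)) 0 := by
    have h := hasDerivAt_exp_smul_const (𝕂 := ℝ) (-(β • B)) (0 : ℝ)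
    have h2 := h.clm_apply (hasDerivAt_const (0 : ℝ) u)
    simp only [zero_smul, exp_zero, one_mul, map_zero, add_zero] at h2
    convert h2 using 1
    · funext δ
      rw [smul_neg, smul_smul]
    · rw [neg_apply, smul_apply]
  have hlim : Tendsto (fun δ : ℝ => δ⁻¹ * ‖R δ‖) (𝓝[>] 0) (𝓝 0) := by
    have h := (hasDerivAt_iff_tendsto_slope_zero.1 hderiv).mono_left
      (nhdsWithin_mono 0 (fun x (hx : 0 < x) => hx.ne'))
    have h2 := (h.sub_const (-(β • B u))).norm
    simp only [sub_self, norm_zero] at h2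
    refine h2.congr' ?_
    filter_upwards [self_mem_nhdsWithin] with δ (hδ : 0 < δ)
    have : R δ = -(δ • (δ⁻¹ • (exp (-(((0 + δ) * β) • B)) u - exp (-((0 * β) • B)) u)
        - -(β • B u))) := by
      simp only [hR, smul_sub, smul_smul, mul_inv_cancel₀ hδ.ne', zero_add, zero_mul, zero_smul,
        neg_zero, exp_zero, one_apply_eq_self]
      module
    rw [this, norm_neg, norm_smul, Real.norm_of_nonneg hδ.le, inv_mul_cancel_left₀ hδ.ne']
  have := (hlim.const_mul C).const_add (p w)
  rw [mul_zero, add_zero] at this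
  refine ge_of_tendsto this ?_
  filter_upwards [self_mem_nhdsWithin] with δ hδ
  exact hstep δ hδ

-- Abel summation, which moves the differences from the unknowns to the kernel.
omit [CompleteSpace X] in
theorem sum_smul_increment (A : ℕ → ℝ) (W : ℕ → X) (m : ℕ) :
    ∑ k ∈ Finset.range (m + 1), A (k + 1) • (W (k + 1) - W k)
      = A (m + 1) • W (m + 1) - ∑ k ∈ Finset.range m, (A (k + 2) - A (k + 1)) • W (k + 1)
        - A 1 • W 0 := by
  induction m with
  | zero => simp [smul_sub]
  | succ m ih =>
    rw [Finset.sum_range_succ, ih, Finset.sum_range_succ _ m]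
    module

omit [CompleteSpace X] in
/-- Stability of an implicit scheme with a monotone memory kernel, in a norm in which the space
operator is accretive. -/
theorem norm_le_of_monotone_kernel {B : X →L[ℝ] X} {p : X → ℝ}
    (hadd : ∀ u v, p (u + v) ≤ p u + p v) (hsmul : ∀ (c : ℝ) u, p (c • u) = |c| * p u)
    (hacc : ∀ μ β : ℝ, 0 ≤ β → ∀ u, μ * p u ≤ p (μ • u + β • B u))
    {M : ℕ} {A : ℕ → ℕ → ℝ} {W ρ : ℕ → X} {κ β K : ℝ} (hκ : 0 ≤ κ) (hβ : 0 ≤ β) (hW : W 0 = 0)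
    (hA : ∀ n, 1 ≤ n → n ≤ M → 0 < A n 1)
    (hmono : ∀ n k, 1 ≤ k → k < n → n ≤ M → A n k ≤ A n (k + 1))
    (heq : ∀ n, 1 ≤ n → n ≤ M →
      ∑ k ∈ Finset.range n, A n (k + 1) • (W (k + 1) - W k) + κ • W n + β • B (W n) = ρ n)
    (hρ : ∀ n, 1 ≤ n → n ≤ M → p (ρ n) ≤ A n 1 * K) :
    ∀ n, 1 ≤ n → n ≤ M → p (W n) ≤ K := by
  intro n
  induction n using Nat.strong_induction_on with
  | _ n ih =>
    intro hn hnM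
    obtain ⟨m, rfl⟩ : ∃ m, n = m + 1 := ⟨n - 1, by omega⟩
    have hp0 : ∀ u, 0 ≤ p u := fun u => by
      have h1 := hadd u ((-1 : ℝ) • u)
      rw [hsmul, neg_one_smul, add_neg_cancel] at h1
      have h2 := hsmul 0 0
      rw [zero_smul, abs_zero, zero_mul] at h2
      rw [h2] at h1
      norm_num at h1
      linarith
    have hpsum : ∀ (s : Finset ℕ) (f : ℕ → X), p (∑ k ∈ s, f k) ≤ ∑ k ∈ s, p (f k) := by
      intro s f
      induction s using Finset.induction_on with
      | empty =>
        have h2 := hsmul 0 0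
        rw [zero_smul, abs_zero, zero_mul] at h2
        simp [h2]
      | insert a s ha ih =>
        rw [Finset.sum_insert ha, Finset.sum_insert ha]
        exact (hadd _ _).trans (by gcongr)
    set D : X := ∑ k ∈ Finset.range m, (A (m + 1) (k + 2) - A (m + 1) (k + 1)) • W (k + 1) with hD
    have e := heq (m + 1) hn hnM
    rw [sum_smul_increment (A (m + 1)) W m, hW, smul_zero, sub_zero] at e
    -- The earlier levels stand on the right with nonnegative weights of total mass `A n n - A n 1`.
    -- The residual contributes at most `A n 1 * K`, so the induction closes with the same `K`.
    have e2 : (A (m + 1) (m + 1) + κ) • W (m + 1) + β • B (W (m + 1)) = ρ (m + 1) + D := by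
      rw [← e]
      module
    have h1 := hacc (A (m + 1) (m + 1) + κ) β hβ (W (m + 1))
    rw [e2] at h1
    have htel : ∑ k ∈ Finset.range m, (A (m + 1) (k + 2) - A (m + 1) (k + 1))
        = A (m + 1) (m + 1) - A (m + 1) 1 :=
      Finset.sum_range_sub (fun k => A (m + 1) (k + 1)) m
    have hDp : p D ≤ (A (m + 1) (m + 1) - A (m + 1) 1) * K := by
      rw [← htel, Finset.sum_mul]
      refine (hpsum _ _).trans (Finset.sum_le_sum fun k hk => ?_)
      have hk := Finset.mem_range.1 hk
      have h0 := hmono (m + 1) (k + 1) (by omega) (by omega) hnM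
      rw [hsmul, abs_of_nonneg (by linarith)]
      exact mul_le_mul_of_nonneg_left (ih (k + 1) (by omega) (by omega) (by omega)) (by linarith)
    have hApos : 0 < A (m + 1) (m + 1) := by
      have h2 : 0 ≤ A (m + 1) (m + 1) - A (m + 1) 1 := by
        rw [← htel]
        refine Finset.sum_nonneg fun k hk => ?_
        have hk := Finset.mem_range.1 hk
        have h0 := hmono (m + 1) (k + 1) (by omega) (by omega) hnM
        linarith
      linarith [hA (m + 1) hn hnM]
    have h3 : A (m + 1) (m + 1) * p (W (m + 1)) ≤ A (m + 1) (m + 1) * K := by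
      have := hadd (ρ (m + 1)) D
      have := hρ (m + 1) hn hnM
      have := mul_nonneg hκ (hp0 (W (m + 1)))
      nlinarith
    exact le_of_mul_le_mul_left h3 hApos

end Renorming
end TemperedBS

noncomputable section
namespace TemperedBS

/-! ### Reduction to the integer lattice and stability in the maximum norm -/

section Lattice
open scoped BoundedContinuousFunction

/-- Translation by `d` on bounded functions on `ℤ`. -/
def shift (d : ℤ) : (ℤ →ᵇ ℝ) →L[ℝ] (ℤ →ᵇ ℝ) :=
  LinearMap.mkContinuous
    { toFun := fun f => BoundedContinuousFunction.ofNormedAddCommGroupDiscrete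
        (fun z => f (z + d)) ‖f‖ (fun z => f.norm_coe_le_norm _)
      map_add' := fun f g => by ext z; rfl
      map_smul' := fun c f => by ext z; rfl } 1 (fun f => by
        rw [one_mul]
        exact (BoundedContinuousFunction.norm_le (norm_nonneg f)).2
          fun z => f.norm_coe_le_norm _)

@[simp] theorem shift_apply (d : ℤ) (f : ℤ →ᵇ ℝ) (z : ℤ) : shift d f z = f (z + d) := rfl

theorem norm_shift_le (d : ℤ) : ‖shift d‖ ≤ 1 :=
  LinearMap.mkContinuous_norm_le _ zero_le_one _

theorem shift_shift_neg (d : ℤ) (f : ℤ →ᵇ ℝ) : shift d (shift (-d) f) = f := by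
  ext z
  simp

/-- The odd `2N`-periodic extension to `ℤ` of a grid function on `0, …, N`. -/
def oddExt {N : ℕ} (hN : 1 ≤ N) : (ℕ → ℝ) →ₗ[ℝ] (ℤ →ᵇ ℝ) where
  toFun u := BoundedContinuousFunction.ofNormedAddCommGroupDiscrete
    (fun z => if z % (2 * N) ≤ N then u (z % (2 * N)).toNat else -u (2 * N - z % (2 * N)).toNat)
    (∑ i ∈ Finset.range (2 * N + 1), |u i|) (fun z => by
      have h1 := Int.emod_nonneg z (show (2 * N : ℤ) ≠ 0 by positivity)
      have h2 := Int.emod_lt_of_pos z (show (0 : ℤ) < 2 * N by positivity)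
      split_ifs with h
      · exact Finset.single_le_sum (f := fun i => |u i|) (fun i _ => abs_nonneg _)
          (Finset.mem_range.2 (by omega))
      · rw [norm_neg]
        exact Finset.single_le_sum (f := fun i => |u i|) (fun i _ => abs_nonneg _)
          (Finset.mem_range.2 (by omega)))
  map_add' u v := by
    ext z
    simp only [BoundedContinuousFunction.coe_ofNormedAddCommGroupDiscrete,
      BoundedContinuousFunction.add_apply, Pi.add_apply]
    split_ifs
    · rfl
    · ring
  map_smul' c u := by
    ext z
    simp only [BoundedContinuousFunction.coe_ofNormedAddCommGroupDiscrete,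
      BoundedContinuousFunction.smul_apply, Pi.smul_apply, RingHom.id_apply, smul_eq_mul]
    split_ifs
    · rfl
    · ring

theorem oddExt_apply {N : ℕ} (hN : 1 ≤ N) (u : ℕ → ℝ) (z : ℤ) :
    oddExt hN u z = if z % (2 * N) ≤ N then u (z % (2 * N)).toNat
      else -u (2 * N - z % (2 * N)).toNat := rfl

theorem oddExt_natCast {N i : ℕ} (hN : 1 ≤ N) (hi : i ≤ N) (u : ℕ → ℝ) : oddExt hN u i = u i := by
  have : (i : ℤ) % (2 * N) = i := Int.emod_eq_of_lt (by omega) (by omega)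
  rw [oddExt_apply, this, if_pos (by omega)]
  simp

theorem oddExt_congr {N : ℕ} (hN : 1 ≤ N) {u v : ℕ → ℝ} (h : ∀ i ≤ N, u i = v i) :
    oddExt hN u = oddExt hN v := by
  ext z
  have h1 := Int.emod_nonneg z (show (2 * N : ℤ) ≠ 0 by positivity)
  have h2 := Int.emod_lt_of_pos z (show (0 : ℤ) < 2 * N by positivity)
  rw [oddExt_apply, oddExt_apply]
  split_ifs with h3
  · exact h _ (by omega)
  · rw [h _ (by omega)]

theorem norm_oddExt_le {N : ℕ} (hN : 1 ≤ N) {u : ℕ → ℝ} {r : ℝ} (h : ∀ i ≤ N, |u i| ≤ r) :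
    ‖oddExt hN u‖ ≤ r := by
  refine (BoundedContinuousFunction.norm_le ((abs_nonneg _).trans (h 0 (by omega)))).2 fun z => ?_
  have h1 := Int.emod_nonneg z (show (2 * N : ℤ) ≠ 0 by positivity)
  have h2 := Int.emod_lt_of_pos z (show (0 : ℤ) < 2 * N by positivity)
  rw [oddExt_apply]
  split_ifs with h3
  · exact h _ (by omega)
  · rw [norm_neg]
    exact h _ (by omega)

/-- Odd reflection makes the Dirichlet neighbour sum translation invariant. At the multiples of `N`
the two neighbours cancel, which accounts for the value `0` at the boundary nodes. For `N = 1` all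
values involved vanish. -/
theorem oddExt_neighbours {N : ℕ} (hN : 1 ≤ N) {u : ℕ → ℝ} (h0 : u 0 = 0) (hNz : u N = 0) (z : ℤ) :
    oddExt hN u (z + 1) + oddExt hN u (z + -1)
      = oddExt hN (fun i => if 1 ≤ i ∧ i < N then u (i + 1) + u (i - 1) else 0) z := by
  have h1 := Int.emod_nonneg z (show (2 * N : ℤ) ≠ 0 by positivity)
  have h2 := Int.emod_lt_of_pos z (show (0 : ℤ) < 2 * N by positivity)
  have hz := Int.emod_add_mul_ediv z (2 * N)
  set r := z % (2 * N)
  set d := z / (2 * N)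
  have hp : (z + 1) % (2 * N) = if r + 1 = 2 * N then 0 else r + 1 := by
    rw [← hz, show r + 2 * N * d + 1 = r + 1 + 2 * N * d by ring, Int.add_mul_emod_self_left]
    split_ifs with h
    · rw [h]; simp
    · exact Int.emod_eq_of_lt (by omega) (by omega)
  have hm : (z + -1) % (2 * N) = if r = 0 then 2 * (N : ℤ) - 1 else r - 1 := by
    rw [← hz]
    split_ifs with h
    · rw [h, show 0 + 2 * N * d + -1 = (2 * N - 1) + 2 * N * (d - 1) by ring,
        Int.add_mul_emod_self_left]
      exact Int.emod_eq_of_lt (by omega) (by omega)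
    · rw [show r + 2 * N * d + -1 = (r - 1) + 2 * N * d by ring, Int.add_mul_emod_self_left]
      exact Int.emod_eq_of_lt (by omega) (by omega)
  have hval : ∀ {a b : ℕ}, a = b → u a = u b := fun h => by rw [h]
  rw [oddExt_apply, oddExt_apply, oddExt_apply, hp, hm]
  change _ = if r ≤ N then _ else _
  rcases lt_trichotomy r N with hr | hr | hr
  · rcases h1.eq_or_lt with hr0 | hr0
    · rw [if_neg (show ¬ r + 1 = 2 * N by omega), if_pos (show r = 0 by omega),
        if_pos (show r + 1 ≤ N by omega), if_pos (show r ≤ N by omega),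
        if_neg (show ¬ (1 ≤ r.toNat ∧ r.toNat < N) by omega)]
      split_ifs with h
      · rw [hval (show (r + 1).toNat = N by omega), hval (show (2 * (N : ℤ) - 1).toNat = N by omega),
          hNz, add_zero]
      · rw [hval (show (r + 1).toNat = 1 by omega),
          hval (show (2 * (N : ℤ) - (2 * N - 1)).toNat = 1 by omega), add_neg_cancel]
    · rw [if_neg (show ¬ r + 1 = 2 * N by omega), if_neg (show ¬ r = 0 by omega),
        if_pos (show r + 1 ≤ N by omega), if_pos (show r - 1 ≤ N by omega),
        if_pos (show r ≤ N by omega),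
        if_pos (show (1 ≤ r.toNat ∧ r.toNat < N) by omega),
        hval (show (r + 1).toNat = r.toNat + 1 by omega),
        hval (show (r - 1).toNat = r.toNat - 1 by omega)]
  · rw [if_neg (show ¬ r = 0 by omega), if_pos (show r - 1 ≤ N by omega),
      if_pos (show r ≤ N by omega), if_neg (show ¬ (1 ≤ r.toNat ∧ r.toNat < N) by omega)]
    by_cases hN1 : N = 1
    · rw [if_pos (show r + 1 = 2 * N by omega), if_pos (by omega),
        hval (show (0 : ℤ).toNat = 0 by omega), hval (show (r - 1).toNat = 0 by omega), h0, add_zero]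
    · rw [if_neg (show ¬ r + 1 = 2 * N by omega), if_neg (by omega),
        hval (show (2 * (N : ℤ) - (r + 1)).toNat = N - 1 by omega),
        hval (show (r - 1).toNat = N - 1 by omega), neg_add_cancel]
  · rw [if_neg (show ¬ r = 0 by omega), if_neg (show ¬ r ≤ N by omega),
      if_pos (show (1 ≤ (2 * (N : ℤ) - r).toNat ∧ (2 * (N : ℤ) - r).toNat < N) by omega), neg_add,
      add_comm]
    congr 1
    · split_ifs with h
      · rw [hval (show (r - 1).toNat = N by omega),
          hval (show (2 * (N : ℤ) - r).toNat + 1 = N by omega), hNz, neg_zero]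
      · rw [hval (show (2 * (N : ℤ) - r).toNat + 1 = (2 * (N : ℤ) - (r - 1)).toNat by omega)]
    · by_cases h : r + 1 = 2 * N
      · rw [if_pos h, if_pos (by omega), hval (show (0 : ℤ).toNat = 0 by omega),
          hval (show (2 * (N : ℤ) - r).toNat - 1 = 0 by omega), h0, neg_zero]
      · rw [if_neg h, if_neg (by omega),
          hval (show (2 * (N : ℤ) - r).toNat - 1 = (2 * (N : ℤ) - (r + 1)).toNat by omega)]

section Operators

variable {X : Type*} [NormedAddCommGroup X] [NormedSpace ℝ X] [CompleteSpace X]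

/-- The inverse of the compact averaging operator, and a norm in which the compact second
difference is accretive, for a pair of mutually inverse contractions `E`, `E'`. -/
theorem exists_compact_inverse {E E' : X →L[ℝ] X} (hE : ‖E‖ ≤ 1) (hE' : ‖E'‖ ≤ 1)
    (hi : ∀ u, E (E' u) = u) (hi' : ∀ u, E' (E u) = u) :
    ∃ (Q B : X →L[ℝ] X) (p : X → ℝ),
    (∀ u, Q (u - (1 / 3 : ℝ) • (1 / 4 : ℝ) • ((2 : ℝ) • u - (E u + E' u))) = u) ∧
    (∀ u, Q ((1 / 4 : ℝ) • ((2 : ℝ) • u - (E u + E' u))) = B u) ∧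
    (∀ u, ‖u‖ ≤ p u) ∧ (∀ u, p (Q u) ≤ 5 * ‖u‖) ∧
    (∀ u v, p (u + v) ≤ p u + p v) ∧ (∀ (c : ℝ) u, p (c • u) = |c| * p u) ∧
    ∀ μ β : ℝ, 0 ≤ β → ∀ u, μ * p u ≤ p (μ • u + β • B u) := by
  have h1 : ‖(1 : X →L[ℝ] X)‖ ≤ 1 := ContinuousLinearMap.norm_id_le
  have hi : E * E' = 1 := ContinuousLinearMap.ext hi
  have hi' : E' * E = 1 := ContinuousLinearMap.ext hi'
  set S1 : X →L[ℝ] X := (1 / 2 : ℝ) • (E + E') with hS1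
  set L : X →L[ℝ] X := (1 / 4 : ℝ) • ((1 - E) * (1 - E')) with hLdef
  have hS1n : ‖S1‖ ≤ 1 := by
    rw [hS1, norm_smul]
    have := norm_add_le E E'
    norm_num
    linarith
  have hL : L = (1 / 2 : ℝ) • (1 - S1) := by
    have : (1 - E) * (1 - E') = 1 - E - E' + 1 := by
      rw [mul_sub, sub_mul, sub_mul, hi]
      noncomm_ring
    rw [hLdef, this, hS1]
    module
  have hLapp : ∀ u, (1 / 4 : ℝ) • ((2 : ℝ) • u - (E u + E' u)) = L u := by
    intro u
    rw [hL, hS1]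
    simp only [smul_apply, sub_apply, add_apply, one_apply_eq_self]
    module
  -- Since `L = (1 - S1)/2`, the averaging operator `1 - L/3` equals `(5/6)(1 - x)`. Its inverse is
  -- `6/5` times a Neumann series `Q` with `‖Q - 1‖ ≤ 1/4`, exactly the size allowed for the
  -- perturbation.
  set x : X →L[ℝ] X := -((1 / 5 : ℝ) • S1) with hx
  have hxn : ‖x‖ ≤ 1 / 5 := by
    rw [hx, norm_neg, norm_smul]
    norm_num
    linarith
  have hx1 : ‖x‖ < 1 := by linarith
  set Q := ∑' i : ℕ, x ^ i with hQ
  have hQ1 : Q * (1 - x) = 1 := geom_series_mul_neg x hx1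
  have hQ2 : (1 - x) * Q = 1 := mul_neg_geom_series x hx1
  have hQn : ‖Q‖ ≤ 5 / 4 := by
    refine (tsum_geometric_le_of_norm_lt_one x hx1).trans ?_
    have : (1 - ‖x‖)⁻¹ ≤ (4 / 5 : ℝ)⁻¹ := by
      gcongr
      linarith
    norm_num at this ⊢
    linarith
  have hG : Q - 1 = x * Q := by
    rw [sub_mul, one_mul] at hQ2
    rw [← hQ2]; abel
  have hGn : ‖Q - 1‖ ≤ 1 / 4 := by
    rw [hG]
    calc _ ≤ ‖x‖ * ‖Q‖ := norm_mul_le _ _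
      _ ≤ 1 / 5 * (5 / 4) := by gcongr
      _ = _ := by norm_num
  have hcx : Commute x Q := by
    have e1 : Q - Q * x = 1 := by rw [← hQ1]; noncomm_ring
    have e2 : Q - x * Q = 1 := by rw [← hQ2]; noncomm_ring
    have : Q - Q * x = Q - x * Q := e1.trans e2.symm
    exact (sub_right_injective this).symm
  have hLx : L = (1 / 2 : ℝ) • (1 + (5 : ℝ) • x) := by
    rw [hL, hx]
    module
  have hcL : Commute L (Q - 1) := by
    rw [hLx]
    exact (((Commute.one_left _).add_left ((hcx.sub_right (Commute.one_right x)).smul_left _))).smul_left _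
  have hbd : ∀ t : ℝ, 0 ≤ t →
      ‖NormedSpace.exp (-(t • (L * (1 + (Q - 1)))))‖
        ≤ 1 / (1 - Real.exp 1 / 4) := fun t ht =>
    norm_exp_perturbed_secondDiff_le h1 hE hE' hi hi' rfl hGn hcL ht
  obtain ⟨p, hp1, hp2, hp3, hp4, hp5⟩ := exists_accretive_norm hbd
  have he := Real.exp_one_lt_d9
  have hC : 1 / (1 - Real.exp 1 / 4) ≤ 10 / 3 := by
    rw [div_le_iff₀] <;> linarith
  refine ⟨(6 / 5 : ℝ) • Q,
    (6 / 5 : ℝ) • (L * (1 + (Q - 1))), p, fun u => ?_, fun u => ?_, hp1,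
    fun u => ?_, hp3, hp4, fun μ β hβ u => ?_⟩
  · rw [hLapp]
    have e : ((6 / 5 : ℝ) • Q) * (1 - (1 / 3 : ℝ) • L) = 1 := by
      refine Eq.trans ?_ hQ1
      rw [hLx, smul_mul_assoc, ← mul_smul_comm]
      congr 1
      module
    have := congrArg (fun F : X →L[ℝ] X => F u) e
    exact this
  · rw [hLapp]
    have e : ((6 / 5 : ℝ) • Q) * L
        = (6 / 5 : ℝ) • (L * (1 + (Q - 1))) := by
      rw [smul_mul_assoc, add_sub_cancel]
      congr 1
      have := hcL.eq
      rw [mul_sub, sub_mul, mul_one, one_mul] at this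
      exact (sub_left_injective this).symm
    exact congrArg (fun F : X →L[ℝ] X => F u) e
  -- The constant `5` is `10/3`, from the equivalence of norms, times `3/2 = (6/5)(5/4)`, the bound
  -- for the inverse averaging operator.
  · refine (hp2 _).trans ?_
    have hQn2 : ‖(6 / 5 : ℝ) • Q‖ ≤ 3 / 2 := by
      rw [norm_smul]
      norm_num
      linarith
    calc _ ≤ 10 / 3 * (3 / 2 * ‖u‖) := by
          gcongr
          exact (ContinuousLinearMap.le_opNorm _ _).trans (by gcongr)
      _ = _ := by ring
  · have := hp5 μ (β * (6 / 5)) (by positivity) u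
    rwa [mul_smul] at this

end Operators

/-- Maximum norm stability of compact difference schemes with a monotone memory kernel. -/
theorem exists_stability_constant : ∃ C : ℝ, 0 < C ∧
    ∀ (M N : ℕ) (h : ℝ) (A : ℕ → ℕ → ℝ) (e R : ℕ → ℕ → ℝ) (r : ℕ → ℝ) (κ β K : ℝ),
    1 ≤ N → 0 < h → 0 ≤ κ → 0 ≤ β → (∀ i ≤ N, e 0 i = 0) →
    (∀ n ≤ M, e n 0 = 0) → (∀ n ≤ M, e n N = 0) →
    (∀ n, 1 ≤ n → n ≤ M → 0 < A n 1) →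
    (∀ n k, 1 ≤ k → k < n → n ≤ M → A n k ≤ A n (k + 1)) →
    (∀ n i, 1 ≤ n → n ≤ M → 1 ≤ i → i < N →
      compactOp N h (fun j => ∑ k ∈ Finset.range n, A n (k + 1) * (e (k + 1) j - e k j)
        + κ * e n j) i - β * secondDiff h (e n) i = R n i) →
    (∀ n, 1 ≤ n → n ≤ M → 0 ≤ r n) →
    (∀ n i, 1 ≤ n → n ≤ M → 1 ≤ i → i < N → |R n i| ≤ r n) →
    (∀ n, 1 ≤ n → n ≤ M → C * r n ≤ A n 1 * K) →
    ∀ n, 1 ≤ n → n ≤ M → ∀ i ≤ N, |e n i| ≤ K := by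
  obtain ⟨Q, B, p, hQ, hB, hp1, hp2, hp3, hp4, hp5⟩ := exists_compact_inverse
    (norm_shift_le 1) (norm_shift_le (-1)) (shift_shift_neg 1) (shift_shift_neg (-1))
  refine ⟨5, by norm_num, ?_⟩
  intro M N h A e R r κ β K hN hh hκ hβ h0 hl hr hA hmono heq hr0 hR hK
  -- On the lattice `δ²` becomes `-(4/h^2) L`. This is the origin of the coefficient `β * (4 / h ^
  -- 2)` below and of `1/3 = (1/12) * 4` in the averaging operator.
  have hlap : ∀ u : ℕ → ℝ, u 0 = 0 → u N = 0 →
      (1 / 4 : ℝ) • ((2 : ℝ) • oddExt hN u - (shift 1 (oddExt hN u) + shift (-1) (oddExt hN u)))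
      = oddExt hN (fun i => if 1 ≤ i ∧ i < N then -(h ^ 2 / 4) * secondDiff h u i else 0) := by
    intro u hu0 huN
    have e2 : (fun i => if 1 ≤ i ∧ i < N then -(h ^ 2 / 4) * secondDiff h u i else 0)
        = fun i => (1 / 4 : ℝ) * ((if 1 ≤ i ∧ i < N then 2 * u i else 0)
          - (if 1 ≤ i ∧ i < N then u (i + 1) + u (i - 1) else 0)) := by
      funext i
      split_ifs
      · rw [secondDiff]
        field_simp
        ring
      · ring
    have e3 : (fun i => if 1 ≤ i ∧ i < N then -(h ^ 2 / 4) * secondDiff h u i else 0)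
        = (1 / 4 : ℝ) • ((fun i => (if 1 ≤ i ∧ i < N then 2 * u i else 0))
          - (fun i => if 1 ≤ i ∧ i < N then u (i + 1) + u (i - 1) else 0)) := e2
    have e4 : oddExt hN (fun i => (if 1 ≤ i ∧ i < N then 2 * u i else 0)) = oddExt hN ((2 : ℝ) • u) := by
      refine oddExt_congr hN fun i hi => ?_
      split_ifs with hcase
      · rfl
      · rcases (show i = 0 ∨ i = N by omega) with rfl | rfl <;> simp [hu0, huN]
    rw [e3, map_smul, map_sub, e4, map_smul]
    ext z
    have := oddExt_neighbours hN hu0 huN z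
    simp only [BoundedContinuousFunction.smul_apply, BoundedContinuousFunction.sub_apply,
      BoundedContinuousFunction.add_apply, shift_apply, this]
  have hcomp : ∀ u : ℕ → ℝ, u 0 = 0 → u N = 0 →
      oddExt hN u - (1 / 3 : ℝ) • (1 / 4 : ℝ) • ((2 : ℝ) • oddExt hN u
          - (shift 1 (oddExt hN u) + shift (-1) (oddExt hN u)))
        = oddExt hN (fun i => if 1 ≤ i ∧ i < N then compactOp N h u i else 0) := by
    intro u hu0 huN
    rw [hlap u hu0 huN, ← map_smul, ← map_sub]
    refine oddExt_congr hN fun i hi => ?_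
    simp only [Pi.sub_apply, Pi.smul_apply, smul_eq_mul]
    split_ifs with hcase
    · rw [compactOp, if_pos hcase]
      ring
    · rcases (show i = 0 ∨ i = N by omega) with rfl | rfl <;> simp [hu0, huN]
  have key := norm_le_of_monotone_kernel (B := B) (p := p) hp3 hp4 hp5 (M := M) (A := A)
    (W := fun n => oddExt hN (e n))
    (ρ := fun n => Q (oddExt hN (fun i => if 1 ≤ i ∧ i < N then R n i else 0)))
    (κ := κ) (β := β * (4 / h ^ 2)) (K := K) hκ (by positivity)
    (by rw [oddExt_congr hN (v := 0) h0, map_zero]) hA hmono ?_ ?_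
  · intro n hn hnM i hi
    rw [← oddExt_natCast hN hi (e n)]
    exact ((oddExt hN (e n)).norm_coe_le_norm _).trans ((hp1 _).trans (key n hn hnM))
  · intro n hn hnM
    set y : ℕ → ℝ := fun j => ∑ k ∈ Finset.range n, A n (k + 1) * (e (k + 1) j - e k j)
        + κ * e n j with hy
    have hy2 : ∑ k ∈ Finset.range n, A n (k + 1) • (oddExt hN (e (k + 1)) - oddExt hN (e k))
        + κ • oddExt hN (e n) = oddExt hN y := by
      simp only [← map_sub, ← map_smul, ← map_sum, ← map_add]
      congr 1
      funext j
      simp [hy]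
    -- Zero boundary values of `y` are needed for the odd extension to commute with the averaging
    -- operator.
    have hzero : ∀ j, (∀ m ≤ M, e m j = 0) → y j = 0 := by
      intro j hj
      simp only [hy]
      rw [hj n hnM, Finset.sum_eq_zero, mul_zero, add_zero]
      intro k hk
      have := Finset.mem_range.1 hk
      rw [hj (k + 1) (by omega), hj k (by omega), sub_zero, mul_zero]
    have hy0 := hzero 0 hl
    have hyN := hzero N hr
    rw [hy2, ← hQ (oddExt hN y), ← hB, ← map_smul Q, ← map_add, hcomp y hy0 hyN,
      hlap (e n) (hl n hnM) (hr n hnM), ← map_smul, ← map_add]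
    congr 2
    funext i
    simp only [Pi.add_apply, Pi.smul_apply, smul_eq_mul]
    split_ifs with hcase
    · rw [← heq n i hn hnM hcase.1 hcase.2]
      field_simp
      ring
    · ring
  · intro n hn hnM
    refine (hp2 _).trans (le_trans ?_ (hK n hn hnM))
    gcongr
    refine norm_oddExt_le hN fun i _ => ?_
    split_ifs with hcase
    · exact hR n i hn hnM hcase.1 hcase.2
    · rw [abs_zero]
      exact hr0 n hn hnM

end Lattice
end TemperedBS
end

namespace TemperedBS

/-! ### Quadrature errors for weakly singular functions -/

section WeaklySingular
open MeasureTheory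

/-- `w` is continuous on `[0, T]` with two derivatives `w1`, `w2` on `(0, T)` which have at most the
singularities of the derivatives of `t ^ α`. -/
structure WeaklySingular (α T A : ℝ) (w w1 w2 : ℝ → ℝ) : Prop where
  cont : ContinuousOn w (Icc 0 T)
  deriv1 : ∀ t ∈ Ioo 0 T, HasDerivAt w (w1 t) t
  deriv2 : ∀ t ∈ Ioo 0 T, HasDerivAt w1 (w2 t) t
  bound1 : ∀ t ∈ Ioo 0 T, |w1 t| ≤ A * t ^ (α - 1)
  bound2 : ∀ t ∈ Ioo 0 T, |w2 t| ≤ A * t ^ (α - 2)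

theorem intervalIntegrable_sub_rpow {α : ℝ} (hα : α < 1) (t a b : ℝ) :
    IntervalIntegrable (fun s => (t - s) ^ (-α)) volume a b := by
  have h := (intervalIntegral.intervalIntegrable_rpow' (a := t - a) (b := t - b) (r := -α)
    (by linarith)).comp_sub_left t
  simpa using h

theorem integral_sub_rpow {α : ℝ} (hα : α < 1) (t a b : ℝ) :
    ∫ s in a..b, (t - s) ^ (-α) = ((t - a) ^ (1 - α) - (t - b) ^ (1 - α)) / (1 - α) := by
  rw [intervalIntegral.integral_comp_sub_left (fun x => x ^ (-α)) t,
    integral_rpow (Or.inl (by linarith))]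
  rw [show -α + 1 = 1 - α by ring]

/-- Integration by parts against the kernel `(t - s) ^ (-α)`, away from its singularity. -/
theorem abs_integral_kernel_sub_le {α t a b B : ℝ} (hα : 0 < α) (hab : a ≤ b) (hbt : b < t)
    {e e1 : ℝ → ℝ} (he : ContinuousOn e (Icc a b)) (he1 : ∀ s ∈ Ioo a b, HasDerivAt e (e1 s) s)
    (hint : IntervalIntegrable e1 volume a b) (hB : ∀ s ∈ Icc a b, |e s| ≤ B) :
    |(∫ s in a..b, (t - s) ^ (-α) * e1 s) - ((t - b) ^ (-α) * e b - (t - a) ^ (-α) * e a)|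
      ≤ B * ((t - b) ^ (-α) - (t - a) ^ (-α)) := by
  have hpos : ∀ s ∈ Icc a b, 0 < t - s := fun s hs => by linarith [hs.2]
  have hu : ∀ s ∈ Icc a b, HasDerivAt (fun s => (t - s) ^ (-α)) (α * (t - s) ^ (-α - 1)) s := by
    intro s hs
    have := ((hasDerivAt_id s).const_sub t).rpow_const (p := -α) (Or.inl (hpos s hs).ne')
    refine this.congr_deriv ?_
    simp
  have huc : ContinuousOn (fun s => (t - s) ^ (-α)) (Icc a b) := fun s hs =>
    (hu s hs).continuousAt.continuousWithinAt
  have hu1 : ContinuousOn (fun s => α * (t - s) ^ (-α - 1)) (Icc a b) := by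
    refine continuousOn_const.mul (ContinuousOn.rpow_const (by fun_prop) fun s hs => ?_)
    exact Or.inl (hpos s hs).ne'
  have hu1i : IntervalIntegrable (fun s => α * (t - s) ^ (-α - 1)) volume a b :=
    ContinuousOn.intervalIntegrable (by rwa [uIcc_of_le hab])
  have hparts := intervalIntegral.integral_mul_deriv_eq_deriv_mul_of_hasDerivAt
    (u := fun s => (t - s) ^ (-α)) (v := e) (u' := fun s => α * (t - s) ^ (-α - 1)) (v' := e1)
    (a := a) (b := b) (by rwa [uIcc_of_le hab]) (by rwa [uIcc_of_le hab])
    (fun s hs => hu s (by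
      rw [min_eq_left hab, max_eq_right hab] at hs
      exact ⟨hs.1.le, hs.2.le⟩))
    (fun s hs => he1 s (by rwa [min_eq_left hab, max_eq_right hab] at hs)) hu1i hint
  rw [hparts, sub_sub_cancel_left, abs_neg]
  have hftc : ∫ s in a..b, α * (t - s) ^ (-α - 1) = (t - b) ^ (-α) - (t - a) ^ (-α) :=
    intervalIntegral.integral_eq_sub_of_hasDerivAt
      (fun s hs => hu s (by rwa [uIcc_of_le hab] at hs)) hu1i
  rw [← hftc, ← intervalIntegral.integral_const_mul, ← Real.norm_eq_abs]
  refine intervalIntegral.norm_integral_le_of_norm_le hab ?_ (hu1i.const_mul B)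
  filter_upwards with s hs
  have hs' : s ∈ Icc a b := ⟨hs.1.le, hs.2⟩
  have h1 : 0 ≤ α * (t - s) ^ (-α - 1) := by
    have := hpos s hs'
    positivity
  rw [Real.norm_eq_abs, abs_mul, abs_of_nonneg h1, mul_comm]
  exact mul_le_mul_of_nonneg_right (hB s hs') h1

variable {α T A : ℝ} {w w1 w2 : ℝ → ℝ}

theorem WeaklySingular.nonneg (hw : WeaklySingular α T A w w1 w2) (hT : 0 < T) : 0 ≤ A := by
  have h := hw.bound1 (T / 2) ⟨by linarith, by linarith⟩
  have h2 : 0 < (T / 2) ^ (α - 1) := by positivity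
  by_contra hA
  have := mul_neg_of_neg_of_pos (not_le.1 hA) h2
  linarith [abs_nonneg (w1 (T / 2))]

/-- Both `(A/α) s^α - w` and `(A/α) s^α + w` are nondecreasing. Derivatives are needed only in the
interior, so the left end may be `0`. -/
theorem WeaklySingular.abs_increment_le (hw : WeaklySingular α T A w w1 w2) (hα : 0 < α)
    {a b : ℝ} (ha : 0 ≤ a) (hab : a ≤ b) (hb : b ≤ T) :
    |w b - w a| ≤ A / α * (b ^ α - a ^ α) := by
  have hcont : ContinuousOn (fun s : ℝ => A / α * s ^ α) (Icc 0 T) :=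
    continuousOn_const.mul (ContinuousOn.rpow_const continuousOn_id fun _ _ => Or.inr hα.le)
  have hd : ∀ s ∈ Ioo 0 T, HasDerivAt (fun s : ℝ => A / α * s ^ α) (A * s ^ (α - 1)) s := by
    intro s hs
    refine ((Real.hasDerivAt_rpow_const (x := s) (p := α)
      (Or.inl hs.1.ne')).const_mul (A / α)).congr_deriv ?_
    rw [← mul_assoc, div_mul_cancel₀ A hα.ne']
  have h1 : MonotoneOn (fun s => A / α * s ^ α - w s) (Icc 0 T) := by
    refine monotoneOn_of_hasDerivWithinAt_nonneg (f' := fun s => A * s ^ (α - 1) - w1 s)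
      (convex_Icc 0 T) (hcont.sub hw.cont) (fun s hs => ?_) (fun s hs => ?_)
    · rw [interior_Icc] at hs
      exact ((hd s hs).sub (hw.deriv1 s hs)).hasDerivWithinAt
    · rw [interior_Icc] at hs
      have := (abs_le.1 (hw.bound1 s hs)).2
      linarith
  have h2 : MonotoneOn (fun s => A / α * s ^ α + w s) (Icc 0 T) := by
    refine monotoneOn_of_hasDerivWithinAt_nonneg (f' := fun s => A * s ^ (α - 1) + w1 s)
      (convex_Icc 0 T) (hcont.add hw.cont) (fun s hs => ?_) (fun s hs => ?_)
    · rw [interior_Icc] at hs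
      exact ((hd s hs).add (hw.deriv1 s hs)).hasDerivWithinAt
    · rw [interior_Icc] at hs
      have := (abs_le.1 (hw.bound1 s hs)).1
      linarith
  have h3 := h1 ⟨ha, hab.trans hb⟩ ⟨ha.trans hab, hb⟩ hab
  have h4 := h2 ⟨ha, hab.trans hb⟩ ⟨ha.trans hab, hb⟩ hab
  simp only at h3 h4
  rw [abs_le]
  constructor <;> linarith

theorem WeaklySingular.continuousOn_deriv (hw : WeaklySingular α T A w w1 w2) :
    ContinuousOn w1 (Ioo 0 T) := fun s hs =>
  (hw.deriv2 s hs).continuousAt.continuousWithinAt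

theorem WeaklySingular.intervalIntegrable_deriv (hw : WeaklySingular α T A w w1 w2) (hα : 0 < α)
    {a b : ℝ} (ha : 0 ≤ a) (hab : a ≤ b) (hb : b ≤ T) : IntervalIntegrable w1 volume a b := by
  have h := (intervalIntegral.intervalIntegrable_rpow' (a := a) (b := b) (r := α - 1)
    (by linarith)).const_mul A
  rw [intervalIntegrable_iff_integrableOn_Ioo_of_le hab] at h ⊢
  have hsub : Ioo a b ⊆ Ioo 0 T := Ioo_subset_Ioo ha hb
  refine h.mono' ((hw.continuousOn_deriv.mono hsub).aestronglyMeasurable measurableSet_Ioo) ?_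
  filter_upwards [ae_restrict_mem measurableSet_Ioo] with s hs
  exact hw.bound1 s (hsub hs)

/-- The kernel is singular at `t` and `w1` at `0`. On either side of `t/2` one of the two factors is
bounded by its value there. -/
theorem WeaklySingular.intervalIntegrable_kernel_mul (hw : WeaklySingular α T A w w1 w2)
    (hα : 0 < α) (hα1 : α < 1) {t : ℝ} (ht : 0 < t) (htT : t ≤ T) :
    IntervalIntegrable (fun s => (t - s) ^ (-α) * w1 s) volume 0 t := by
  have h1 := (intervalIntegral.intervalIntegrable_rpow' (a := 0) (b := t) (r := α - 1)
    (by linarith)).const_mul ((t / 2) ^ (-α))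
  have h2 := (intervalIntegrable_sub_rpow hα1 t 0 t).const_mul ((t / 2) ^ (α - 1))
  have h := (h1.add h2).const_mul A
  have hA := hw.nonneg (ht.trans_le htT)
  rw [intervalIntegrable_iff_integrableOn_Ioo_of_le ht.le] at h ⊢
  have hsub : Ioo 0 t ⊆ Ioo 0 T := Ioo_subset_Ioo le_rfl htT
  refine h.mono' (ContinuousOn.aestronglyMeasurable ?_ measurableSet_Ioo) ?_
  · refine ContinuousOn.mul (ContinuousOn.rpow_const (by fun_prop) fun s hs => ?_)
      (hw.continuousOn_deriv.mono hsub)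
    exact Or.inl (sub_pos.2 hs.2).ne'
  filter_upwards [ae_restrict_mem measurableSet_Ioo] with s hs
  have hts : 0 < t - s := sub_pos.2 hs.2
  rw [norm_mul, Real.norm_of_nonneg (by positivity), Real.norm_eq_abs]
  have hs0 := hs.1
  calc _ ≤ (t - s) ^ (-α) * (A * s ^ (α - 1)) := by
        gcongr
        exact hw.bound1 s (hsub hs)
    _ = A * ((t - s) ^ (-α) * s ^ (α - 1)) := by ring
    _ ≤ A * ((t / 2) ^ (-α) * s ^ (α - 1) + (t / 2) ^ (α - 1) * (t - s) ^ (-α)) := by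
        gcongr
        rcases le_total s (t / 2) with h3 | h3
        · have : (t - s) ^ (-α) ≤ (t / 2) ^ (-α) :=
            Real.rpow_le_rpow_of_nonpos (by positivity) (by linarith) (by linarith)
          have h5 : 0 ≤ (t / 2) ^ (α - 1) * (t - s) ^ (-α) := by positivity
          have := mul_le_mul_of_nonneg_right this (show 0 ≤ s ^ (α - 1) by positivity)
          linarith
        · have : s ^ (α - 1) ≤ (t / 2) ^ (α - 1) :=
            Real.rpow_le_rpow_of_nonpos (by positivity) h3 (by linarith)
          have h5 : 0 ≤ (t / 2) ^ (-α) * s ^ (α - 1) := by positivity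
          have := mul_le_mul_of_nonneg_right this (show 0 ≤ (t - s) ^ (-α) by positivity)
          linarith

theorem WeaklySingular.intervalIntegrable_kernel_mul_of_subset
    (hw : WeaklySingular α T A w w1 w2) (hα : 0 < α) (hα1 : α < 1) {t a b : ℝ} (ha : 0 ≤ a)
    (hab : a ≤ b) (hbt : b ≤ t) (ht : 0 < t) (htT : t ≤ T) :
    IntervalIntegrable (fun s => (t - s) ^ (-α) * w1 s) volume a b := by
  refine (hw.intervalIntegrable_kernel_mul hα hα1 ht htT).mono_set ?_
  rw [uIcc_of_le hab, uIcc_of_le ht.le]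
  exact Icc_subset_Icc ha hbt

/-- A small function has a small fractional derivative. -/
theorem WeaklySingular.abs_integral_kernel_le (hw : WeaklySingular α T A w w1 w2) (hα : 0 < α)
    (hα1 : α < 1) {t η δ : ℝ} (htT : t ≤ T) (hδ : 0 < δ) (hδt : δ ≤ t / 2)
    (hη : ∀ s ∈ Icc 0 t, |w s| ≤ η) :
    |∫ s in (0 : ℝ)..t, (t - s) ^ (-α) * w1 s|
      ≤ 2 * η * δ ^ (-α) + A * (t / 2) ^ (α - 1) * (δ ^ (1 - α) / (1 - α)) := by
  have ht : 0 < t := by linarith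
  have hA := hw.nonneg (ht.trans_le htT)
  -- Before `t - δ` the derivative is removed by parts, and only the smallness of `w` is used. The
  -- boundary terms and the variation of the kernel add up to `2 η δ^(-α)`. On the last piece the
  -- kernel is integrable and `w1` is controlled by its size at `t/2`.
  rw [← intervalIntegral.integral_add_adjacent_intervals (b := t - δ)
    (hw.intervalIntegrable_kernel_mul_of_subset hα hα1 le_rfl (by linarith) (by linarith) ht htT)
    (hw.intervalIntegrable_kernel_mul_of_subset hα hα1 (by linarith) (by linarith) le_rfl ht htT)]
  refine (abs_add_le _ _).trans (add_le_add ?_ ?_)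
  · have h := abs_integral_kernel_sub_le (t := t) hα (show (0 : ℝ) ≤ t - δ by linarith) (by linarith)
      (hw.cont.mono (Icc_subset_Icc le_rfl (by linarith)))
      (fun s hs => hw.deriv1 s ⟨hs.1, by linarith [hs.2]⟩)
      (hw.intervalIntegrable_deriv hα le_rfl (by linarith) (by linarith))
      (B := η) (fun s hs => hη s ⟨hs.1, by linarith [hs.2]⟩)
    rw [sub_sub_cancel, sub_zero] at h
    have h1 : |δ ^ (-α) * w (t - δ) - t ^ (-α) * w 0| ≤ δ ^ (-α) * η + t ^ (-α) * η := by
      refine (abs_sub _ _).trans ?_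
      rw [abs_mul, abs_mul, abs_of_nonneg (show 0 ≤ δ ^ (-α) by positivity),
        abs_of_nonneg (show 0 ≤ t ^ (-α) by positivity)]
      gcongr
      · exact hη _ ⟨by linarith, by linarith⟩
      · exact hη _ ⟨by linarith, by linarith⟩
    have h2 := abs_sub_abs_le_abs_sub (∫ s in (0 : ℝ)..(t - δ), (t - s) ^ (-α) * w1 s)
      (δ ^ (-α) * w (t - δ) - t ^ (-α) * w 0)
    linarith
  · have h := (intervalIntegrable_sub_rpow hα1 t (t - δ) t).const_mul (A * (t / 2) ^ (α - 1))
    have h2 : ∫ s in (t - δ)..t, (t - s) ^ (-α) = δ ^ (1 - α) / (1 - α) := by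
      rw [integral_sub_rpow hα1, sub_self, Real.zero_rpow (by linarith), sub_sub_cancel, sub_zero]
    rw [← h2, ← intervalIntegral.integral_const_mul, ← Real.norm_eq_abs]
    refine intervalIntegral.norm_integral_le_of_norm_le (by linarith) ?_ h
    have hne : ∀ᵐ s ∂(volume : Measure ℝ), s ≠ t := by
      simp [ae_iff, measure_singleton]
    filter_upwards [hne] with s hst hs
    have hs1 : s < t := lt_of_le_of_ne hs.2 hst
    have hts : 0 < t - s := by linarith
    rw [norm_mul, Real.norm_of_nonneg (by positivity), Real.norm_eq_abs, mul_comm]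
    have h3 : s ^ (α - 1) ≤ (t / 2) ^ (α - 1) :=
      Real.rpow_le_rpow_of_nonpos (by positivity) (by linarith [hs.1]) (by linarith)
    have h4 := hw.bound1 s ⟨by linarith [hs.1], by linarith⟩
    gcongr
    exact h4.trans (by gcongr)

/-- Linear interpolation away from the singularity. -/
theorem WeaklySingular.abs_deriv_sub_slope_le (hw : WeaklySingular α T A w w1 w2) (hα1 : α < 1)
    {a b : ℝ} (ha : 0 < a) (hab : a < b) (hb : b ≤ T) {s : ℝ} (hs : s ∈ Ioo a b) :
    |w1 s - (w b - w a) / (b - a)| ≤ A * a ^ (α - 2) * (b - a) := by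
  have hA := hw.nonneg (ha.trans (hab.trans_le hb))
  obtain ⟨ξ, hξ, hξe⟩ := exists_hasDerivAt_eq_slope w w1 hab
    (hw.cont.mono (Icc_subset_Icc ha.le hb))
    (fun s hs => hw.deriv1 s ⟨ha.trans hs.1, hs.2.trans_le hb⟩)
  rw [← hξe]
  have h := Convex.norm_image_sub_le_of_norm_hasDerivWithin_le (f := w1) (f' := w2)
    (s := Ioo a b) (C := A * a ^ (α - 2))
    (fun s hs => (hw.deriv2 s ⟨ha.trans hs.1, hs.2.trans_le hb⟩).hasDerivWithinAt)
    (fun s hs => by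
      have h3 : s ^ (α - 2) ≤ a ^ (α - 2) := Real.rpow_le_rpow_of_nonpos ha hs.1.le (by linarith)
      exact (hw.bound2 s ⟨ha.trans hs.1, hs.2.trans_le hb⟩).trans (by gcongr)) (convex_Ioo a b) hξ hs
  refine h.trans ?_
  gcongr
  rw [Real.norm_eq_abs, abs_le]
  constructor <;> linarith [hs.1, hs.2, hξ.1, hξ.2]

theorem WeaklySingular.abs_sub_interpolant_le (hw : WeaklySingular α T A w w1 w2) (hα1 : α < 1)
    {a b : ℝ} (ha : 0 < a) (hab : a < b) (hb : b ≤ T) {s : ℝ} (hs : s ∈ Icc a b) :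
    |w s - w a - (w b - w a) / (b - a) * (s - a)| ≤ A * a ^ (α - 2) * (b - a) ^ 2 := by
  have hA := hw.nonneg (ha.trans (hab.trans_le hb))
  rcases hs.1.eq_or_lt with rfl | has
  · simp
    positivity
  obtain ⟨ξ, hξ, hξe⟩ := exists_hasDerivAt_eq_slope w w1 has
    (hw.cont.mono (Icc_subset_Icc ha.le (hs.2.trans hb)))
    (fun r hr => hw.deriv1 r ⟨ha.trans hr.1, hr.2.trans_le (hs.2.trans hb)⟩)
  have hsa : 0 < s - a := by linarith
  have e : w s - w a = w1 ξ * (s - a) := by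
    rw [hξe]
    field_simp
  rw [e, ← sub_mul, abs_mul, abs_of_pos hsa]
  calc _ ≤ A * a ^ (α - 2) * (b - a) * (b - a) := by
        gcongr
        · exact hw.abs_deriv_sub_slope_le hα1 ha hab hb ⟨hξ.1, hξ.2.trans_le hs.2⟩
        · exact hs.2
    _ = _ := by ring

/-- The first cell touches the singularity, where `w2` gives no bound; both parts are estimated by
the increment of `w`. -/
theorem WeaklySingular.abs_sub_interpolant_zero_le (hw : WeaklySingular α T A w w1 w2)
    (hα : 0 < α) {b : ℝ} (hb0 : 0 < b) (hb : b ≤ T) {s : ℝ} (hs : s ∈ Icc 0 b) :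
    |w s - w 0 - (w b - w 0) / (b - 0) * (s - 0)| ≤ 2 * (A / α) * b ^ α := by
  have hA := hw.nonneg (hb0.trans_le hb)
  have h1 := hw.abs_increment_le hα le_rfl hs.1 (hs.2.trans hb)
  have h2 := hw.abs_increment_le hα le_rfl hb0.le hb
  rw [Real.zero_rpow hα.ne', sub_zero] at h1 h2
  have h3 : s ^ α ≤ b ^ α := Real.rpow_le_rpow hs.1 hs.2 hα.le
  have h4 : |(w b - w 0) / (b - 0) * (s - 0)| ≤ |w b - w 0| := by
    rw [sub_zero, sub_zero, abs_mul, abs_div, abs_of_pos hb0, abs_of_nonneg hs.1]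
    rw [div_mul_eq_mul_div, div_le_iff₀ hb0]
    exact mul_le_mul_of_nonneg_left hs.2 (abs_nonneg _)
  have h5 := abs_sub (w s - w 0) ((w b - w 0) / (b - 0) * (s - 0))
  have h6 : A / α * s ^ α ≤ A / α * b ^ α := by gcongr
  linarith

/-- The error of the L1 formula on one cell `[a, b]` at distance from `t`. -/
theorem WeaklySingular.abs_cell_error_le (hw : WeaklySingular α T A w w1 w2) (hα : 0 < α)
    (hα1 : α < 1) {t a b B : ℝ} (ha : 0 ≤ a) (hab : a < b) (hbt : b < t) (htT : t ≤ T)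
    (hB : ∀ s ∈ Icc a b, |w s - w a - (w b - w a) / (b - a) * (s - a)| ≤ B) :
    |(1 / (b - a) * ∫ s in a..b, (t - s) ^ (-α)) * (w b - w a)
        - ∫ s in a..b, (t - s) ^ (-α) * w1 s|
      ≤ B * ((t - b) ^ (-α) - (t - a) ^ (-α)) := by
  have hba : b - a ≠ 0 := by linarith
  -- The interpolation error vanishes at both ends of the cell, so no boundary terms remain.
  have h := abs_integral_kernel_sub_le (t := t) hα hab.le hbt
    (e := fun s => w s - w a - (w b - w a) / (b - a) * (s - a))
    (e1 := fun s => w1 s - (w b - w a) / (b - a)) (B := B)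
    (((hw.cont.mono (Icc_subset_Icc ha (hbt.le.trans htT))).sub continuousOn_const).sub
      (by fun_prop))
    (fun s hs => by
      have h1 := hw.deriv1 s ⟨ha.trans_lt hs.1, hs.2.trans (hbt.trans_le htT)⟩
      have h2 := (((hasDerivAt_id s).sub_const a).const_mul ((w b - w a) / (b - a)))
      rw [mul_one] at h2
      exact (h1.sub_const (w a)).sub h2)
    ((hw.intervalIntegrable_deriv hα ha hab.le (hbt.le.trans htT)).sub
      intervalIntegrable_const) hB
  have h0 : w b - w a - (w b - w a) / (b - a) * (b - a) = 0 := by field_simp; ring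
  simp only [sub_self, mul_zero, h0, sub_zero] at h
  have e : ∫ s in a..b, (t - s) ^ (-α) * (w1 s - (w b - w a) / (b - a))
      = (∫ s in a..b, (t - s) ^ (-α) * w1 s)
        - (1 / (b - a) * ∫ s in a..b, (t - s) ^ (-α)) * (w b - w a) := by
    have : ∀ s, (t - s) ^ (-α) * (w1 s - (w b - w a) / (b - a))
        = (t - s) ^ (-α) * w1 s - (t - s) ^ (-α) * ((w b - w a) / (b - a)) := fun s => by ring
    simp only [this]
    rw [intervalIntegral.integral_sub
      (hw.intervalIntegrable_kernel_mul_of_subset hα hα1 ha hab.le hbt.le (by linarith) htT)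
      ((intervalIntegrable_sub_rpow hα1 t a b).mul_const _), intervalIntegral.integral_mul_const]
    ring
  rw [e, abs_sub_comm] at h
  exact h

/-- The error of the L1 formula on the last cell `[a, t]`. -/
theorem WeaklySingular.abs_last_cell_error_le (hw : WeaklySingular α T A w w1 w2) (hα : 0 < α)
    (hα1 : α < 1) {t a : ℝ} (ha : 0 < a) (hat : a < t) (htT : t ≤ T) :
    |(1 / (t - a) * ∫ s in a..t, (t - s) ^ (-α)) * (w t - w a)
        - ∫ s in a..t, (t - s) ^ (-α) * w1 s|
      ≤ A * a ^ (α - 2) * (t - a) * ((t - a) ^ (1 - α) / (1 - α)) := by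
  have h2 : ∫ s in a..t, (t - s) ^ (-α) = (t - a) ^ (1 - α) / (1 - α) := by
    rw [integral_sub_rpow hα1, sub_self, Real.zero_rpow (by linarith), sub_zero]
  have hki := intervalIntegrable_sub_rpow hα1 t a t
  -- Integration by parts would produce a nonintegrable kernel at `t`. The error of the slope is
  -- integrated against the kernel itself.
  have e : (1 / (t - a) * ∫ s in a..t, (t - s) ^ (-α)) * (w t - w a)
        - ∫ s in a..t, (t - s) ^ (-α) * w1 s
      = ∫ s in a..t, (t - s) ^ (-α) * ((w t - w a) / (t - a) - w1 s) := by
    have : ∀ s, (t - s) ^ (-α) * ((w t - w a) / (t - a) - w1 s)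
        = (t - s) ^ (-α) * ((w t - w a) / (t - a)) - (t - s) ^ (-α) * w1 s := fun s => by ring
    simp only [this]
    rw [intervalIntegral.integral_sub (hki.mul_const _)
      (hw.intervalIntegrable_kernel_mul_of_subset hα hα1 ha.le hat.le le_rfl (by linarith) htT),
      intervalIntegral.integral_mul_const]
    ring
  rw [e, ← h2, ← intervalIntegral.integral_const_mul, ← Real.norm_eq_abs]
  refine intervalIntegral.norm_integral_le_of_norm_le hat.le ?_
    (hki.const_mul (A * a ^ (α - 2) * (t - a)))
  have hne : ∀ᵐ s ∂(volume : Measure ℝ), s ≠ t := by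
    simp [ae_iff, measure_singleton]
  filter_upwards [hne] with s hst hs
  have hs1 : s < t := lt_of_le_of_ne hs.2 hst
  have hts : 0 < t - s := by linarith
  rw [norm_mul, Real.norm_of_nonneg (by positivity), Real.norm_eq_abs, mul_comm, abs_sub_comm]
  gcongr
  exact hw.abs_deriv_sub_slope_le hα1 ha hat htT ⟨hs.1, hs1⟩

end WeaklySingular

/-! ### The graded mesh and the L1 coefficients -/

section Mesh
open MeasureTheory

variable {α T γ : ℝ} {M : ℕ}

theorem timeNode_zero (hγ : 1 ≤ γ) : timeNode T γ M 0 = 0 := by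
  simp [timeNode, Real.zero_rpow (by linarith : γ ≠ 0)]

theorem timeNode_self (hM : 1 ≤ M) : timeNode T γ M M = T := by
  have : (M : ℝ) ≠ 0 := by positivity
  simp [timeNode, div_self this]

theorem timeNode_nonneg (hT : 0 < T) (n : ℕ) : 0 ≤ timeNode T γ M n := by
  unfold timeNode; positivity

theorem timeNode_pos (hT : 0 < T) (hM : 1 ≤ M) {n : ℕ} (hn : 1 ≤ n) : 0 < timeNode T γ M n := by
  unfold timeNode; positivity

theorem timeNode_mono (hT : 0 < T) (hγ : 1 ≤ γ) {m n : ℕ} (h : m ≤ n) :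
    timeNode T γ M m ≤ timeNode T γ M n := by
  unfold timeNode; gcongr

theorem timeNode_lt (hT : 0 < T) (hγ : 1 ≤ γ) (hM : 1 ≤ M) {m n : ℕ} (h : m < n) :
    timeNode T γ M m < timeNode T γ M n := by
  unfold timeNode; gcongr

theorem timeNode_le (hT : 0 < T) (hγ : 1 ≤ γ) (hM : 1 ≤ M) {n : ℕ} (h : n ≤ M) :
    timeNode T γ M n ≤ T := (timeNode_mono hT hγ h).trans_eq (timeNode_self hM)

theorem timeNode_eq_mul (hM : 1 ≤ M) {m n : ℕ} (hn : 1 ≤ n) :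
    timeNode T γ M m = timeNode T γ M n * ((m : ℝ) / n) ^ γ := by
  have h1 : (M : ℝ) ≠ 0 := by positivity
  have h2 : (n : ℝ) ≠ 0 := by positivity
  rw [timeNode, timeNode, mul_assoc, ← Real.mul_rpow (by positivity) (by positivity)]
  congr 2
  field_simp

theorem timeStep_succ (n : ℕ) :
    timeStep T γ M (n + 1) = timeNode T γ M (n + 1) - timeNode T γ M n := rfl

theorem timeStep_pos (hT : 0 < T) (hγ : 1 ≤ γ) (hM : 1 ≤ M) {n : ℕ} (hn : 1 ≤ n) :
    0 < timeStep T γ M n := sub_pos.2 (timeNode_lt hT hγ hM (by omega))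

/-- Bernoulli's inequality `(1 - 1/n)^γ ≥ 1 - γ/n`. -/
theorem timeStep_le (hT : 0 < T) (hγ : 1 ≤ γ) (hM : 1 ≤ M) {n : ℕ} (hn : 1 ≤ n) :
    timeStep T γ M n ≤ γ * timeNode T γ M n / n := by
  have h1 : (1 : ℝ) ≤ n := by exact_mod_cast hn
  have h0 : (n : ℝ) ≠ 0 := by positivity
  have hb := one_add_mul_self_le_rpow_one_add (s := -(1 / (n : ℝ)))
    (by rw [neg_le_neg_iff, div_le_one (by positivity)]; exact h1) hγ
  have e : (((n - 1 : ℕ) : ℝ) / n) = 1 + -(1 / (n : ℝ)) := by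
    rw [Nat.cast_sub hn]; field_simp; push_cast; ring
  rw [timeStep, timeNode_eq_mul (m := n - 1) hM hn, e]
  have := mul_le_mul_of_nonneg_left hb (timeNode_nonneg (γ := γ) (M := M) hT n)
  have e2 : timeNode T γ M n * (1 + γ * -(1 / (n : ℝ)))
    = timeNode T γ M n - γ * timeNode T γ M n / n := by ring
  linarith

theorem le_timeStep (hT : 0 < T) (hγ : 1 ≤ γ) (hM : 1 ≤ M) {n : ℕ} (hn : 1 ≤ n) :
    timeNode T γ M n / n ≤ timeStep T γ M n := by
  have h1 : (1 : ℝ) ≤ n := by exact_mod_cast hn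
  have h0 : (n : ℝ) ≠ 0 := by positivity
  have e : (((n - 1 : ℕ) : ℝ) / n) = 1 - 1 / (n : ℝ) := by
    rw [Nat.cast_sub hn]; field_simp; push_cast; ring
  have h2 : (0 : ℝ) ≤ 1 - 1 / n := by rw [← e]; positivity
  have h3 : (1 : ℝ) - 1 / n ≤ 1 := by
    have : (0 : ℝ) < 1 / n := by positivity
    linarith
  have hb := Real.rpow_le_rpow_of_exponent_ge_of_imp h2 h3 hγ (by intro _ h; linarith)
  rw [Real.rpow_one] at hb
  rw [timeStep, timeNode_eq_mul (m := n - 1) hM hn, e]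
  have := mul_le_mul_of_nonneg_left hb (timeNode_nonneg (γ := γ) (M := M) hT n)
  have e2 : timeNode T γ M n * (1 - 1 / (n : ℝ))
    = timeNode T γ M n - timeNode T γ M n / n := by ring
  linarith

theorem timeNode_le_linear (hT : 0 < T) (hγ : 1 ≤ γ) (hM : 1 ≤ M) {n : ℕ} (hnM : n ≤ M) :
    timeNode T γ M n ≤ T * (n / M) := by
  have h3 : (n : ℝ) / M ≤ 1 := by
    rw [div_le_one (by positivity)]; exact_mod_cast hnM
  have hb := Real.rpow_le_rpow_of_exponent_ge_of_imp (show 0 ≤ (n : ℝ) / M by positivity) h3 hγ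
    (by intro _ h; linarith)
  rw [Real.rpow_one] at hb
  unfold timeNode
  gcongr

theorem timeStep_le_div (hT : 0 < T) (hγ : 1 ≤ γ) (hM : 1 ≤ M) {n : ℕ} (hn : 1 ≤ n)
    (hnM : n ≤ M) : timeStep T γ M n ≤ T * γ / M := by
  refine (timeStep_le hT hγ hM hn).trans ?_
  have h0 : (n : ℝ) ≠ 0 := by positivity
  calc _ ≤ γ * (T * (n / M)) / n := by
        gcongr
        exact timeNode_le_linear hT hγ hM hnM
    _ = _ := by field_simp

/-- Superadditivity of `x^γ`. It keeps every history cell at distance at least `τ_1` from `τ_n`,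
within the range of the exponential approximation. -/
theorem timeNode_one_le_timeStep (hT : 0 < T) (hγ : 1 ≤ γ) {n : ℕ}
    (hn : 1 ≤ n) : timeNode T γ M 1 ≤ timeStep T γ M n := by
  have h := Real.add_rpow_le_rpow_add (a := ((n - 1 : ℕ) : ℝ) / M) (b := ((1 : ℕ) : ℝ) / M)
    (by positivity) (by positivity) hγ
  have e : ((n - 1 : ℕ) : ℝ) / M + ((1 : ℕ) : ℝ) / M = n / M := by
    rw [Nat.cast_sub hn, ← add_div]; congr 1; ring
  rw [e] at h
  unfold timeStep timeNode
  nlinarith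

theorem half_rpow_mul_timeNode_le (hT : 0 < T) (hγ : 1 ≤ γ) (hM : 1 ≤ M) {n : ℕ} (hn : 1 ≤ n) :
    (1 / 2) ^ γ * timeNode T γ M (n + 1) ≤ timeNode T γ M n := by
  have h1 : (1 : ℝ) ≤ n := by exact_mod_cast hn
  rw [timeNode_eq_mul (m := n) hM (show 1 ≤ n + 1 by omega), mul_comm]
  have := timeNode_nonneg (γ := γ) (M := M) hT (n + 1)
  have hq : (1 / 2 : ℝ) ≤ (n : ℝ) / (n + 1 : ℕ) := by
    rw [div_le_div_iff₀ (by norm_num) (by positivity)]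
    push_cast
    linarith
  exact mul_le_mul_of_nonneg_left (Real.rpow_le_rpow (by norm_num) hq (by linarith)) this

theorem timeNode_le_half (hT : 0 < T) (hγ : 1 ≤ γ) (hM : 1 ≤ M) {k n : ℕ} (hn : 1 ≤ n)
    (hkn : 2 * k ≤ n) : timeNode T γ M k ≤ timeNode T γ M n / 2 := by
  have h0 := timeNode_nonneg (γ := γ) (M := M) hT n
  have h3 : (k : ℝ) / n ≤ 1 / 2 := by
    rw [div_le_div_iff₀ (by positivity) (by norm_num)]
    exact_mod_cast (by omega : k * 2 ≤ 1 * n)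
  have hb := Real.rpow_le_rpow_of_exponent_ge_of_imp (show 0 ≤ (k : ℝ) / n by positivity)
    (by linarith) hγ (by intro _ h; linarith)
  rw [Real.rpow_one] at hb
  have := mul_le_mul_of_nonneg_left (hb.trans h3) h0
  rw [timeNode_eq_mul (m := k) hM hn]
  linarith

/-- The mean of a function lies between its bounds. -/
theorem mean_mem_Icc {f : ℝ → ℝ} {a b lo hi : ℝ} (hab : a < b)
    (hf : IntervalIntegrable f volume a b) (h : ∀ s ∈ Icc a b, f s ∈ Icc lo hi) :
    1 / (b - a) * ∫ s in a..b, f s ∈ Icc lo hi := by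
  have hba : 0 < b - a := sub_pos.2 hab
  have h1 := intervalIntegral.integral_mono_on hab.le intervalIntegrable_const hf
    (fun s hs => (h s hs).1)
  have h2 := intervalIntegral.integral_mono_on hab.le hf intervalIntegrable_const
    (fun s hs => (h s hs).2)
  rw [intervalIntegral.integral_const, smul_eq_mul] at h1 h2
  rw [one_div, inv_mul_eq_div]
  constructor
  · rw [le_div_iff₀ hba]; linarith
  · rw [div_le_iff₀ hba]; linarith

theorem l1Coeff_self (hα1 : α < 1) (hT : 0 < T) (hγ : 1 ≤ γ) (hM : 1 ≤ M) {n : ℕ} (hn : 1 ≤ n) :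
    l1Coeff α T γ M n n = timeStep T γ M n ^ (-α) / (1 - α) := by
  have hs := timeStep_pos hT hγ hM hn
  have h1 : 1 - α ≠ 0 := by linarith
  rw [l1Coeff, integral_sub_rpow hα1, sub_self, Real.zero_rpow h1, sub_zero]
  change 1 / timeStep T γ M n * (timeStep T γ M n ^ (1 - α) / (1 - α)) = _
  rw [show (1 - α) = -α + 1 by ring, Real.rpow_add_one hs.ne']
  field_simp

theorem kernel_mem_Icc (hα : 0 < α) {t a b : ℝ} (hbt : b < t) :
    ∀ s ∈ Icc a b, (t - s) ^ (-α) ∈ Icc ((t - a) ^ (-α)) ((t - b) ^ (-α)) := fun s hs =>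
  ⟨Real.rpow_le_rpow_of_nonpos (by linarith [hs.2]) (by linarith [hs.1]) (by linarith),
    Real.rpow_le_rpow_of_nonpos (by linarith) (by linarith [hs.2]) (by linarith)⟩

/-- The last coefficient is `Δτ_n^(-α)/(1-α)`, while the previous one averages values at most
`Δτ_n^(-α)`. The gap is at least `α/(1-α) Δτ_n^(-α)`, and `Δτ_n ≤ Tγ/M`. -/
theorem exists_gapConstant (hα : 0 < α) (hα1 : α < 1) (hT : 0 < T) (hγ : 1 ≤ γ) :
    ∃ c₁ : ℝ, 0 < c₁ ∧ IsGapConstant α T γ c₁ := by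
  have h1α : 0 < 1 - α := by linarith
  refine ⟨α / (1 - α) * (T * γ) ^ (-α), by positivity, ?_⟩
  intro M n hn hnM
  have hM : 1 ≤ M := by omega
  have hs := timeStep_pos hT hγ hM (show 1 ≤ n by omega)
  have h1 : l1Coeff α T γ M n (n - 1) ≤ timeStep T γ M n ^ (-α) :=
    (mean_mem_Icc (timeNode_lt hT hγ hM (by omega)) (intervalIntegrable_sub_rpow hα1 _ _ _)
      (kernel_mem_Icc hα (timeNode_lt hT hγ hM (by omega)))).2
  have h2 : (T * γ / M) ^ (-α) ≤ timeStep T γ M n ^ (-α) :=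
    Real.rpow_le_rpow_of_nonpos hs (timeStep_le_div hT hγ hM (by omega) hnM) (by linarith)
  have h3 : (T * γ / M) ^ (-α) = (T * γ) ^ (-α) * (M : ℝ) ^ α := by
    rw [Real.div_rpow (by positivity) (by positivity), Real.rpow_neg (Nat.cast_nonneg M),
      div_inv_eq_mul]
  rw [l1Coeff_self hα1 hT hγ hM (by omega)]
  have h4 : timeStep T γ M n ^ (-α) / (1 - α) - timeStep T γ M n ^ (-α)
      = α / (1 - α) * timeStep T γ M n ^ (-α) := by
    field_simp
    ring
  calc _ = α / (1 - α) * ((T * γ) ^ (-α) * (M : ℝ) ^ α) := by ring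
    _ ≤ α / (1 - α) * timeStep T γ M n ^ (-α) := by
      rw [← h3]
      gcongr
    _ ≤ _ := by rw [← h4]; gcongr

theorem rpow_neg_sub_rpow_neg_le (hα : 0 < α) (hα1 : α < 1) {x d : ℝ} (hx : 0 < x) (hd : 0 ≤ d) :
    x ^ (-α) - (x + d) ^ (-α) ≤ α * d * x ^ (-α - 1) := by
  have hb := rpow_one_add_le_one_add_mul_self (s := d / x) (p := α)
    (by have : 0 ≤ d / x := by positivity
        linarith) hα.le hα1.le
  have hpos : 0 < 1 + d / x := by positivity
  have h1 : 1 - α * (d / x) ≤ (1 + d / x) ^ (-α) := by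
    rw [Real.rpow_neg hpos.le]
    have h2 : 0 < 1 + α * (d / x) := by positivity
    calc 1 - α * (d / x) ≤ (1 + α * (d / x))⁻¹ := by
          rw [← one_div, le_div_iff₀ h2]
          nlinarith [sq_nonneg (α * (d / x))]
      _ ≤ _ := by gcongr
  have e : x + d = x * (1 + d / x) := by field_simp
  rw [e, Real.mul_rpow hx.le hpos.le, Real.rpow_sub_one hx.ne']
  have := mul_le_mul_of_nonneg_left h1 (show 0 ≤ x ^ (-α) by positivity)
  have e2 : α * d * (x ^ (-α) / x) = x ^ (-α) - x ^ (-α) * (1 - α * (d / x)) := by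
    field_simp; ring
  linarith

end Mesh

/-! ### Truncation error of the L1 formula -/

section L1Error

variable {α T γ A : ℝ}

theorem WeaklySingular.sub_const {w w1 w2 : ℝ → ℝ} (hw : WeaklySingular α T A w w1 w2) (c : ℝ) :
    WeaklySingular α T A (fun s => w s - c) w1 w2 :=
  ⟨hw.cont.sub continuousOn_const, fun t ht => (hw.deriv1 t ht).sub_const c, hw.deriv2, hw.bound1,
    hw.bound2⟩

/-- The L1 interpolation error on the cell `[τ_k, τ_{k+1}]`, relative to `τ_{k+1} ^ α`. -/
theorem WeaklySingular.abs_cell_interpolation_le {w w1 w2 : ℝ → ℝ}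
    (hw : WeaklySingular α T A w w1 w2) (hα : 0 < α) (hα1 : α < 1) (hT : 0 < T) (hγ : 1 ≤ γ)
    {M k : ℕ} (hkM : k + 1 ≤ M) :
    ∀ s ∈ Icc (timeNode T γ M k) (timeNode T γ M (k + 1)),
      |w s - w (timeNode T γ M k) - (w (timeNode T γ M (k + 1)) - w (timeNode T γ M k))
          / (timeNode T γ M (k + 1) - timeNode T γ M k) * (s - timeNode T γ M k)|
        ≤ A * (((1 / 2) ^ γ) ^ (α - 2) * γ ^ 2 + 2 / α) * timeNode T γ M (k + 1) ^ α
            * ((k + 1 : ℕ) : ℝ) ^ (-2 : ℝ) := by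
  intro s hs
  have hM : 1 ≤ M := by omega
  have hA := hw.nonneg hT
  have htp := timeNode_pos (γ := γ) hT hM (show 1 ≤ k + 1 by omega)
  rcases Nat.eq_zero_or_pos k with rfl | hk
  · rw [timeNode_zero hγ] at hs ⊢
    refine (hw.abs_sub_interpolant_zero_le hα htp (timeNode_le hT hγ hM hkM) hs).trans ?_
    have h1 : 0 ≤ A * (((1 / 2) ^ γ) ^ (α - 2) * γ ^ 2) * timeNode T γ M (0 + 1) ^ α := by positivity
    simp only [zero_add, Nat.cast_one, Real.one_rpow, mul_one] at h1 ⊢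
    have e : A * (((1 / 2) ^ γ) ^ (α - 2) * γ ^ 2 + 2 / α) * timeNode T γ M 1 ^ α
      = A * (((1 / 2) ^ γ) ^ (α - 2) * γ ^ 2) * timeNode T γ M 1 ^ α
        + 2 * (A / α) * timeNode T γ M 1 ^ α := by ring
    linarith
  · have hkp := timeNode_pos (γ := γ) hT hM hk
    have hlt := timeNode_lt hT hγ hM (Nat.lt_succ_self k)
    refine (hw.abs_sub_interpolant_le hα1 hkp hlt (timeNode_le hT hγ hM hkM) hs).trans ?_
    have hstep := timeStep_le hT hγ hM (show 1 ≤ k + 1 by omega)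
    rw [timeStep_succ] at hstep
    -- The bound for `w2` is taken at the left node. Past the first cell it is comparable with the
    -- right node, up to the factor `(1/2)^γ`.
    have hhalf := half_rpow_mul_timeNode_le hT hγ hM hk
    have h1 : timeNode T γ M k ^ (α - 2)
        ≤ ((1 / 2) ^ γ * timeNode T γ M (k + 1)) ^ (α - 2) :=
      Real.rpow_le_rpow_of_nonpos (by positivity) hhalf (by linarith)
    rw [Real.mul_rpow (by positivity) htp.le] at h1
    have h2 : timeNode T γ M (k + 1) ^ (α - 2) * timeNode T γ M (k + 1) ^ 2
        = timeNode T γ M (k + 1) ^ α := by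
      rw [← Real.rpow_natCast, ← Real.rpow_add htp]
      norm_num
    calc _ ≤ A * (((1 / 2) ^ γ) ^ (α - 2) * timeNode T γ M (k + 1) ^ (α - 2))
          * (γ * timeNode T γ M (k + 1) / (k + 1 : ℕ)) ^ 2 := by
          gcongr
      _ = A * (((1 / 2) ^ γ) ^ (α - 2) * γ ^ 2) *
          (timeNode T γ M (k + 1) ^ (α - 2) * timeNode T γ M (k + 1) ^ 2)
          * ((k + 1 : ℕ) : ℝ) ^ (-2 : ℝ) := by
          rw [Real.rpow_neg (by positivity), show (2 : ℝ) = ((2 : ℕ) : ℝ) by norm_num,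
            Real.rpow_natCast]
          field_simp
      _ ≤ _ := by
          rw [h2]
          gcongr
          have : 0 ≤ 2 / α := by positivity
          linarith

theorem summable_succ_rpow (hα : 0 < α) :
    Summable fun k : ℕ => ((k + 1 : ℕ) : ℝ) ^ (-(1 + α)) :=
  (summable_nat_add_iff (f := fun k : ℕ => (k : ℝ) ^ (-(1 + α))) 1).2
    (Real.summable_nat_rpow.2 (by linarith))

theorem rpow_neg_order_le {n : ℕ} (hn : 1 ≤ n) :
    (n : ℝ) ^ (-(2 - α)) ≤ (n : ℝ) ^ (-min (γ * (1 + α)) (2 - α)) :=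
  Real.rpow_le_rpow_of_exponent_le (by exact_mod_cast hn) (neg_le_neg (min_le_right _ _))

/-- Contribution of the cell `[τ_k, τ_{k+1}]`, `k + 1 < n`, to the L1 error at `τ_n`. -/
theorem cell_weight_le (hα : 0 < α) (hα1 : α < 1) (hT : 0 < T) (hγ : 1 ≤ γ)
    {M n k : ℕ} (hkn : k + 1 < n) (hnM : n ≤ M) :
    timeNode T γ M (k + 1) ^ α * ((k + 1 : ℕ) : ℝ) ^ (-2 : ℝ)
        * ((timeNode T γ M n - timeNode T γ M (k + 1)) ^ (-α)
          - (timeNode T γ M n - timeNode T γ M k) ^ (-α))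
      ≤ α * γ * 2 ^ (1 + α) * (((k + 1 : ℕ) : ℝ) ^ (-(1 + α))
          * (n : ℝ) ^ (-min (γ * (1 + α)) (2 - α)))
        + 4 * (n : ℝ) ^ (-2 : ℝ) * timeNode T γ M n ^ α
          * ((timeNode T γ M n - timeNode T γ M (k + 1)) ^ (-α)
            - (timeNode T γ M n - timeNode T γ M k) ^ (-α)) := by
  have hM : 1 ≤ M := by omega
  have hn : 1 ≤ n := by omega
  set t := timeNode T γ M n with ht
  set b := timeNode T γ M (k + 1) with hb
  set a := timeNode T γ M k with ha
  have htp : 0 < t := timeNode_pos hT hM hn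
  have hbp : 0 < b := timeNode_pos hT hM (by omega)
  have hab : a < b := timeNode_lt hT hγ hM (by omega)
  have hbt : b < t := timeNode_lt hT hγ hM (by omega)
  have hφ : 0 ≤ (t - b) ^ (-α) - (t - a) ^ (-α) :=
    sub_nonneg.2 (Real.rpow_le_rpow_of_nonpos (by linarith) (by linarith) (by linarith))
  have hk1 : (1 : ℝ) ≤ ((k + 1 : ℕ) : ℝ) := by exact_mod_cast (by omega : 1 ≤ k + 1)
  rcases le_or_gt (2 * (k + 1)) n with hcase | hcase
  -- Cells with `2(k+1) ≤ n` are at distance at least `t/2` from `t`, so the kernel increment is of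
  -- order `(b - a) t^(-α-1)`. With `κ = k + 1` this leaves `κ^(-3) (κ/n)^(γ(1+α))`. Lowering the
  -- exponent to the minimum with `2 - α` yields the required power of `n` times the summable
  -- `κ^(-(1+α))`.
  · refine le_add_of_le_of_nonneg ?_ (by positivity)
    have hhalf : b ≤ t / 2 := timeNode_le_half hT hγ hM hn hcase
    have hd := rpow_neg_sub_rpow_neg_le hα hα1 (x := t - b) (d := b - a) (by linarith) (by linarith)
    rw [sub_add_sub_cancel] at hd
    have hstep : b - a ≤ γ * b / (k + 1 : ℕ) := timeStep_le hT hγ hM (by omega)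
    have h1 : (t - b) ^ (-α - 1) ≤ (t / 2) ^ (-α - 1) :=
      Real.rpow_le_rpow_of_nonpos (by linarith) (by linarith) (by linarith)
    have hba : 0 < b - a := by linarith
    set κ : ℝ := ((k + 1 : ℕ) : ℝ) with hκ
    have hκ0 : κ ≠ 0 := by linarith
    have hbt2 : b = t * (κ / n) ^ γ := timeNode_eq_mul hM hn
    have hn0 : (n : ℝ) ≠ 0 := by positivity
    have hratio : (b / t) ^ (1 + α) ≤ κ ^ (2 - α) * (n : ℝ) ^ (-min (γ * (1 + α)) (2 - α)) := by
      have e : (b / t) ^ (1 + α) = (κ / n) ^ (γ * (1 + α)) := by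
        rw [hbt2, mul_div_cancel_left₀ _ htp.ne', ← Real.rpow_mul (by positivity)]
      have hle1 : κ / n ≤ 1 := by
        rw [div_le_one (by positivity), hκ]
        exact_mod_cast (by omega : k + 1 ≤ n)
      calc (b / t) ^ (1 + α) ≤ (κ / n) ^ (min (γ * (1 + α)) (2 - α)) := by
            rw [e]
            exact Real.rpow_le_rpow_of_exponent_ge (by positivity) hle1 (min_le_left _ _)
        _ = κ ^ (min (γ * (1 + α)) (2 - α)) * (n : ℝ) ^ (-min (γ * (1 + α)) (2 - α)) := by
            rw [Real.div_rpow (by positivity) (by positivity), Real.rpow_neg (by positivity),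
              div_eq_mul_inv]
        _ ≤ _ := by
            gcongr
            exact min_le_right _ _
    calc _ ≤ b ^ α * κ ^ (-2 : ℝ) * (α * (γ * b / κ) * (t / 2) ^ (-α - 1)) := by
          have hκp : 0 < κ := by linarith
          gcongr
          refine hd.trans ?_
          gcongr
      _ = α * γ * 2 ^ (1 + α) * (κ ^ (-3 : ℝ) * (b / t) ^ (1 + α)) := by
          have e1 : (t / 2) ^ (-α - 1) = 2 ^ (1 + α) * (t ^ (1 + α))⁻¹ := by
            rw [show -α - 1 = -(1 + α) by ring, Real.div_rpow htp.le (by norm_num),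
              Real.rpow_neg htp.le, Real.rpow_neg (by norm_num), div_inv_eq_mul, mul_comm]
          rw [e1, Real.div_rpow hbp.le htp.le, Real.rpow_add hbp, Real.rpow_one,
            show (-3 : ℝ) = -2 - 1 by norm_num, Real.rpow_sub_one hκ0]
          generalize κ ^ (-2 : ℝ) = y
          ring
      _ ≤ α * γ * 2 ^ (1 + α) * (κ ^ (-3 : ℝ) * (κ ^ (2 - α)
            * (n : ℝ) ^ (-min (γ * (1 + α)) (2 - α)))) := by
          have : 0 ≤ γ := by linarith
          gcongr
      _ = _ := by
          rw [← mul_assoc (κ ^ (-3 : ℝ)), ← Real.rpow_add (by linarith)]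
          congr 3
          ring
  -- In the remaining cells `k + 1 ≥ n/2`. The kernel increment is kept because it telescopes in the
  -- sum over `k`.
  · refine le_add_of_nonneg_of_le (by positivity) (mul_le_mul_of_nonneg_right ?_ hφ)
    have hn0 : (n : ℝ) ≠ 0 := by positivity
    have h1 : b ^ α ≤ t ^ α := by gcongr
    have h2 : ((k + 1 : ℕ) : ℝ) ^ (-2 : ℝ) ≤ 4 * (n : ℝ) ^ (-2 : ℝ) := by
      have h3 : (n : ℝ) / 2 ≤ ((k + 1 : ℕ) : ℝ) := by
        rw [div_le_iff₀ (by norm_num)]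
        exact_mod_cast (by omega : n ≤ (k + 1) * 2)
      refine (Real.rpow_le_rpow_of_nonpos (by positivity) h3 (by norm_num)).trans_eq ?_
      rw [Real.div_rpow (by positivity) (by norm_num), Real.rpow_neg (x := 2) (by norm_num)]
      norm_num
      ring
    calc b ^ α * ((k + 1 : ℕ) : ℝ) ^ (-2 : ℝ) ≤ t ^ α * (4 * (n : ℝ) ^ (-2 : ℝ)) := by gcongr
      _ = _ := by ring

/-- At the first level the error need only be bounded. Increments of `w` are `O(t^α)`, which
compensates `t^(-α)` in the difference quotient and in the integral separately. -/
theorem WeaklySingular.abs_l1_error_one_le {w w1 w2 : ℝ → ℝ}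
    (hw : WeaklySingular α T A w w1 w2) (hα : 0 < α) (hα1 : α < 1) {t : ℝ} (ht : 0 < t)
    (htT : t ≤ T) :
    |(t ^ (-α) / (1 - α)) * (w t - w 0) - ∫ s in (0 : ℝ)..t, (t - s) ^ (-α) * w1 s|
      ≤ A / α / (1 - α) + (4 * (A / α) + A / (1 - α)) := by
  have hA := hw.nonneg (ht.trans_le htT)
  have h1α : 0 < 1 - α := by linarith
  refine (abs_sub _ _).trans (add_le_add ?_ ?_)
  · have h := hw.abs_increment_le hα le_rfl ht.le htT
    rw [Real.zero_rpow hα.ne', sub_zero] at h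
    rw [abs_mul, abs_of_nonneg (by positivity)]
    calc _ ≤ t ^ (-α) / (1 - α) * (A / α * t ^ α) := by gcongr
      _ = A / α / (1 - α) := by
        rw [Real.rpow_neg ht.le]
        field_simp
  · have h := (hw.sub_const (w 0)).abs_integral_kernel_le hα hα1 htT (δ := t / 2)
      (η := A / α * t ^ α) (by positivity) le_rfl (fun s hs => by
        have h := hw.abs_increment_le hα le_rfl hs.1 (hs.2.trans htT)
        rw [Real.zero_rpow hα.ne', sub_zero] at h
        refine h.trans ?_
        gcongr
        · exact hs.1
        · exact hs.2)
    refine h.trans (add_le_add ?_ ?_)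
    · have e : (t / 2) ^ (-α) = t ^ (-α) * 2 ^ α := by
        rw [Real.div_rpow ht.le (by norm_num), Real.rpow_neg (x := 2) (by norm_num), div_inv_eq_mul]
      have h2 : (2 : ℝ) ^ α ≤ 2 := by
        calc (2 : ℝ) ^ α ≤ 2 ^ (1 : ℝ) :=
              Real.rpow_le_rpow_of_exponent_le (by norm_num) hα1.le
          _ = 2 := Real.rpow_one 2
      rw [e]
      calc _ = 2 * (A / α) * 2 ^ α * (t ^ α * t ^ (-α)) := by ring
        _ = 2 * (A / α) * 2 ^ α := by
          rw [← Real.rpow_add ht, add_neg_cancel, Real.rpow_zero, mul_one]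
        _ ≤ 2 * (A / α) * 2 := by gcongr
        _ = _ := by ring
    · apply le_of_eq
      rw [← mul_div_assoc, mul_assoc, ← Real.rpow_add (by positivity)]
      norm_num

/-- Truncation error of the L1 formula on the graded mesh. -/
theorem exists_l1_error_bound (hα : 0 < α) (hα1 : α < 1) (hT : 0 < T) (hγ : 1 ≤ γ) (hA : 0 ≤ A) :
    ∃ c : ℝ, 0 ≤ c ∧ ∀ (w w1 w2 : ℝ → ℝ), WeaklySingular α T A w w1 w2 →
      ∀ M n : ℕ, 1 ≤ n → n ≤ M →
        |∑ k ∈ Finset.range n, l1Coeff α T γ M n (k + 1)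
            * (w (timeNode T γ M (k + 1)) - w (timeNode T γ M k))
          - ∫ s in (0 : ℝ)..timeNode T γ M n, (timeNode T γ M n - s) ^ (-α) * w1 s|
        ≤ c * (n : ℝ) ^ (-min (γ * (1 + α)) (2 - α)) := by
  have h1α : 0 < 1 - α := by linarith
  set Z := ∑' k : ℕ, ((k + 1 : ℕ) : ℝ) ^ (-(1 + α)) with hZ
  have hZ0 : 0 ≤ Z := tsum_nonneg fun k => by positivity
  set cB : ℝ := A * (((1 / 2) ^ γ) ^ (α - 2) * γ ^ 2 + 2 / α) with hcB
  have hcB0 : 0 ≤ cB := by positivity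
  set cL : ℝ := A / (1 - α) * (γ * 2 ^ γ) ^ (2 - α) with hcL
  have hcL0 : 0 ≤ cL := by positivity
  have hγ0 : 0 ≤ γ := by linarith
  refine ⟨(A / α / (1 - α) + (4 * (A / α) + A / (1 - α)))
    + (cB * (α * γ * 2 ^ (1 + α)) * Z + cB * 4 + cL), by positivity, ?_⟩
  intro w w1 w2 hw M n hn hnM
  have hM : 1 ≤ M := by omega
  have hpn : 0 ≤ (n : ℝ) ^ (-min (γ * (1 + α)) (2 - α)) := by positivity
  obtain ⟨m, rfl⟩ : ∃ m, n = m + 1 := ⟨n - 1, by omega⟩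
  set t := timeNode T γ M (m + 1) with ht
  have htp : 0 < t := timeNode_pos hT hM hn
  have htT : t ≤ T := timeNode_le hT hγ hM hnM
  rcases Nat.eq_zero_or_pos m with rfl | hm
  · have h := hw.abs_l1_error_one_le hα hα1 htp htT
    have e : l1Coeff α T γ M (0 + 1) (0 + 1) = t ^ (-α) / (1 - α) := by
      rw [l1Coeff_self hα1 hT hγ hM hn, timeStep_succ, timeNode_zero hγ, sub_zero]
    rw [Finset.sum_range_one, e, timeNode_zero hγ]
    refine h.trans ?_
    simp only [zero_add, Nat.cast_one, Real.one_rpow, mul_one]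
    have : 0 ≤ cB * (α * γ * 2 ^ (1 + α)) * Z + cB * 4 + cL := by positivity
    linarith
  set τ := timeNode T γ M with hτ
  set ψ : ℕ → ℝ := fun k => (t - τ k) ^ (-α) with hψ
  have hτT : ∀ k ≤ m + 1, τ k ≤ T := fun k hk => timeNode_le hT hγ hM (by omega)
  have hsplit : ∫ s in (0 : ℝ)..t, (t - s) ^ (-α) * w1 s
      = ∑ k ∈ Finset.range (m + 1), ∫ s in (τ k)..(τ (k + 1)), (t - s) ^ (-α) * w1 s := by
    rw [intervalIntegral.sum_integral_adjacent_intervals]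
    · rw [hτ, timeNode_zero hγ]
    · intro k hk
      exact hw.intervalIntegrable_kernel_mul_of_subset hα hα1 (timeNode_nonneg hT k)
        (timeNode_mono hT hγ (by omega)) (timeNode_mono hT hγ (by omega)) htp htT
  rw [hsplit, ← Finset.sum_sub_distrib, Finset.sum_range_succ]
  have hcells : ∀ k ∈ Finset.range m,
      |l1Coeff α T γ M (m + 1) (k + 1) * (w (τ (k + 1)) - w (τ k))
        - ∫ s in (τ k)..(τ (k + 1)), (t - s) ^ (-α) * w1 s|
      ≤ cB * (α * γ * 2 ^ (1 + α) * (((k + 1 : ℕ) : ℝ) ^ (-(1 + α))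
          * ((m + 1 : ℕ) : ℝ) ^ (-min (γ * (1 + α)) (2 - α)))
        + 4 * ((m + 1 : ℕ) : ℝ) ^ (-2 : ℝ) * t ^ α * (ψ (k + 1) - ψ k)) := by
    intro k hk
    have hk := Finset.mem_range.1 hk
    have h1 := hw.abs_cell_error_le hα hα1 (timeNode_nonneg (γ := γ) (M := M) hT k)
      (timeNode_lt hT hγ hM (Nat.lt_succ_self k))
      (timeNode_lt hT hγ hM (show k + 1 < m + 1 by omega)) htT
      (hw.abs_cell_interpolation_le hα hα1 hT hγ (show k + 1 ≤ M by omega))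
    refine h1.trans ?_
    have h2 := mul_le_mul_of_nonneg_left
      (cell_weight_le hα hα1 hT hγ (show k + 1 < m + 1 by omega) hnM) hcB0
    refine le_trans (le_of_eq ?_) h2
    ring
  have hsum := (Finset.abs_sum_le_sum_abs _ _).trans (Finset.sum_le_sum hcells)
  have hψ0 : 0 ≤ ψ 0 := by
    have : 0 ≤ t - τ 0 := by rw [hτ, timeNode_zero hγ]; linarith
    positivity
  have hn0 : ((m + 1 : ℕ) : ℝ) ≠ 0 := by positivity
  -- The last step is at least `t/n`, so the telescoped kernel costs only `n^α`. Together with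
  -- `n^(-2)` this is `n^(-(2-α))`.
  have hψm : t ^ α * ψ m ≤ ((m + 1 : ℕ) : ℝ) ^ α := by
    have h1 : ψ m ≤ (t / (m + 1 : ℕ)) ^ (-α) :=
      Real.rpow_le_rpow_of_nonpos (by positivity) (le_timeStep hT hγ hM hn) (by linarith)
    calc _ ≤ t ^ α * (t / (m + 1 : ℕ)) ^ (-α) := by gcongr
      _ = _ := by
        rw [Real.div_rpow htp.le (by positivity), Real.rpow_neg htp.le, Real.rpow_neg (by positivity)]
        field_simp
  have hsum2 : ∑ k ∈ Finset.range m, cB * (α * γ * 2 ^ (1 + α) * (((k + 1 : ℕ) : ℝ) ^ (-(1 + α))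
          * ((m + 1 : ℕ) : ℝ) ^ (-min (γ * (1 + α)) (2 - α)))
        + 4 * ((m + 1 : ℕ) : ℝ) ^ (-2 : ℝ) * t ^ α * (ψ (k + 1) - ψ k))
      ≤ (cB * (α * γ * 2 ^ (1 + α)) * Z + cB * 4)
        * ((m + 1 : ℕ) : ℝ) ^ (-min (γ * (1 + α)) (2 - α)) := by
    rw [← Finset.mul_sum, Finset.sum_add_distrib, ← Finset.mul_sum, ← Finset.mul_sum,
      ← Finset.sum_mul, Finset.sum_range_sub]
    have h1 : ∑ k ∈ Finset.range m, ((k + 1 : ℕ) : ℝ) ^ (-(1 + α)) ≤ Z :=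
      (summable_succ_rpow hα).sum_le_tsum _ fun k _ => by positivity
    have h2 : ((m + 1 : ℕ) : ℝ) ^ (-2 : ℝ) * (t ^ α * (ψ m - ψ 0))
        ≤ ((m + 1 : ℕ) : ℝ) ^ (-min (γ * (1 + α)) (2 - α)) := by
      have h3 : t ^ α * (ψ m - ψ 0) ≤ ((m + 1 : ℕ) : ℝ) ^ α := by
        refine le_trans ?_ hψm
        gcongr
        linarith
      refine le_trans ?_ (rpow_neg_order_le (α := α) (γ := γ) hn)
      calc _ ≤ ((m + 1 : ℕ) : ℝ) ^ (-2 : ℝ) * ((m + 1 : ℕ) : ℝ) ^ α := by gcongr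
        _ = _ := by
          rw [← Real.rpow_add (by positivity)]
          congr 1
          ring
    calc _ = cB * (α * γ * 2 ^ (1 + α)) * (∑ k ∈ Finset.range m, ((k + 1 : ℕ) : ℝ) ^ (-(1 + α)))
            * ((m + 1 : ℕ) : ℝ) ^ (-min (γ * (1 + α)) (2 - α))
          + cB * 4 * (((m + 1 : ℕ) : ℝ) ^ (-2 : ℝ) * (t ^ α * (ψ m - ψ 0))) := by ring
      _ ≤ cB * (α * γ * 2 ^ (1 + α)) * Z
            * ((m + 1 : ℕ) : ℝ) ^ (-min (γ * (1 + α)) (2 - α))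
          + cB * 4 * ((m + 1 : ℕ) : ℝ) ^ (-min (γ * (1 + α)) (2 - α)) := by gcongr
      _ = _ := by ring
  have hlast : |l1Coeff α T γ M (m + 1) (m + 1) * (w (τ (m + 1)) - w (τ m))
        - ∫ s in (τ m)..(τ (m + 1)), (t - s) ^ (-α) * w1 s|
      ≤ cL * ((m + 1 : ℕ) : ℝ) ^ (-min (γ * (1 + α)) (2 - α)) := by
    have hτm : 0 < τ m := timeNode_pos hT hM hm
    have hlt : τ m < t := timeNode_lt hT hγ hM (by omega)
    have hd : 0 < t - τ m := by linarith
    refine (hw.abs_last_cell_error_le hα hα1 hτm hlt htT).trans ?_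
    have hstep : t - τ m ≤ γ * t / (m + 1 : ℕ) := timeStep_le hT hγ hM hn
    have hhalf : (1 / 2) ^ γ * t ≤ τ m := half_rpow_mul_timeNode_le hT hγ hM hm
    have hratio : (t - τ m) / τ m ≤ γ * 2 ^ γ / (m + 1 : ℕ) := by
      rw [div_le_iff₀ hτm]
      refine hstep.trans ?_
      have : t ≤ 2 ^ γ * τ m := by
        rw [Real.div_rpow (by norm_num) (by norm_num), Real.one_rpow, one_div,
          inv_mul_le_iff₀ (by positivity)] at hhalf
        exact hhalf
      calc _ ≤ γ * (2 ^ γ * τ m) / (m + 1 : ℕ) := by gcongr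
        _ = _ := by ring
    -- The bound on the last cell depends only on the ratio of step to node, which is of order
    -- `1/n`.
    calc _ = A / (1 - α) * ((t - τ m) / τ m) ^ (2 - α) := by
          rw [Real.div_rpow hd.le hτm.le, show (2 - α) = (1 - α) + 1 by ring,
            Real.rpow_add_one hd.ne', show α - 2 = -((1 - α) + 1) by ring, Real.rpow_neg hτm.le]
          field_simp
      _ ≤ A / (1 - α) * (γ * 2 ^ γ / (m + 1 : ℕ)) ^ (2 - α) := by
          gcongr
          linarith
      _ = cL * ((m + 1 : ℕ) : ℝ) ^ (-(2 - α)) := by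
          rw [Real.div_rpow (by positivity) (by positivity), Real.rpow_neg (by positivity), hcL,
            div_eq_mul_inv]
          ring
      _ ≤ _ := by
          exact mul_le_mul_of_nonneg_left (rpow_neg_order_le hn) hcL0
  refine (abs_add_le _ _).trans ?_
  have h0 : 0 ≤ A / α / (1 - α) + (4 * (A / α) + A / (1 - α)) := by positivity
  have := mul_nonneg h0 hpn
  linarith [hsum.trans hsum2]

end L1Error
end TemperedBS

noncomputable section
namespace TemperedBS

/-! ### The fast formula as a perturbed memory kernel -/

section FastFormula
open MeasureTheory

variable {α lam T γ ε : ℝ} {M K : ℕ} {s ω : Fin K → ℝ}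

/-- The factor `e^{-s Δτ}` moves the evaluation time of all earlier integrals to the new level,
which unrolls the recursion. -/
theorem history_succ (σ : ℝ) (u : ℕ → ℝ) (n : ℕ) :
    history lam T γ M σ u (n + 1) = ∑ k ∈ Finset.range n,
      (1 / timeStep T γ M (k + 1) * ∫ y in (timeNode T γ M k)..(timeNode T γ M (k + 1)),
        Real.exp (-σ * (timeNode T γ M (n + 1) - y)))
      * (Real.exp (lam * timeNode T γ M (k + 1)) * u (k + 1)
          - Real.exp (lam * timeNode T γ M k) * u k) := by
  induction n with
  | zero => simp [history]
  | succ n ih =>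
    rw [history, ih, Finset.sum_range_succ, Finset.mul_sum]
    congr 1
    refine Finset.sum_congr rfl fun k _ => ?_
    rw [← mul_assoc, mul_left_comm, ← intervalIntegral.integral_const_mul]
    congr 2
    refine intervalIntegral.integral_congr fun y _ => ?_
    rw [← Real.exp_add, timeStep_succ]
    congr 1
    ring

/-- The coefficients of the increments in the fast L1 formula at `τ_n`, `1 ≤ k ≤ n`. -/
def fastKernel (α T γ : ℝ) (M : ℕ) {K : ℕ} (s ω : Fin K → ℝ) (n k : ℕ) : ℝ :=
  if k = n then l1Coeff α T γ M n n
  else 1 / timeStep T γ M k * ∫ y in (timeNode T γ M (k - 1))..(timeNode T γ M k),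
    ∑ j, ω j * Real.exp (-s j * (timeNode T γ M n - y))

theorem fastCaputo_eq_sum (u : ℕ → ℝ) {n : ℕ} (hn : 1 ≤ n) :
    fastCaputo α lam T γ M s ω u n
      = Real.exp (-lam * timeNode T γ M n) / Real.Gamma (1 - α) *
        ∑ k ∈ Finset.range n, fastKernel α T γ M s ω n (k + 1)
          * (Real.exp (lam * timeNode T γ M (k + 1)) * u (k + 1)
            - Real.exp (lam * timeNode T γ M k) * u k) := by
  obtain ⟨m, rfl⟩ : ∃ m, n = m + 1 := ⟨n - 1, by omega⟩
  rw [fastCaputo, Finset.sum_range_succ]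
  congr 2
  · simp only [history_succ, Finset.mul_sum]
    rw [Finset.sum_comm]
    refine Finset.sum_congr rfl fun k hk => ?_
    have hk := Finset.mem_range.1 hk
    rw [fastKernel, if_neg (by omega), Nat.add_sub_cancel,
      intervalIntegral.integral_finsetSum
        (fun j _ => Continuous.intervalIntegrable (by fun_prop) _ _), Finset.mul_sum,
      Finset.sum_mul]
    refine Finset.sum_congr rfl fun j _ => ?_
    rw [intervalIntegral.integral_const_mul]
    ring
  · rw [fastKernel, if_pos rfl, Nat.add_sub_cancel]

theorem IsSOE.nonneg (h : IsSOE α ε (T * (1 / (M : ℝ)) ^ γ) T K s ω) (hT : 0 < T) (hγ : 1 ≤ γ)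
    (hM : 1 ≤ M) : 0 ≤ ε := by
  have h1 := timeNode_le (γ := γ) hT hγ hM hM
  rw [timeNode, Nat.cast_one] at h1
  exact (abs_nonneg _).trans (h.approx T ⟨h1, le_rfl⟩)

theorem continuous_soe (t : ℝ) :
    Continuous fun y => ∑ j, ω j * Real.exp (-s j * (t - y)) := by fun_prop

/-- Off the diagonal the difference is the mean over a cell of the approximation error at distances
in `[τ_1, T]`; on the diagonal it is zero. -/
theorem abs_fastKernel_sub_le (h : IsSOE α ε (T * (1 / (M : ℝ)) ^ γ) T K s ω)
    (hα1 : α < 1) (hT : 0 < T) (hγ : 1 ≤ γ) {n k : ℕ} (hk : 1 ≤ k) (hkn : k ≤ n)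
    (hnM : n ≤ M) : |fastKernel α T γ M s ω n k - l1Coeff α T γ M n k| ≤ ε := by
  have hM : 1 ≤ M := by omega
  rcases hkn.eq_or_lt with rfl | hkn
  · rw [fastKernel, if_pos rfl, sub_self, abs_zero]
    exact h.nonneg hT hγ hM
  have hi1 := (continuous_soe (s := s) (ω := ω) (timeNode T γ M n)).intervalIntegrable (μ := volume)
    (timeNode T γ M (k - 1)) (timeNode T γ M k)
  have hi2 := intervalIntegrable_sub_rpow hα1 (timeNode T γ M n)
    (timeNode T γ M (k - 1)) (timeNode T γ M k)
  rw [fastKernel, if_neg hkn.ne, l1Coeff, ← mul_sub, ← intervalIntegral.integral_sub hi1 hi2]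
  refine abs_le.2 (mean_mem_Icc (timeNode_lt hT hγ hM (by omega)) (hi1.sub hi2) fun y hy => ?_)
  have h1 : timeNode T γ M n - y ∈ Icc (T * (1 / (M : ℝ)) ^ γ) T := by
    have h2 := timeNode_one_le_timeStep (M := M) hT hγ (show 1 ≤ n by omega)
    have h3 := timeNode_mono (M := M) hT hγ (show k ≤ n - 1 by omega)
    have h4 := timeNode_le hT hγ hM hnM
    have h5 := timeNode_nonneg (γ := γ) (M := M) hT (k - 1)
    have h6 : timeNode T γ M 1 = T * (1 / (M : ℝ)) ^ γ := by rw [timeNode, Nat.cast_one]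
    rw [timeStep] at h2
    constructor <;> linarith [hy.1, hy.2]
  have := h.approx _ h1
  rw [abs_sub_comm] at this
  exact abs_le.1 this

/-- Between history cells, both sides are means of one increasing exponential sum. At the last cell
the exact coefficient takes over, and the gap `c₁ M^α` absorbs the error `ε`. -/
theorem fastKernel_le_succ (h : IsSOE α ε (T * (1 / (M : ℝ)) ^ γ) T K s ω)
    (hα1 : α < 1) (hT : 0 < T) (hγ : 1 ≤ γ) {c₁ : ℝ}
    (hc : IsGapConstant α T γ c₁) (hε : ε ≤ c₁ * (M : ℝ) ^ α) {n k : ℕ} (hk : 1 ≤ k)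
    (hkn : k < n) (hnM : n ≤ M) :
    fastKernel α T γ M s ω n k ≤ fastKernel α T γ M s ω n (k + 1) := by
  have hM : 1 ≤ M := by omega
  rcases (show k + 1 ≤ n from hkn).eq_or_lt with hkn1 | hkn1
  · have h1 := (abs_le.1 (abs_fastKernel_sub_le h hα1 hT hγ hk hkn.le hnM)).2
    have h2 := hc M n (by omega) hnM
    subst hkn1
    have e : fastKernel α T γ M s ω (k + 1) (k + 1) = l1Coeff α T γ M (k + 1) (k + 1) := if_pos rfl
    rw [Nat.add_sub_cancel] at h2
    rw [e]
    linarith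
  · have hmono : ∀ x y, x ≤ y → ∑ j, ω j * Real.exp (-s j * (timeNode T γ M n - x))
        ≤ ∑ j, ω j * Real.exp (-s j * (timeNode T γ M n - y)) := fun x y hxy => by
      refine Finset.sum_le_sum fun j _ => ?_
      have := h.weights_pos j
      have := h.points_pos j
      gcongr ω j * Real.exp ?_
      nlinarith
    have h1 := (mean_mem_Icc (timeNode_lt hT hγ hM (show k - 1 < k by omega))
      ((continuous_soe (s := s) (ω := ω) (timeNode T γ M n)).intervalIntegrable _ _)
      (fun y hy => ⟨hmono _ _ hy.1, hmono _ _ hy.2⟩)).2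
    have h2 := (mean_mem_Icc (timeNode_lt hT hγ hM (Nat.lt_succ_self k))
      ((continuous_soe (s := s) (ω := ω) (timeNode T γ M n)).intervalIntegrable _ _)
      (fun y hy => ⟨hmono _ _ hy.1, hmono _ _ hy.2⟩)).1
    rw [fastKernel, if_neg hkn.ne, fastKernel, if_neg hkn1.ne]
    exact h1.trans h2

/-- The exact coefficient is at least `τ_n^(-α)`, and `ε` takes away at most half of it because `τ_n
≤ T`. -/
theorem half_rpow_le_fastKernel_one (h : IsSOE α ε (T * (1 / (M : ℝ)) ^ γ) T K s ω)
    (hα : 0 < α) (hα1 : α < 1) (hT : 0 < T) (hγ : 1 ≤ γ) (hε : ε ≤ 1 / 2 * T ^ (-α)) {n : ℕ}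
    (hn : 1 ≤ n) (hnM : n ≤ M) :
    1 / 2 * timeNode T γ M n ^ (-α) ≤ fastKernel α T γ M s ω n 1 := by
  have hM : 1 ≤ M := by omega
  have htp := timeNode_pos (γ := γ) hT hM hn
  have h0 : 0 < timeNode T γ M n ^ (-α) := by positivity
  rcases hn.eq_or_lt with rfl | hn1
  · rw [fastKernel, if_pos rfl, l1Coeff_self hα1 hT hγ hM le_rfl, timeStep,
      show 1 - 1 = 0 from rfl, timeNode_zero hγ, sub_zero, le_div_iff₀ (by linarith)]
    nlinarith
  · have h1 := (abs_le.1 (abs_fastKernel_sub_le h hα1 hT hγ le_rfl hn hnM)).1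
    have h2 : timeNode T γ M n ^ (-α) ≤ l1Coeff α T γ M n 1 := by
      have := (mean_mem_Icc (timeNode_lt hT hγ hM (show 1 - 1 < 1 by omega))
        (intervalIntegrable_sub_rpow hα1 _ _ _)
        (kernel_mem_Icc hα (timeNode_lt hT hγ hM hn1))).1
      rwa [show 1 - 1 = 0 from rfl, timeNode_zero hγ, sub_zero, ← timeNode_zero hγ] at this
    have h3 : T ^ (-α) ≤ timeNode T γ M n ^ (-α) :=
      Real.rpow_le_rpow_of_nonpos htp (timeNode_le hT hγ hM hnM) (by linarith)
    linarith

/-- Truncation error of the fast L1 formula. -/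
theorem exists_fast_error_bound {A : ℝ} (hα : 0 < α) (hα1 : α < 1) (hT : 0 < T) (hγ : 1 ≤ γ)
    (hA : 0 ≤ A) :
    ∃ c : ℝ, 0 ≤ c ∧ ∀ (w w1 w2 : ℝ → ℝ), WeaklySingular α T A w w1 w2 →
      ∀ (M : ℕ) (ε : ℝ) (K : ℕ) (s ω : Fin K → ℝ), IsSOE α ε (T * (1 / (M : ℝ)) ^ γ) T K s ω →
      ∀ n : ℕ, 1 ≤ n → n ≤ M →
        |∑ k ∈ Finset.range n, fastKernel α T γ M s ω n (k + 1)
            * (w (timeNode T γ M (k + 1)) - w (timeNode T γ M k))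
          - ∫ y in (0 : ℝ)..timeNode T γ M n, (timeNode T γ M n - y) ^ (-α) * w1 y|
        ≤ c * ((n : ℝ) ^ (-min (γ * (1 + α)) (2 - α)) + ε) := by
  obtain ⟨c, hc, hc1⟩ := exists_l1_error_bound hα hα1 hT hγ hA
  refine ⟨c + A / α * T ^ α, by positivity, ?_⟩
  intro w w1 w2 hw M ε K s ω h n hn hnM
  have hM : 1 ≤ M := by omega
  have hε := h.nonneg hT hγ hM
  have h1 := hc1 w w1 w2 hw M n hn hnM
  -- The increments of `w` are dominated by those of `(A/α) τ^α`, which telescope; thus `ε` is not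
  -- multiplied by the number of levels.
  have h2 : |∑ k ∈ Finset.range n, fastKernel α T γ M s ω n (k + 1)
            * (w (timeNode T γ M (k + 1)) - w (timeNode T γ M k))
      - ∑ k ∈ Finset.range n, l1Coeff α T γ M n (k + 1)
            * (w (timeNode T γ M (k + 1)) - w (timeNode T γ M k))| ≤ ε * (A / α * T ^ α) := by
    rw [← Finset.sum_sub_distrib]
    calc _ ≤ ∑ k ∈ Finset.range n, ε * (A / α * (timeNode T γ M (k + 1) ^ α
            - timeNode T γ M k ^ α)) := by
          refine (Finset.abs_sum_le_sum_abs _ _).trans (Finset.sum_le_sum fun k hk => ?_)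
          have hk := Finset.mem_range.1 hk
          rw [← sub_mul, abs_mul]
          gcongr
          · exact abs_fastKernel_sub_le h hα1 hT hγ (by omega) (by omega) hnM
          · exact hw.abs_increment_le hα (timeNode_nonneg hT k) (timeNode_mono hT hγ (by omega))
              (timeNode_le hT hγ hM (by omega))
      _ = ε * (A / α * timeNode T γ M n ^ α) := by
          rw [← Finset.mul_sum, ← Finset.mul_sum,
            Finset.sum_range_sub (fun k => timeNode T γ M k ^ α), timeNode_zero hγ,
            Real.zero_rpow hα.ne', sub_zero]
      _ ≤ _ := by
          have := timeNode_nonneg (γ := γ) (M := M) hT n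
          gcongr
          exact timeNode_le hT hγ hM hnM
  have h3 := abs_sub_le (∑ k ∈ Finset.range n, fastKernel α T γ M s ω n (k + 1)
            * (w (timeNode T γ M (k + 1)) - w (timeNode T γ M k)))
    (∑ k ∈ Finset.range n, l1Coeff α T γ M n (k + 1)
            * (w (timeNode T γ M (k + 1)) - w (timeNode T γ M k)))
    (∫ y in (0 : ℝ)..timeNode T γ M n, (timeNode T γ M n - y) ^ (-α) * w1 y)
  have h4 : 0 ≤ c * ε := by positivity
  have h5 : 0 ≤ A / α * T ^ α * (n : ℝ) ^ (-min (γ * (1 + α)) (2 - α)) := by positivity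
  linarith

end FastFormula
end TemperedBS
end

namespace TemperedBS

/-! ### Taylor expansion in space and regularity in time -/

section Regularity
open Filter Topology

theorem hasDerivWithinAt_iteratedDerivWithin {f : ℝ → ℝ} {S : Set ℝ} {n m : ℕ}
    (hf : ContDiffOn ℝ n f S) (hS : UniqueDiffOn ℝ S) (hm : m < n) {x : ℝ} (hx : x ∈ S) :
    HasDerivWithinAt (iteratedDerivWithin m f S) (iteratedDerivWithin (m + 1) f S x) S x := by
  rw [iteratedDerivWithin_succ]
  exact ((hf.differentiableOn_iteratedDerivWithin (by exact_mod_cast hm) hS) x hx).hasDerivWithinAt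

/-- The Taylor remainder of a function on an interval, with base point anywhere in it. -/
theorem abs_taylor_remainder_le {a b C : ℝ} (n : ℕ) (F : ℕ → ℝ → ℝ)
    (hF : ∀ p < n, ∀ x ∈ Icc a b, HasDerivWithinAt (F p) (F (p + 1) x) (Icc a b) x)
    (hC : ∀ x ∈ Icc a b, |F n x| ≤ C) {x y : ℝ} (hx : x ∈ Icc a b) (hy : y ∈ Icc a b) :
    |F 0 y - ∑ p ∈ Finset.range n, F p x * (y - x) ^ p / p.factorial| ≤ C * |y - x| ^ n := by
  induction n generalizing F y with
  | zero => simpa using hC y hy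
  | succ n ih =>
    have hsub : uIcc x y ⊆ Icc a b := uIcc_subset_Icc hx hy
    -- The derivative of the remainder is the remainder of one lower order for the shifted family,
    -- so the mean value inequality drives the induction.
    have hd : ∀ z ∈ uIcc x y, HasDerivWithinAt
        (fun z => F 0 z - ∑ p ∈ Finset.range (n + 1), F p x * (z - x) ^ p / p.factorial)
        (F 1 z - ∑ p ∈ Finset.range n, F (p + 1) x * (z - x) ^ p / p.factorial) (uIcc x y) z := by
      intro z hz
      refine ((hF 0 (by omega) z (hsub hz)).mono hsub).sub ?_
      have hsum : ∀ p ∈ Finset.range (n + 1), HasDerivWithinAt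
          (fun z : ℝ => F p x * (z - x) ^ p / p.factorial)
          (F p x * (p * (z - x) ^ (p - 1)) / p.factorial) (uIcc x y) z := by
        intro p _
        have h1 := (((hasDerivWithinAt_id z (uIcc x y)).sub_const x).pow p)
        simp only [id, mul_one] at h1
        exact (h1.const_mul (F p x)).div_const _
      refine (HasDerivWithinAt.fun_sum hsum).congr_deriv ?_
      rw [Finset.sum_range_succ']
      simp only [Nat.cast_zero, zero_mul, mul_zero, zero_div, add_zero]
      refine Finset.sum_congr rfl fun p _ => ?_
      rw [Nat.factorial_succ, Nat.add_sub_cancel]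
      push_cast
      have : (p.factorial : ℝ) ≠ 0 := by positivity
      have : (p : ℝ) + 1 ≠ 0 := by positivity
      field_simp
    have hbd : ∀ z ∈ uIcc x y,
        ‖F 1 z - ∑ p ∈ Finset.range n, F (p + 1) x * (z - x) ^ p / p.factorial‖
          ≤ C * |y - x| ^ n := by
      intro z hz
      refine (ih (fun p => F (p + 1)) (fun p hp => hF (p + 1) (by omega)) hC (hsub hz)).trans ?_
      have hC0 : 0 ≤ C := (abs_nonneg _).trans (hC x hx)
      gcongr ?_ * ?_ ^ _
      exact abs_sub_left_of_mem_uIcc hz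
    have := Convex.norm_image_sub_le_of_norm_hasDerivWithin_le hd hbd (convex_uIcc x y)
      left_mem_uIcc right_mem_uIcc
    have h0 : F 0 x - ∑ p ∈ Finset.range (n + 1), F p x * (x - x) ^ p / p.factorial = 0 := by
      rw [Finset.sum_range_succ']
      simp
    rw [h0, sub_zero] at this
    rw [pow_succ, ← mul_assoc]
    exact this

/-- Fourth order consistency of the compact second difference. -/
theorem abs_compact_sub_le {a b C x h : ℝ} (F : ℕ → ℝ → ℝ)
    (hF : ∀ p < 6, ∀ x ∈ Icc a b, HasDerivWithinAt (F p) (F (p + 1) x) (Icc a b) x)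
    (hC : ∀ x ∈ Icc a b, |F 6 x| ≤ C) (hh : 0 < h) (hl : a ≤ x - h) (hr : x + h ≤ b) :
    |F 2 x + (F 2 (x + h) - 2 * F 2 x + F 2 (x - h)) / 12
      - (F 0 (x + h) - 2 * F 0 x + F 0 (x - h)) / h ^ 2| ≤ 3 * C * h ^ 4 := by
  have hx : x ∈ Icc a b := ⟨by linarith, by linarith⟩
  have hp : x + h ∈ Icc a b := ⟨by linarith, hr⟩
  have hm : x - h ∈ Icc a b := ⟨hl, by linarith⟩
  have h1 := abs_taylor_remainder_le 6 F hF hC hx hp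
  have h2 := abs_taylor_remainder_le 6 F hF hC hx hm
  have h3 := abs_taylor_remainder_le 4 (fun p => F (p + 2)) (fun p hp => hF (p + 2) (by omega)) hC
    hx hp
  have h4 := abs_taylor_remainder_le 4 (fun p => F (p + 2)) (fun p hp => hF (p + 2) (by omega)) hC
    hx hm
  have e1 : x + h - x = h := by ring
  have e2 : x - h - x = -h := by ring
  rw [e1, abs_of_pos hh] at h1 h3
  rw [e2, abs_neg, abs_of_pos hh] at h2 h4
  obtain ⟨r1, q1, h1⟩ : ∃ r, F 0 (x + h) = ∑ p ∈ Finset.range 6, F p x * h ^ p / p.factorial + r ∧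
    |r| ≤ C * h ^ 6 := ⟨_, (add_sub_cancel _ _).symm, h1⟩
  obtain ⟨r2, q2, h2⟩ : ∃ r, F 0 (x - h) = ∑ p ∈ Finset.range 6, F p x * (-h) ^ p / p.factorial + r ∧
    |r| ≤ C * h ^ 6 := ⟨_, (add_sub_cancel _ _).symm, h2⟩
  obtain ⟨r3, q3, h3⟩ : ∃ r, F 2 (x + h)
      = ∑ p ∈ Finset.range 4, F (p + 2) x * h ^ p / p.factorial + r ∧
    |r| ≤ C * h ^ 4 := ⟨_, (add_sub_cancel _ _).symm, h3⟩
  obtain ⟨r4, q4, h4⟩ : ∃ r, F 2 (x - h)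
      = ∑ p ∈ Finset.range 4, F (p + 2) x * (-h) ^ p / p.factorial + r ∧
    |r| ≤ C * h ^ 4 := ⟨_, (add_sub_cancel _ _).symm, h4⟩
  -- Odd terms cancel by symmetry, and the weight `1/12` matches the fourth derivative. Only the
  -- four remainders survive.
  have key : F 2 x + (F 2 (x + h) - 2 * F 2 x + F 2 (x - h)) / 12
      - (F 0 (x + h) - 2 * F 0 x + F 0 (x - h)) / h ^ 2 = (r3 + r4) / 12 - (r1 + r2) / h ^ 2 := by
    rw [q1, q2, q3, q4]
    simp only [Finset.sum_range_succ, Finset.sum_range_zero, zero_add, Nat.factorial]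
    push_cast
    field_simp
    ring
  have hC0 : 0 ≤ C := (abs_nonneg _).trans (hC x hx)
  have h5 : |(r1 + r2) / h ^ 2| ≤ 2 * C * h ^ 4 := by
    rw [abs_div, abs_of_pos (show 0 < h ^ 2 by positivity), div_le_iff₀ (by positivity)]
    have := abs_add_le r1 r2
    nlinarith
  have h6 : |(r3 + r4) / 12| ≤ C * h ^ 4 := by
    rw [abs_div, abs_of_pos (show (0 : ℝ) < 12 by norm_num), div_le_iff₀ (by norm_num)]
    have := abs_add_le r3 r4
    have : 0 ≤ C * h ^ 4 := by positivity
    linarith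
  rw [key]
  have := abs_sub ((r3 + r4) / 12) ((r1 + r2) / h ^ 2)
  linarith

variable {α lam T xl xr : ℝ} {v : ℝ → ℝ → ℝ}

theorem IsRegular.hasDerivWithinAt_partialX (hreg : IsRegular α T xl xr v) (hx : xl < xr)
    {τ : ℝ} (hτ : τ ∈ Ioc 0 T) {p : ℕ} (hp : p < 6) {x : ℝ} (hxm : x ∈ Icc xl xr) :
    HasDerivWithinAt (fun y => partialX xl xr v p y τ) (partialX xl xr v (p + 1) x τ)
      (Icc xl xr) x :=
  hasDerivWithinAt_iteratedDerivWithin (n := 6) (by exact_mod_cast hreg.smooth_space τ hτ)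
    (uniqueDiffOn_Icc hx) hp hxm

theorem IsRegular.hasDerivAt_partialT (hreg : IsRegular α T xl xr v) {x : ℝ}
    (hx : x ∈ Icc xl xr) {l : ℕ} (hl : l < 2) {t : ℝ} (ht : t ∈ Ioo 0 T) :
    HasDerivAt (fun s => partialT T v l x s) (partialT T v (l + 1) x t) t :=
  (hasDerivWithinAt_iteratedDerivWithin (n := 2) (by exact_mod_cast hreg.smooth_time x hx)
    (uniqueDiffOn_Ioc 0 T) hl ⟨ht.1, ht.2.le⟩).hasDerivAt (Ioc_mem_nhds ht.1 ht.2)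

/-- The tempered solution `e^{lam t} v(x, t)` is weakly singular, uniformly in `x`. -/
theorem IsRegular.exists_weaklySingular (hreg : IsRegular α T xl xr v) (hα1 : α < 1) (hα : 0 < α)
    (hlam : 0 ≤ lam) (hT : 0 < T) (hxx : xl < xr) :
    ∃ A : ℝ, 0 ≤ A ∧ ∀ x ∈ Icc xl xr, ∃ w2 : ℝ → ℝ,
      WeaklySingular α T A (fun s => Real.exp (lam * s) * v x s)
        (deriv fun s => Real.exp (lam * s) * v x s) w2 := by
  obtain ⟨C, hC⟩ := hreg.bounds
  have hC0 : 0 ≤ C := by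
    have := (hC xl ⟨le_rfl, hxx.le⟩ T ⟨hT, le_rfl⟩).1 0 (by omega)
    exact (abs_nonneg _).trans this
  set E := Real.exp (lam * T) with hE
  have hEp : 0 < E := Real.exp_pos _
  set U := T ^ (1 - α) with hU
  have hU0 : 0 < U := by positivity
  set V := C * (1 + T ^ α) with hV
  have hV0 : 0 ≤ V := by positivity
  set A1 := E * (lam * V * U + C * (U + 1)) with hA1
  set A2 := E * (lam ^ 2 * V * (U * T) + 2 * lam * (C * (U * T + T)) + C * (U * T + 1)) with hA2
  have hA10 : 0 ≤ A1 := by positivity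
  have hA20 : 0 ≤ A2 := by positivity
  refine ⟨A1 + A2, by positivity, fun x hx => ?_⟩
  set w1 : ℝ → ℝ := fun t => Real.exp (lam * t) * (lam * v x t + partialT T v 1 x t) with hw1
  set w2 : ℝ → ℝ := fun t => Real.exp (lam * t) * (lam ^ 2 * v x t + 2 * lam * partialT T v 1 x t
    + partialT T v 2 x t) with hw2
  have hexp : ∀ t : ℝ, HasDerivAt (fun s => Real.exp (lam * s)) (lam * Real.exp (lam * t)) t := by
    intro t
    refine (((hasDerivAt_id t).const_mul lam).exp).congr_deriv ?_
    simp [mul_comm]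
  have hv1 : ∀ t ∈ Ioo 0 T, HasDerivAt (v x) (partialT T v 1 x t) t := by
    intro t ht
    have := hreg.hasDerivAt_partialT hx (l := 0) (by omega) ht
    simpa [partialT] using this
  have hd1 : ∀ t ∈ Ioo 0 T, HasDerivAt (fun s => Real.exp (lam * s) * v x s) (w1 t) t := by
    intro t ht
    refine ((hexp t).mul (hv1 t ht)).congr_deriv ?_
    simp only [hw1]
    ring
  have hd2 : ∀ t ∈ Ioo 0 T, HasDerivAt w1 (w2 t) t := by
    intro t ht
    refine ((hexp t).mul (((hv1 t ht).const_mul lam).add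
      (hreg.hasDerivAt_partialT hx (l := 1) (by omega) ht))).congr_deriv ?_
    simp only [hw2, Pi.add_apply]
    ring
  have hderiv : ∀ t ∈ Ioo 0 T, deriv (fun s => Real.exp (lam * s) * v x s) t = w1 t :=
    fun t ht => (hd1 t ht).deriv
  -- On the bounded interval the less singular powers are absorbed by the most singular one: `1 ≤ U
  -- t^(α-1)` and `t^(α-1) ≤ T t^(α-2)`.
  have hbase : ∀ t ∈ Ioo 0 T, Real.exp (lam * t) ≤ E ∧ 1 ≤ U * t ^ (α - 1) ∧
      t ^ (α - 1) ≤ T * t ^ (α - 2) ∧ |v x t| ≤ V ∧ |partialT T v 1 x t| ≤ C * (1 + t ^ (α - 1)) ∧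
      |partialT T v 2 x t| ≤ C * (1 + t ^ (α - 2)) := by
    intro t ht
    have ht0 := ht.1
    have hb := (hC x hx t ⟨ht.1, ht.2.le⟩).2
    refine ⟨?_, ?_, ?_, ?_, ?_, ?_⟩
    · exact Real.exp_le_exp.2 (by have := ht.2.le; gcongr)
    · have : T ^ (α - 1) ≤ t ^ (α - 1) := Real.rpow_le_rpow_of_nonpos ht.1 ht.2.le (by linarith)
      calc (1 : ℝ) = U * T ^ (α - 1) := by
            rw [hU, ← Real.rpow_add hT]; norm_num
        _ ≤ _ := by gcongr
    · rw [show α - 1 = (α - 2) + 1 by ring, Real.rpow_add_one ht.1.ne', mul_comm]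
      have := ht.2.le
      gcongr
    · have := hb 0 (by omega)
      simp only [partialT, iteratedDerivWithin_zero, Nat.cast_zero, sub_zero] at this
      refine this.trans ?_
      have := ht.2.le
      simp only [hV]
      gcongr
    · simpa using hb 1 (by omega)
    · simpa using hb 2 (by omega)
  refine ⟨w2, ⟨?_, ?_, ?_, ?_, ?_⟩⟩
  · exact ContinuousOn.mul (by fun_prop) (hreg.continuous_time x hx)
  · intro t ht
    rw [hderiv t ht]
    exact hd1 t ht
  · intro t ht
    refine (hd2 t ht).congr_of_eventuallyEq ?_
    filter_upwards [Ioo_mem_nhds ht.1 ht.2] with s hs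
    exact hderiv s hs
  · intro t ht
    obtain ⟨h1, h2, h3, h4, h5, h6⟩ := hbase t ht
    have ht0 := ht.1
    have hP : 0 < t ^ (α - 1) := by positivity
    rw [hderiv t ht, hw1]
    simp only
    rw [abs_mul, abs_of_pos (Real.exp_pos _)]
    calc _ ≤ E * (lam * V * (U * t ^ (α - 1)) + C * (U * t ^ (α - 1) + t ^ (α - 1))) := by
          gcongr
          refine (abs_add_le _ _).trans (add_le_add ?_ (h5.trans (by gcongr)))
          rw [abs_mul, abs_of_nonneg hlam]
          calc lam * |v x t| ≤ lam * V * 1 := by rw [mul_one]; gcongr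
            _ ≤ _ := by gcongr
      _ = A1 * t ^ (α - 1) := by rw [hA1]; ring
      _ ≤ _ := by gcongr; linarith
  · intro t ht
    obtain ⟨h1, h2, h3, h4, h5, h6⟩ := hbase t ht
    have ht0 := ht.1
    have hQ : 0 < t ^ (α - 2) := by positivity
    have h7 : 1 ≤ U * T * t ^ (α - 2) := by
      rw [mul_assoc]
      exact h2.trans (by gcongr)
    simp only [hw2]
    rw [abs_mul, abs_of_pos (Real.exp_pos _)]
    calc _ ≤ E * (lam ^ 2 * V * (U * T * t ^ (α - 2))
            + 2 * lam * (C * (U * T * t ^ (α - 2) + T * t ^ (α - 2)))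
            + C * (U * T * t ^ (α - 2) + t ^ (α - 2))) := by
          gcongr
          refine (abs_add_le _ _).trans (add_le_add ((abs_add_le _ _).trans (add_le_add ?_ ?_))
            (h6.trans (by gcongr)))
          · rw [abs_mul, abs_of_nonneg (show 0 ≤ lam ^ 2 by positivity)]
            calc lam ^ 2 * |v x t| ≤ lam ^ 2 * V * 1 := by rw [mul_one]; gcongr
              _ ≤ _ := by gcongr
          · rw [abs_mul, abs_of_nonneg (show 0 ≤ 2 * lam by positivity)]
            gcongr
            exact h5.trans (by gcongr)
      _ = A2 * t ^ (α - 2) := by rw [hA2]; ring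
      _ ≤ _ := by gcongr; linarith

end Regularity

/-! ### The equation at the spatial end points -/

section Boundary
open Filter Topology

variable {α lam σ q T xl xr : ℝ} {g v : ℝ → ℝ → ℝ} {v₀ : ℝ → ℝ}

theorem le_at_zero_of_le_on_Ioc {f : ℝ → ℝ} {C : ℝ} (hT : 0 < T) (hf : ContinuousOn f (Icc 0 T))
    (h : ∀ s ∈ Ioc 0 T, f s ≤ C) : ∀ s ∈ Icc 0 T, f s ≤ C := by
  intro s hs
  rcases hs.1.eq_or_lt with rfl | hs0
  · have hne : (𝓝[Ioc 0 T] (0 : ℝ)).NeBot := by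
      rw [← mem_closure_iff_nhdsWithin_neBot, closure_Ioc hT.ne]
      exact ⟨le_rfl, hT.le⟩
    have ht : Tendsto f (𝓝[Ioc 0 T] 0) (𝓝 (f 0)) :=
      (hf 0 ⟨le_rfl, hT.le⟩).mono_left (nhdsWithin_mono _ Ioc_subset_Icc_self)
    refine le_of_tendsto ht ?_
    filter_upwards [self_mem_nhdsWithin] with s hs
    exact h s hs
  · exact h s ⟨hs0, hs.2⟩

theorem IsRegular.boundary_eq_zero (hreg : IsRegular α T xl xr v) (hT : 0 < T) {b : ℝ}
    (hb : b ∈ Icc xl xr) (hz : ∀ τ ∈ Ioc 0 T, v b τ = 0) : ∀ s ∈ Icc 0 T, v b s = 0 := by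
  intro s hs
  have := le_at_zero_of_le_on_Ioc (C := 0) hT (hreg.continuous_time b hb).abs
    (fun s hs => by rw [hz s hs, abs_zero]) s hs
  exact abs_nonpos_iff.1 this

theorem IsRegular.exists_lipschitz (hreg : IsRegular α T xl xr v) (hT : 0 < T) (hx : xl < xr) :
    ∃ C : ℝ, 0 ≤ C ∧ ∀ s ∈ Icc 0 T, ∀ x ∈ Icc xl xr, ∀ y ∈ Icc xl xr,
      |v x s - v y s| ≤ C * |x - y| := by
  obtain ⟨C, hC⟩ := hreg.bounds
  have hC0 : 0 ≤ C :=
    (abs_nonneg _).trans ((hC xl ⟨le_rfl, hx.le⟩ T ⟨hT, le_rfl⟩).1 0 (by omega))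
  refine ⟨C, hC0, fun s hs x hxm y hym => ?_⟩
  refine le_at_zero_of_le_on_Ioc hT
    ((hreg.continuous_time x hxm).sub (hreg.continuous_time y hym)).abs (fun τ hτ => ?_) s hs
  have h := Convex.norm_image_sub_le_of_norm_hasDerivWithin_le (s := Icc xl xr) (C := C)
    (fun z hz => hreg.hasDerivWithinAt_partialX hx hτ (p := 0) (by omega) hz)
    (fun z hz => (hC z hz τ hτ).1 1 (by omega)) (convex_Icc _ _) hym hxm
  simpa [partialX] using h

theorem temperedCaputo_eq_zero {u : ℝ → ℝ} {τ : ℝ} (hτ : 0 ≤ τ) (hu : ∀ s ∈ Ioo 0 τ, u s = 0) :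
    temperedCaputo α lam u τ = 0 := by
  rw [temperedCaputo]
  have : ∫ η in (0 : ℝ)..τ, (τ - η) ^ (-α) * deriv (fun s => Real.exp (lam * s) * u s) η = 0 := by
    have hne : ∀ᵐ s : ℝ, s ≠ τ := by simp [MeasureTheory.ae_iff, MeasureTheory.measure_singleton]
    apply intervalIntegral.integral_zero_ae
    filter_upwards [hne] with s hs hsm
    rw [uIoc_of_le hτ] at hsm
    have hsm2 : s ∈ Ioo 0 τ := ⟨hsm.1, lt_of_le_of_ne hsm.2 hs⟩
    have : (fun s => Real.exp (lam * s) * u s) =ᶠ[𝓝 s] fun _ => 0 := by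
      filter_upwards [Ioo_mem_nhds hsm2.1 hsm2.2] with r hr
      rw [hu r hr, mul_zero]
    rw [this.deriv_eq, deriv_const, mul_zero]
  rw [this, mul_zero]

/-- Near `b` the solution is `O(|x - b|)` uniformly in time, while the constant `A` of its
singularity does not depend on `x`. Taking `δ = |x - b|` in `WeaklySingular.abs_integral_kernel_le`
gives `O(|x - b|^(1-α))`. -/
theorem tendsto_temperedCaputo_boundary (hreg : IsRegular α T xl xr v) (hα : 0 < α) (hα1 : α < 1)
    (hlam : 0 ≤ lam) (hT : 0 < T) (hx : xl < xr) {b : ℝ} (hb : b ∈ Icc xl xr)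
    (hz : ∀ τ ∈ Ioc 0 T, v b τ = 0) {τ : ℝ} (hτ : τ ∈ Ioc 0 T) :
    Tendsto (fun x => temperedCaputo α lam (v x) τ) (𝓝[Icc xl xr \ {b}] b) (𝓝 0) := by
  obtain ⟨C, hC0, hC⟩ := hreg.exists_lipschitz hT hx
  obtain ⟨A, hA, hw⟩ := hreg.exists_weaklySingular hα1 hα hlam hT hx
  have hτ0 := hτ.1
  have hvb := hreg.boundary_eq_zero hT hb hz
  set G := |Real.exp (-lam * τ) / Real.Gamma (1 - α)| with hG
  set K := 2 * (Real.exp (lam * T) * C) + A * (τ / 2) ^ (α - 1) / (1 - α) with hK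
  have hbound : ∀ x ∈ Icc xl xr, x ≠ b → |x - b| ≤ τ / 2 →
      |temperedCaputo α lam (v x) τ| ≤ G * (K * |x - b| ^ (1 - α)) := by
    intro x hxm hxb hxτ
    obtain ⟨w2, hw2⟩ := hw x hxm
    have hδ : 0 < |x - b| := abs_pos.2 (sub_ne_zero.2 hxb)
    have h := hw2.abs_integral_kernel_le hα hα1 hτ.2 hδ hxτ
      (η := Real.exp (lam * T) * (C * |x - b|)) (fun s hs => by
        have hs2 : s ∈ Icc 0 T := ⟨hs.1, hs.2.trans hτ.2⟩
        have := hC s hs2 x hxm b hb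
        rw [hvb s hs2, sub_zero] at this
        rw [abs_mul, abs_of_pos (Real.exp_pos _)]
        gcongr
        exact hs2.2)
    rw [temperedCaputo, abs_mul]
    refine mul_le_mul_of_nonneg_left (h.trans_eq ?_) (abs_nonneg _)
    rw [hK, show (1 - α) = -α + 1 by ring, Real.rpow_add_one hδ.ne']
    ring
  have hlim : Tendsto (fun x => G * (K * |x - b| ^ (1 - α))) (𝓝[Icc xl xr \ {b}] b) (𝓝 0) := by
    have h1 : ContinuousAt (fun x => G * (K * |x - b| ^ (1 - α))) b := by
      refine continuousAt_const.mul (continuousAt_const.mul (ContinuousAt.rpow_const ?_ ?_))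
      · fun_prop
      · exact Or.inr (by linarith)
    have h2 := h1.tendsto
    rw [sub_self, abs_zero, Real.zero_rpow (by linarith), mul_zero, mul_zero] at h2
    exact h2.mono_left nhdsWithin_le_nhds
  refine squeeze_zero_norm' ?_ hlim
  have hnear : ∀ᶠ x in 𝓝[Icc xl xr \ {b}] b, |x - b| ≤ τ / 2 := by
    have : Metric.closedBall b (τ / 2) ∈ 𝓝 b := Metric.closedBall_mem_nhds b (by positivity)
    filter_upwards [nhdsWithin_le_nhds this] with x hx
    rwa [Metric.mem_closedBall, Real.dist_eq] at hx
  filter_upwards [self_mem_nhdsWithin, hnear] with x hxm hxn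
  exact hbound x hxm.1 hxm.2 hxn

/-- The differential equation extends to the boundary. -/
theorem IsSolution.pde_closed (hv : IsSolution α lam σ q T xl xr g v₀ v)
    (hreg : IsRegular α T xl xr v) (hα : 0 < α) (hα1 : α < 1)
    (hlam : 0 ≤ lam) (hT : 0 < T) (hx : xl < xr)
    (hg : ∀ τ ∈ Ioc 0 T, ContinuousOn (fun x => g x τ) (Icc xl xr)) :
    ∀ x ∈ Icc xl xr, ∀ τ ∈ Ioc 0 T, temperedCaputo α lam (v x) τ
      = σ ^ 2 / 2 * partialX xl xr v 2 x τ - q * v x τ + g x τ := by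
  have hbd : ∀ b ∈ Icc xl xr, (∀ τ ∈ Ioc 0 T, v b τ = 0) → b ∉ Ioo xl xr →
      ∀ τ ∈ Ioc 0 T, temperedCaputo α lam (v b) τ
        = σ ^ 2 / 2 * partialX xl xr v 2 b τ - q * v b τ + g b τ := by
    intro b hb hz hbo τ hτ
    rw [temperedCaputo_eq_zero hτ.1.le fun s hs => hz s ⟨hs.1, hs.2.le.trans hτ.2⟩]
    have hsub : Ioo xl xr ⊆ Icc xl xr \ {b} := fun x hxm =>
      ⟨Ioo_subset_Icc_self hxm, fun h => hbo (h ▸ hxm)⟩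
    have hne : (𝓝[Ioo xl xr] b).NeBot := by
      rw [← mem_closure_iff_nhdsWithin_neBot, closure_Ioo hx.ne]
      exact hb
    have h1 : Tendsto (fun x => temperedCaputo α lam (v x) τ) (𝓝[Ioo xl xr] b) (𝓝 0) :=
      (tendsto_temperedCaputo_boundary hreg hα hα1 hlam hT hx hb hz hτ).mono_left
        (nhdsWithin_mono _ hsub)
    have hc2 : ContinuousWithinAt (fun y => partialX xl xr v 2 y τ) (Icc xl xr) b :=
      (hreg.hasDerivWithinAt_partialX hx hτ (p := 2) (by omega) hb).continuousWithinAt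
    have hc0 : ContinuousWithinAt (fun y => v y τ) (Icc xl xr) b :=
      (hreg.smooth_space τ hτ).continuousOn b hb
    have h2 : Tendsto (fun x => σ ^ 2 / 2 * partialX xl xr v 2 x τ - q * v x τ + g x τ)
        (𝓝[Ioo xl xr] b) (𝓝 (σ ^ 2 / 2 * partialX xl xr v 2 b τ - q * v b τ + g b τ)) :=
      (((hc2.const_mul _).sub (hc0.const_mul _)).add (hg τ hτ b hb)).tendsto.mono_left
        (nhdsWithin_mono _ Ioo_subset_Icc_self)
    refine tendsto_nhds_unique h1 (h2.congr' ?_)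
    filter_upwards [self_mem_nhdsWithin] with x hxm
    exact (hv.pde x hxm τ hτ).symm
  intro x hxm τ hτ
  by_cases hxo : x ∈ Ioo xl xr
  · exact hv.pde x hxo τ hτ
  · refine hbd x hxm ?_ hxo τ hτ
    rcases hxm.1.eq_or_lt with rfl | h1
    · exact hv.bdry_left
    rcases hxm.2.eq_or_lt with rfl | h2
    · exact hv.bdry_right
    exact absurd ⟨h1, h2⟩ hxo

end Boundary

/-! ### Truncation error of the full scheme -/

section Truncation

variable {α lam σ q T γ xl xr : ℝ} {g v : ℝ → ℝ → ℝ} {v₀ : ℝ → ℝ}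

theorem gridSize_pos (hx : xl < xr) {N : ℕ} (hN : 1 ≤ N) : 0 < gridSize xl xr N := by
  have : 0 < xr - xl := sub_pos.2 hx
  unfold gridSize
  positivity

theorem spaceNode_self {N : ℕ} (hN : 1 ≤ N) : spaceNode xl xr N N = xr := by
  have : (N : ℝ) ≠ 0 := by positivity
  rw [spaceNode, gridSize]
  field_simp
  ring

theorem spaceNode_zero (N : ℕ) : spaceNode xl xr N 0 = xl := by simp [spaceNode]

theorem spaceNode_mem (hx : xl < xr) {N j : ℕ} (hN : 1 ≤ N) (hj : j ≤ N) :
    spaceNode xl xr N j ∈ Icc xl xr := by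
  have hh := gridSize_pos hx hN
  constructor
  · rw [spaceNode]
    have : 0 ≤ (j : ℝ) * gridSize xl xr N := by positivity
    linarith
  · refine le_of_le_of_eq ?_ (spaceNode_self (xl := xl) (xr := xr) hN)
    unfold spaceNode
    gcongr

/-- At interior nodes the operator is the convex average with weights `1/12, 10/12, 1/12`. -/
theorem abs_compactOp_le {N : ℕ} {h r : ℝ} (hh : 0 < h) {u : ℕ → ℝ} (hu : ∀ j ≤ N, |u j| ≤ r) {i : ℕ}
    (hi : 1 ≤ i) (hiN : i < N) : |compactOp N h u i| ≤ r := by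
  rw [compactOp, if_pos ⟨hi, hiN⟩, secondDiff]
  have e : u i + h ^ 2 / 12 * ((u (i + 1) - 2 * u i + u (i - 1)) / h ^ 2)
      = (10 * u i + u (i + 1) + u (i - 1)) / 12 := by
    field_simp
    ring
  rw [e]
  have h1 := abs_le.1 (hu i hiN.le)
  have h2 := abs_le.1 (hu (i + 1) (by omega))
  have h3 := abs_le.1 (hu (i - 1) (by omega))
  rw [abs_le]
  constructor <;> linarith

/-- Eliminating `g` by the equation splits the defect into the average of the temporal error `r` and
`σ²/2` times the spatial error `d`. -/
theorem exists_truncation_bound (hv : IsSolution α lam σ q T xl xr g v₀ v)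
    (hreg : IsRegular α T xl xr v) (hα : 0 < α) (hα1 : α < 1) (hlam : 0 ≤ lam) (hT : 0 < T)
    (hγ : 1 ≤ γ) (hx : xl < xr)
    (hg : ∀ τ ∈ Ioc 0 T, ContinuousOn (fun x => g x τ) (Icc xl xr)) :
    ∃ c : ℝ, 0 ≤ c ∧ ∀ M N : ℕ, 1 ≤ M → 1 ≤ N → ∀ (ε : ℝ) (K : ℕ) (s ω : Fin K → ℝ),
      IsSOE α ε (T * (1 / (M : ℝ)) ^ γ) T K s ω →
      ∀ n i : ℕ, 1 ≤ n → n ≤ M → 1 ≤ i → i < N →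
        |truncation α lam σ q T γ xl xr g v M N s ω n i|
          ≤ c * ((n : ℝ) ^ (-min (γ * (1 + α)) (2 - α)) + gridSize xl xr N ^ 4 + ε) := by
  obtain ⟨A, hA, hw⟩ := hreg.exists_weaklySingular hα1 hα hlam hT hx
  obtain ⟨c, hc, hc1⟩ := exists_fast_error_bound hα hα1 hT hγ hA
  obtain ⟨C, hC⟩ := hreg.bounds
  have hC0 : 0 ≤ C :=
    (abs_nonneg _).trans ((hC xl ⟨le_rfl, hx.le⟩ T ⟨hT, le_rfl⟩).1 0 (by omega))
  have hΓ : 0 < Real.Gamma (1 - α) := Real.Gamma_pos_of_pos (by linarith)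
  refine ⟨1 / Real.Gamma (1 - α) * c + σ ^ 2 / 2 * (3 * C), by positivity, ?_⟩
  intro M N hM hN ε K s ω hsoe n i hn hnM hi hiN
  set h := gridSize xl xr N with hh
  have hhp : 0 < h := gridSize_pos hx hN
  set X := spaceNode xl xr N with hX
  set t := timeNode T γ M n with ht
  have htm : t ∈ Ioc 0 T := ⟨timeNode_pos hT hM hn, timeNode_le hT hγ hM hnM⟩
  have hXm : ∀ j ≤ N, X j ∈ Icc xl xr := fun j hj => spaceNode_mem hx hN hj
  have hε := hsoe.nonneg hT hγ hM
  set r : ℕ → ℝ := fun j => fastCaputo α lam T γ M s ω (fun m => v (X j) (timeNode T γ M m)) n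
    - temperedCaputo α lam (v (X j)) t with hr
  have hrb : ∀ j ≤ N, |r j| ≤ 1 / Real.Gamma (1 - α)
      * (c * ((n : ℝ) ^ (-min (γ * (1 + α)) (2 - α)) + ε)) := by
    intro j hj
    obtain ⟨w2, hw2⟩ := hw (X j) (hXm j hj)
    have h1 := hc1 _ _ _ hw2 M ε K s ω hsoe n hn hnM
    simp only [hr]
    rw [fastCaputo_eq_sum _ hn, temperedCaputo, ← mul_sub, abs_mul]
    have h2 : |Real.exp (-lam * t) / Real.Gamma (1 - α)| ≤ 1 / Real.Gamma (1 - α) := by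
      rw [abs_of_pos (by positivity)]
      gcongr
      rw [Real.exp_le_one_iff]
      have := mul_nonneg hlam htm.1.le
      linarith
    gcongr
  set d : ℝ := partialX xl xr v 2 (X i) t + (partialX xl xr v 2 (X i + h) t
    - 2 * partialX xl xr v 2 (X i) t + partialX xl xr v 2 (X i - h) t) / 12
      - (v (X i + h) t - 2 * v (X i) t + v (X i - h) t) / h ^ 2 with hd
  have hXp : X (i + 1) = X i + h := by
    simp only [hX, spaceNode]; push_cast; ring
  have hXs : X (i - 1) = X i - h := by
    simp only [hX, spaceNode]; rw [Nat.cast_sub hi]; push_cast; ring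
  have hdb : |d| ≤ 3 * C * h ^ 4 := by
    have h1 := abs_compact_sub_le (C := C) (x := X i) (h := h)
      (fun p y => partialX xl xr v p y t)
      (fun p hp y hy => hreg.hasDerivWithinAt_partialX hx htm hp hy)
      (fun y hy => (hC y hy t htm).1 6 le_rfl) hhp
      (by rw [← hXs]; exact (hXm _ (by omega)).1) (by rw [← hXp]; exact (hXm _ (by omega)).2)
    have e0 : ∀ y, partialX xl xr v 0 y t = v y t := fun y => by simp [partialX]
    simp only [e0] at h1
    exact h1
  -- The end points `j = 0` and `j = N` are included: averaging at the outermost interior nodes uses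
  -- `g` there.
  have hpde : ∀ j ≤ N, g (X j) t = temperedCaputo α lam (v (X j)) t
      - σ ^ 2 / 2 * partialX xl xr v 2 (X j) t + q * v (X j) t := fun j hj => by
    rw [hv.pde_closed hreg hα hα1 hlam hT hx hg (X j) (hXm j hj) t htm]
    ring
  have key : truncation α lam σ q T γ xl xr g v M N s ω n i
      = compactOp N h r i + σ ^ 2 / 2 * d := by
    simp only [truncation, compactOp, if_pos (And.intro hi hiN), secondDiff, ← hh, ← hX, ← ht]
    rw [hpde i hiN.le, hpde (i + 1) (by omega), hpde (i - 1) (by omega)]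
    simp only [hr, hd, ← hXp, ← hXs]
    field_simp
    ring
  have h1 := abs_compactOp_le hhp hrb hi hiN
  have h2 : |σ ^ 2 / 2 * d| ≤ σ ^ 2 / 2 * (3 * C * h ^ 4) := by
    rw [abs_mul, abs_of_nonneg (by positivity)]
    gcongr
  rw [key]
  refine (abs_add_le _ _).trans ((add_le_add h1 h2).trans ?_)
  set y := (n : ℝ) ^ (-min (γ * (1 + α)) (2 - α)) with hy
  have hy0 : 0 ≤ y := by positivity
  have h3 : 0 ≤ 1 / Real.Gamma (1 - α) * c * h ^ 4 := by positivity
  have h4 : 0 ≤ σ ^ 2 / 2 * (3 * C) * (y + ε) := by positivity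
  linarith

end Truncation


/-! ### Error equation and convergence -/

section ErrorEstimate

variable {α lam σ q T γ xl xr ε : ℝ} {g v : ℝ → ℝ → ℝ} {v₀ : ℝ → ℝ} {M N K : ℕ}
  {s ω : Fin K → ℝ} {w : ℕ → ℕ → ℝ}

/-- Multiplication by `Γ(1-α) e^{lam τ_n}`, with `e^{lam τ} (v - w)` as unknown, removes the
tempering and gives the form required by `exists_stability_constant`. -/
theorem error_equation (hα1 : α < 1) (hw : IsFastSchemeSolution α lam σ q T γ xl xr g v₀ M N s ω w)
    {n i : ℕ} (hn : 1 ≤ n) (hnM : n ≤ M) (hi : 1 ≤ i) (hiN : i < N) :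
    compactOp N (gridSize xl xr N) (fun j =>
        ∑ k ∈ Finset.range n, fastKernel α T γ M s ω n (k + 1) *
          (Real.exp (lam * timeNode T γ M (k + 1)) *
              (v (spaceNode xl xr N j) (timeNode T γ M (k + 1)) - w (k + 1) j)
            - Real.exp (lam * timeNode T γ M k) *
              (v (spaceNode xl xr N j) (timeNode T γ M k) - w k j))
        + Real.Gamma (1 - α) * q * (Real.exp (lam * timeNode T γ M n) *
              (v (spaceNode xl xr N j) (timeNode T γ M n) - w n j))) i
      - Real.Gamma (1 - α) * (σ ^ 2 / 2) * secondDiff (gridSize xl xr N)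
          (fun j => Real.exp (lam * timeNode T γ M n) *
              (v (spaceNode xl xr N j) (timeNode T γ M n) - w n j)) i
      = Real.Gamma (1 - α) * Real.exp (lam * timeNode T γ M n) *
          truncation α lam σ q T γ xl xr g v M N s ω n i := by
  have hΓ : Real.Gamma (1 - α) ≠ 0 := (Real.Gamma_pos_of_pos (by linarith)).ne'
  set E := Real.exp (lam * timeNode T γ M n) with hE
  have hE0 : E ≠ 0 := (Real.exp_pos _).ne'
  have hEn : Real.exp (-lam * timeNode T γ M n) = E⁻¹ := by
    rw [hE, ← Real.exp_neg]; congr 1; ring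
  have hsum : ∀ j, ∑ k ∈ Finset.range n, fastKernel α T γ M s ω n (k + 1) *
          (Real.exp (lam * timeNode T γ M (k + 1)) *
              (v (spaceNode xl xr N j) (timeNode T γ M (k + 1)) - w (k + 1) j)
            - Real.exp (lam * timeNode T γ M k) *
              (v (spaceNode xl xr N j) (timeNode T γ M k) - w k j))
      = Real.Gamma (1 - α) * E * (fastCaputo α lam T γ M s ω
          (fun m => v (spaceNode xl xr N j) (timeNode T γ M m)) n
        - fastCaputo α lam T γ M s ω (fun m => w m j) n) := by
    intro j
    rw [fastCaputo_eq_sum _ hn, fastCaputo_eq_sum _ hn, ← mul_sub, ← Finset.sum_sub_distrib, hEn]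
    field_simp
    exact Finset.sum_congr rfl fun k _ => by ring
  have h1 := hw.scheme n i hn hnM hi hiN
  simp only [truncation, compactOp, if_pos (And.intro hi hiN), secondDiff, hsum] at h1 ⊢
  linear_combination (-(Real.Gamma (1 - α) * E)) * h1

/-- With `β = min (γα) (2-α)`, the weight contributes at most `(n/M)^β`, and `(n/M)^β n^(-β) =
M^(-β)`. Large local errors at early times are thus compensated by small `τ_n^α`. -/
theorem timeNode_rpow_mul_le (hα : 0 < α) (hα1 : α < 1) (hT : 0 < T) {n : ℕ} {y : ℝ}
    (hn : 1 ≤ n) (hnM : n ≤ M) (hγ : 1 ≤ γ) (hy : 0 ≤ y) :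
    timeNode T γ M n ^ α * ((n : ℝ) ^ (-min (γ * (1 + α)) (2 - α)) + y)
      ≤ T ^ α * ((M : ℝ) ^ (-min (γ * α) (2 - α)) + y) := by
  have hM : 1 ≤ M := hn.trans hnM
  have hn1 : (1 : ℝ) ≤ n := by exact_mod_cast hn
  have hn0 : (0 : ℝ) < n := by linarith
  have hM0 : (0 : ℝ) < M := by positivity
  set β := min (γ * α) (2 - α) with hβ
  have hβ0 : 0 < β := lt_min (by positivity) (by linarith)
  have hβle : β ≤ min (γ * (1 + α)) (2 - α) := min_le_min (by nlinarith) le_rfl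
  have h1 : (n : ℝ) ^ (-min (γ * (1 + α)) (2 - α)) ≤ (n : ℝ) ^ (-β) :=
    Real.rpow_le_rpow_of_exponent_le hn1 (by linarith)
  have hr : (n : ℝ) / M ≤ 1 := by rw [div_le_one hM0]; exact_mod_cast hnM
  have h2 : timeNode T γ M n ^ α = T ^ α * ((n : ℝ) / M) ^ (γ * α) := by
    rw [timeNode, Real.mul_rpow hT.le (by positivity), ← Real.rpow_mul (by positivity)]
  have h3 : ((n : ℝ) / M) ^ (γ * α) ≤ ((n : ℝ) / M) ^ β :=
    Real.rpow_le_rpow_of_exponent_ge (by positivity) hr (min_le_left _ _)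
  have h4 : ((n : ℝ) / M) ^ β ≤ 1 := Real.rpow_le_one (by positivity) hr hβ0.le
  have h5 : ((n : ℝ) / M) ^ β * (n : ℝ) ^ (-β) = (M : ℝ) ^ (-β) := by
    rw [Real.div_rpow hn0.le hM0.le, Real.rpow_neg hn0.le, Real.rpow_neg hM0.le]
    have : (n : ℝ) ^ β ≠ 0 := by positivity
    field_simp
  rw [h2, mul_assoc]
  gcongr
  calc _ ≤ ((n : ℝ) / M) ^ β * ((n : ℝ) ^ (-β) + y) := by gcongr
    _ ≤ _ := by
      rw [mul_add, h5]
      gcongr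
      exact mul_le_of_le_one_left hy h4

/-- The factor is the stability constant times `e^{lam T}`, the bound for the weight on the
residual. The factor `2` in the estimate comes from the lower bound `τ_n^(-α)/2` for the first
kernel coefficient. -/
theorem exists_error_factor (hα : 0 < α) (hα1 : α < 1) (hlam : 0 ≤ lam) (hT : 0 < T)
    (hx : xl < xr) (hγ : 1 ≤ γ) (hq : 0 ≤ q)
    (hv : IsSolution α lam σ q T xl xr g v₀ v) (hreg : IsRegular α T xl xr v) :
    ∃ C : ℝ, 0 < C ∧ ∀ c : ℝ, 0 ≤ c → ∀ c₁ : ℝ, IsGapConstant α T γ c₁ →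
      ∀ M N : ℕ, 1 ≤ M → 1 ≤ N → ∀ (ε : ℝ) (K : ℕ) (s ω : Fin K → ℝ),
        IsSOE α ε (T * (1 / (M : ℝ)) ^ γ) T K s ω →
        ε ≤ min (c₁ * (M : ℝ) ^ α) (1 / 2 * T ^ (-α)) →
      (∀ n i : ℕ, 1 ≤ n → n ≤ M → 1 ≤ i → i < N →
        |truncation α lam σ q T γ xl xr g v M N s ω n i|
          ≤ c * ((n : ℝ) ^ (-min (γ * (1 + α)) (2 - α)) + gridSize xl xr N ^ 4 + ε)) →
      ∀ w : ℕ → ℕ → ℝ, IsFastSchemeSolution α lam σ q T γ xl xr g v₀ M N s ω w →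
      ∀ n : ℕ, 1 ≤ n → n ≤ M → ∀ i ≤ N,
        |v (spaceNode xl xr N i) (timeNode T γ M n) - w n i|
          ≤ 2 * Real.Gamma (1 - α) * (C * c) * T ^ α *
            ((M : ℝ) ^ (-min (γ * α) (2 - α)) + gridSize xl xr N ^ 4 + ε) := by
  obtain ⟨C, hC, hstab⟩ := exists_stability_constant
  refine ⟨C * Real.exp (lam * T), by positivity, ?_⟩
  intro c hc c₁ hc₁ M N hM hN ε K s ω hsoe hε htr w hw n hn hnM i hiN
  have hΓ : 0 < Real.Gamma (1 - α) := Real.Gamma_pos_of_pos (by linarith)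
  have hε0 := hsoe.nonneg hT hγ hM
  have hh := gridSize_pos hx hN
  have hτ0 : timeNode T γ M 0 = 0 := timeNode_zero hγ
  have hmem : ∀ n ≤ M, timeNode T γ M n ∈ Icc 0 T := fun n hn =>
    ⟨timeNode_nonneg hT n, timeNode_le hT hγ hM hn⟩
  have hbl := hreg.boundary_eq_zero hT (left_mem_Icc.2 hx.le) hv.bdry_left
  have hbr := hreg.boundary_eq_zero hT (right_mem_Icc.2 hx.le) hv.bdry_right
  have hl : ∀ n ≤ M, v (spaceNode xl xr N 0) (timeNode T γ M n) - w n 0 = 0 := fun n hn => by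
    rw [spaceNode_zero, hbl _ (hmem n hn), hw.bdry_left n hn, sub_zero]
  have hr : ∀ n ≤ M, v (spaceNode xl xr N N) (timeNode T γ M n) - w n N = 0 := fun n hn => by
    rw [spaceNode_self hN, hbr _ (hmem n hn), hw.bdry_right n hn, sub_zero]
  have hinit : ∀ i ≤ N, v (spaceNode xl xr N i) (timeNode T γ M 0) - w 0 i = 0 := by
    intro i hi
    rcases Nat.eq_zero_or_pos i with rfl | hi0
    · exact hl 0 (Nat.zero_le _)
    rcases hi.eq_or_lt with rfl | hiN
    · exact hr 0 (Nat.zero_le _)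
    have hmi : spaceNode xl xr N i ∈ Ioo xl xr := by
      have h0 : (0 : ℝ) < i := by exact_mod_cast hi0
      have h1 : (i : ℝ) < N := by exact_mod_cast hiN
      have h2 := spaceNode_self (xl := xl) (xr := xr) hN
      simp only [spaceNode] at h2 ⊢
      exact ⟨by nlinarith, by nlinarith⟩
    rw [hτ0, hv.init _ hmi, hw.init i hi0 hiN, sub_self]
  set H := gridSize xl xr N with hH
  have hbound : ∀ n, 1 ≤ n → n ≤ M → 0 < fastKernel α T γ M s ω n 1 := fun n hn hnM =>
    lt_of_lt_of_le (by have := timeNode_pos (γ := γ) hT hM hn; positivity)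
      (half_rpow_le_fastKernel_one hsoe hα hα1 hT hγ (hε.trans (min_le_right _ _)) hn hnM)
  have key := hstab M N H (fastKernel α T γ M s ω)
    (fun n i => Real.exp (lam * timeNode T γ M n) *
      (v (spaceNode xl xr N i) (timeNode T γ M n) - w n i))
    (fun n i => Real.Gamma (1 - α) * Real.exp (lam * timeNode T γ M n) *
      truncation α lam σ q T γ xl xr g v M N s ω n i)
    (fun n => Real.Gamma (1 - α) * Real.exp (lam * T) *
      (c * ((n : ℝ) ^ (-min (γ * (1 + α)) (2 - α)) + H ^ 4 + ε)))
    (Real.Gamma (1 - α) * q) (Real.Gamma (1 - α) * (σ ^ 2 / 2))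
    (2 * Real.Gamma (1 - α) * (C * Real.exp (lam * T) * c) * T ^ α *
      ((M : ℝ) ^ (-min (γ * α) (2 - α)) + H ^ 4 + ε))
    hN hh (by positivity) (by positivity)
    (fun i hi => by simp only [hinit i hi, mul_zero])
    (fun n hn => by simp only [hl n hn, mul_zero])
    (fun n hn => by simp only [hr n hn, mul_zero])
    hbound
    (fun n k hk hkn hnM =>
      fastKernel_le_succ hsoe hα1 hT hγ hc₁ (hε.trans (min_le_left _ _)) hk hkn hnM)
    (fun n i hn hnM hi hiN => error_equation hα1 hw hn hnM hi hiN)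
    (fun n hn hnM => by positivity)
    (fun n i hn hnM hi hiN => by
      rw [abs_mul, abs_of_pos (by positivity)]
      have h1 := (hmem n hnM).2
      have h2 := htr n i hn hnM hi hiN
      gcongr)
    (fun n hn hnM => by
      have h1 := half_rpow_le_fastKernel_one hsoe hα hα1 hT hγ
        (hε.trans (min_le_right _ _)) hn hnM
      have h2 := timeNode_rpow_mul_le (y := H ^ 4 + ε) hα hα1 hT hn hnM hγ (by positivity)
      rw [← add_assoc, ← add_assoc] at h2
      have ht := timeNode_pos (γ := γ) hT hM hn
      rw [Real.rpow_neg ht.le] at h1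
      have hta : 0 < timeNode T γ M n ^ α := by positivity
      set a := timeNode T γ M n ^ α
      set X := (n : ℝ) ^ (-min (γ * (1 + α)) (2 - α)) + H ^ 4 + ε
      have hG : 0 ≤ C * Real.Gamma (1 - α) * Real.exp (lam * T) * c := by positivity
      calc _ = 1 / 2 * a⁻¹ * (2 * (C * Real.Gamma (1 - α) * Real.exp (lam * T) * c)) * (a * X) := by
            field_simp
        _ ≤ 1 / 2 * a⁻¹ * (2 * (C * Real.Gamma (1 - α) * Real.exp (lam * T) * c))
            * (T ^ α * ((M : ℝ) ^ (-min (γ * α) (2 - α)) + H ^ 4 + ε)) := by gcongr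
        _ = 1 / 2 * a⁻¹ * (2 * Real.Gamma (1 - α) * (C * Real.exp (lam * T) * c) * T ^ α *
            ((M : ℝ) ^ (-min (γ * α) (2 - α)) + H ^ 4 + ε)) := by ring
        _ ≤ _ := by gcongr)
    n hn hnM i hiN
  -- The exponential weight on the error is at least `1` and can be dropped.
  refine le_trans ?_ key
  rw [abs_mul, Real.abs_exp]
  refine le_mul_of_one_le_left (abs_nonneg _) (Real.one_le_exp ?_)
  exact mul_nonneg hlam (hmem n hnM).1

end ErrorEstimate

end TemperedBS

/-! ### The main theorem -/

theorem theorem4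
    (α lam σ r D T xl xr γ : ℝ)
    (hα₀ : 0 < α) (hα₁ : α < 1) (hlam : 0 ≤ lam) (hσ : 0 < σ) (hr : 0 < r) (hD : 0 ≤ D)
    (hT : 0 < T) (hx : xl < xr) (hγ : 1 ≤ γ)
    (c q : ℝ) (hc : c = r - D - σ ^ 2 / 2) (hq : q = c ^ 2 / (2 * σ ^ 2) + r)
    (g : ℝ → ℝ → ℝ) (v₀ : ℝ → ℝ) (v : ℝ → ℝ → ℝ)
    (hg : ∀ τ ∈ Set.Ioc 0 T, ContinuousOn (fun x => g x τ) (Set.Icc xl xr))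
    (hv : TemperedBS.IsSolution α lam σ q T xl xr g v₀ v)
    (hreg : TemperedBS.IsRegular α T xl xr v) :
    (∃ c₁ : ℝ, 0 < c₁ ∧ TemperedBS.IsGapConstant α T γ c₁) ∧
    ∃ c₃ : ℝ, 0 < c₃ ∧
      (∀ M N : ℕ, 1 ≤ M → 1 ≤ N →
        ∀ (ε : ℝ) (K : ℕ) (s ω : Fin K → ℝ),
          TemperedBS.IsSOE α ε (T * (1 / (M : ℝ)) ^ γ) T K s ω →
        ∀ n i : ℕ, 1 ≤ n → n ≤ M → 1 ≤ i → i < N →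
          |TemperedBS.truncation α lam σ q T γ xl xr g v M N s ω n i|
            ≤ c₃ * ((n : ℝ) ^ (-min (γ * (1 + α)) (2 - α))
                + TemperedBS.gridSize xl xr N ^ 4 + ε)) ∧
      ∀ c₁ : ℝ, TemperedBS.IsGapConstant α T γ c₁ →
      ∀ M N : ℕ, 1 ≤ M → 1 ≤ N →
      ∀ (ε : ℝ) (K : ℕ) (s ω : Fin K → ℝ),
        TemperedBS.IsSOE α ε (T * (1 / (M : ℝ)) ^ γ) T K s ω →
        ε ≤ min (c₁ * (M : ℝ) ^ α) (1 / 2 * T ^ (-α)) →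
      ∀ w : ℕ → ℕ → ℝ,
        TemperedBS.IsFastSchemeSolution α lam σ q T γ xl xr g v₀ M N s ω w →
      ∀ n : ℕ, 1 ≤ n → n ≤ M →
        TemperedBS.maxNorm N
            (fun i => v (TemperedBS.spaceNode xl xr N i) (TemperedBS.timeNode T γ M n) - w n i)
          ≤ 2 * Real.Gamma (1 - α) * c₃ * T ^ α *
              ((M : ℝ) ^ (-min (γ * α) (2 - α)) + TemperedBS.gridSize xl xr N ^ 4 + ε) := by

  have hq0 : 0 ≤ q := by rw [hq]; positivity
  refine ⟨TemperedBS.exists_gapConstant hα₀ hα₁ hT hγ, ?_⟩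
  obtain ⟨ca, hca, htr⟩ := TemperedBS.exists_truncation_bound (γ := γ) hv hreg hα₀ hα₁ hlam hT hγ hx hg
  obtain ⟨C, hC, herr⟩ :=
    TemperedBS.exists_error_factor (γ := γ) hα₀ hα₁ hlam hT hx hγ hq0 hv hreg
  have hH : ∀ N : ℕ, 0 ≤ TemperedBS.gridSize xl xr N ^ 4 := fun N => by positivity
  -- One constant serves both statements: `ca` bounds the truncation error, `C * ca` the global
  -- error, and `1` ensures positivity.
  refine ⟨ca + C * ca + 1, by positivity, ?_, ?_⟩
  · intro M N hM hN ε K s ω hsoe n i hn hnM hi hiN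
    have hε := hsoe.nonneg hT hγ hM
    have := hH N
    refine (htr M N hM hN ε K s ω hsoe n i hn hnM hi hiN).trans ?_
    gcongr
    have : 0 ≤ C * ca := by positivity
    linarith
  · intro c₁ hc₁ M N hM hN ε K s ω hsoe hε w hw n hn hnM
    have hε0 := hsoe.nonneg hT hγ hM
    have := hH N
    have hΓ : 0 < Real.Gamma (1 - α) := Real.Gamma_pos_of_pos (by linarith)
    refine Finset.sup'_le _ _ fun i hi => ?_
    refine (herr ca hca c₁ hc₁ M N hM hN ε K s ω hsoe hε (htr M N hM hN ε K s ω hsoe) w hw n hn hnM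
      i (Nat.lt_succ_iff.1 (Finset.mem_range.1 hi))).trans ?_
    gcongr
    linarith
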